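/- Let $\mathfrak{sl}_4=\mathfrak{sl}_4(\mathbb C)$, let $PGL_4=PGL_4(\mathbb C)$ act by conjugation on the Grassmannian $G(3,\mathfrak{sl}_4)$ of three-dimensional subspaces of $\mathfrak{sl}_4$, let $Ab(4)\subset G(3,\mathfrak{sl}_4)$ be the set of three-dimensional abelian Lie subalgebras, and let $Red(4)$ be the Zariski closure in $G(3,\mathfrak{sl}_4)$ of the set of Cartan subalgebras of $\mathfrak{sl}_4$. Then $Red(4)=Ab(4)$, and this variety is the union of exactly $14$ pairwise distinct $PGL_4$-orbits, namely the orbits of the following algebras of matrices (in each of them $a,b,c,d$ are arbitrary complex numbers for which the trace vanishes; rows are separated by semicolons): - $\mathcal O_{12}$: $(a,0,0,0;\,0,b,0,0;\,0,0,c,0;\,0,0,0,d)$ - $\mathcal O_{11}$: $(a,b,0,0;\,0,a,0,0;\,0,0,c,0;\,0,0,0,d)$ - $\mathcal O'_{10}$: $(a,b,0,0;\,0,a,0,0;\,0,0,c,d;\,0,0,0,c)$ - $\mathcal O''_{10}$: $(a,b,c,0;\,0,a,b,0;\,0,0,a,0;\,0,0,0,d)$ - $\mathcal O_{9}$: $(0,a,b,c;\,0,0,a,b;\,0,0,0,a;\,0,0,0,0)$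 - $\mathcal O_{8}$: $(0,a,b,c;\,0,0,0,a;\,0,0,0,b;\,0,0,0,0)$ - $\mathcal O'_{8}$: $(c,b,a,0;\,0,c,0,0;\,0,0,c,0;\,0,0,0,d)$ - $\mathcal O''_{8}$: $(c,0,a,0;\,0,c,b,0;\,0,0,c,0;\,0,0,0,d)$ - $\mathcal O'_{7}$: $(0,a,b,c;\,0,0,0,a;\,0,0,0,0;\,0,0,0,0)$ - $\mathcal O''_{7}$: $(0,0,a,c;\,0,0,0,b;\,0,0,0,a;\,0,0,0,0)$ - $\mathcal O_{7}$: $(0,0,a,b;\,0,0,b,c;\,0,0,0,0;\,0,0,0,0)$ - $\mathcal O_{6}$: $(0,0,a,b;\,0,0,0,c;\,0,0,0,0;\,0,0,0,0)$ - $\mathcal O'_{3}$: $(0,a,b,c;\,0,0,0,0;\,0,0,0,0;\,0,0,0,0)$ - $\mathcal O''_{3}$: $(0,0,0,c;\,0,0,0,b;\,0,0,0,a;\,0,0,0,0)$ An orbit $\mathcal O'$ is contained in the Zariski closure of an orbit $\mathcal O$ if and only if $\mathcal O'$ can be reached from $\mathcal O$ by a (possibly empty) chain of the following arrows: $\mathcal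 O_{12}\to\mathcal O_{11}$; $\mathcal O_{11}\to\mathcal O'_{10},\mathcal O''_{10}$; $\mathcal O'_{10}\to\mathcal O_9$; $\mathcal O''_{10}\to\mathcal O_9,\mathcal O'_8,\mathcal O''_8$; $\mathcal O_9\to\mathcal O_8,\mathcal O_7$; $\mathcal O_8\to\mathcal O'_7,\mathcal O''_7$; $\mathcal O'_8\to\mathcal O'_7$; $\mathcal O''_8\to\mathcal O''_7$; $\mathcal O_7\to\mathcal O_6$; $\mathcal O'_7\to\mathcal O_6,\mathcal O'_3$; $\mathcal O''_7\to\mathcal O_6,\mathcal O''_3$. Exactly three of the orbits are Zariski closed, $\mathcal O'_3$, $\mathcal O''_3$ and $\mathcal O_6$; as varieties with an action of $PGL_4$ they are isomorphic respectively to the projective space $\mathbb P^3$ of lines of $\mathbb C^4$, to the dual projective space $\check{\mathbb P}^3$ of hyperplanes of $\mathbb C^4$, and to the variety $\mathbb F_4$ of complete flags of $\mathbb C^4$. -/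

import Mathlib

open scoped MatrixGroups

noncomputable section

/-! ## Grassmannians, homogeneous coordinates, the Zariski topology and regular maps -/

/-- The Grassmannian `G(k, V)` of `k`-dimensional subspaces of a complex vector space `V`. -/
def Grass (k : ℕ) (V : Type) [AddCommGroup V] [Module ℂ V] : Type :=
  {W : Submodule ℂ V // Module.finrank ℂ W = k}

/-- The homogeneous coordinate vectors of the points of a (multi-)projective variety `X`:
`coords x` is the set of all vectors of homogeneous coordinates of the point `x`. -/
class HomogeneousCoordinates (X : Type) (σ : outParam Type) where
  coords : X → Set (σ → ℂ)

open HomogeneousCoordinates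

/-- Pluecker coordinates. For each alternating `k`-form `ω` on `V` there is a coordinate, whose
value on the subspace with basis `w 0, ..., w (k - 1)` is `ω (w 0, ..., w (k - 1))`;
a change of basis multiplies all the coordinates by its determinant. -/
instance Grass.homogeneousCoordinates (k : ℕ) (V : Type) [AddCommGroup V] [Module ℂ V] :
    HomogeneousCoordinates (Grass k V) (V [⋀^Fin k]→ₗ[ℂ] ℂ) where
  coords W := {p | ∃ w : Fin k → V, LinearIndependent ℂ w ∧
    Submodule.span ℂ (Set.range w) = W.1 ∧ ∀ ω : V [⋀^Fin k]→ₗ[ℂ] ℂ, p ω = ω w}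

/-- Multihomogeneous coordinates on a product: the coordinates of both factors, each of which
may be rescaled independently. -/
instance Prod.homogeneousCoordinates (X Y σ τ : Type) [HomogeneousCoordinates X σ]
    [HomogeneousCoordinates Y τ] : HomogeneousCoordinates (X × Y) (σ ⊕ τ) where
  coords x := {p | (fun i => p (Sum.inl i)) ∈ coords x.1 ∧ (fun j => p (Sum.inr j)) ∈ coords x.2}

section Zariski

variable {X Y σ τ : Type} [HomogeneousCoordinates X σ] [HomogeneousCoordinates Y τ]

/-- A polynomial vanishes at a point if it vanishes at all coordinate vectors of that point
(equivalently, all its (multi-)homogeneous components vanish at that point). -/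
def VanishesAt (P : MvPolynomial σ ℂ) (x : X) : Prop :=
  ∀ p ∈ coords x, MvPolynomial.eval p P = 0

/-- The Zariski closure of `A`: the common zeros of all the polynomials in the homogeneous
coordinates that vanish on `A`. -/
def zariskiClosure (A : Set X) : Set X :=
  {x | ∀ P : MvPolynomial σ ℂ, (∀ y ∈ A, VanishesAt P y) → VanishesAt P x}

/-- Zariski closed sets. -/
def IsZariskiClosed (A : Set X) : Prop := zariskiClosure A = A

/-- A map between subsets `A` and `B` of (multi-)projective varieties is regular if, locally for
the Zariski topology on `A`, homogeneous coordinates of the image point are given by polynomials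
in the homogeneous coordinates of the point. -/
def IsRegularMap {A : Set X} {B : Set Y} (f : A → B) : Prop :=
  ∀ x : A, ∃ U : Set X, IsZariskiClosed Uᶜ ∧ (x : X) ∈ U ∧
    ∃ F : τ → MvPolynomial σ ℂ, ∀ y : A, (y : X) ∈ U → ∀ p ∈ coords (y : X),
      (fun i => MvPolynomial.eval p (F i)) ∈ coords (f y : Y)

/-- `A` and `B` are isomorphic as algebraic varieties, by an isomorphism that is compatible with
the actions of `G` on the ambient varieties. -/
def EquivariantlyIsomorphic (G : Type) [Group G] [MulAction G X] [MulAction G Y]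
    (A : Set X) (B : Set Y) : Prop :=
  ∃ e : A ≃ B, IsRegularMap e ∧ IsRegularMap e.symm ∧
    ∀ (g : G) (x y : A), g • (x : X) = (y : X) → g • (e x : Y) = (e y : Y)

end Zariski

/-! ## The action of `PGL₄` -/

/-- Linear automorphisms of `V` act on `G(k, V)`, by taking images of subspaces. -/
instance Grass.mulActionLinearEquiv (k : ℕ) (V : Type) [AddCommGroup V] [Module ℂ V] :
    MulAction (V ≃ₗ[ℂ] V) (Grass k V) where
  smul e W := ⟨W.1.map (e : V →ₗ[ℂ] V), (LinearEquiv.finrank_map_eq e W.1).trans W.2⟩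
  one_smul W := Subtype.ext (Submodule.map_id W.1)
  mul_smul e f W := Subtype.ext (Submodule.map_comp (f : V →ₗ[ℂ] V) (e : V →ₗ[ℂ] V) W.1)

/-- The space `ℂ⁴`. -/
abbrev C4 : Type := Fin 4 → ℂ

/-- The Lie algebra `𝔰𝔩₄` of complex `4 × 4` matrices of trace zero. -/
abbrev sl4 : Type := LieAlgebra.SpecialLinear.sl (Fin 4) ℂ

/-- The natural action of `GL₄` on `ℂ⁴`. -/
def standardRep : GL (Fin 4) ℂ →* (C4 ≃ₗ[ℂ] C4) :=
  (LinearMap.GeneralLinearGroup.generalLinearEquiv ℂ C4).toMonoidHom.comp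
    (Matrix.GeneralLinearGroup.toLin (n := Fin 4) (R := ℂ)).toMonoidHom

theorem conj_mem_sl4 (g : GL (Fin 4) ℂ) (x : sl4) :
    (g : Matrix (Fin 4) (Fin 4) ℂ) * x.1 * ((g⁻¹ : GL (Fin 4) ℂ) : Matrix (Fin 4) (Fin 4) ℂ) ∈
      LieAlgebra.SpecialLinear.sl (Fin 4) ℂ := by
  have hx : Matrix.trace x.1 = 0 := x.2
  change Matrix.trace ((g : Matrix (Fin 4) (Fin 4) ℂ) * x.1 *
    ((g⁻¹ : GL (Fin 4) ℂ) : Matrix (Fin 4) (Fin 4) ℂ)) = 0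
  rw [Matrix.trace_units_conj, hx]

/-- The action of `g ∈ GL₄` on `𝔰𝔩₄` by conjugation, `x ↦ g x g⁻¹`. -/
def conjLinearMap (g : GL (Fin 4) ℂ) : sl4 →ₗ[ℂ] sl4 where
  toFun x := ⟨g * x.1 * ((g⁻¹ : GL (Fin 4) ℂ) : Matrix (Fin 4) (Fin 4) ℂ), conj_mem_sl4 g x⟩
  map_add' x y := Subtype.ext (by
    change _ * (x.1 + y.1) * _ = _ * x.1 * _ + _ * y.1 * _
    rw [mul_add, add_mul])
  map_smul' c x := Subtype.ext (by
    change _ * (c • x.1) * _ = c • (_ * x.1 * _)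
    rw [Matrix.mul_smul, Matrix.smul_mul])

theorem conjLinearMap_mul (g h : GL (Fin 4) ℂ) (x : sl4) :
    conjLinearMap (g * h) x = conjLinearMap g (conjLinearMap h x) :=
  Subtype.ext (by simp [conjLinearMap, mul_assoc])

theorem conjLinearMap_one (x : sl4) : conjLinearMap 1 x = x :=
  Subtype.ext (by simp [conjLinearMap])

/-- Conjugation by `g` as a linear automorphism of `𝔰𝔩₄`. -/
def conjEquiv (g : GL (Fin 4) ℂ) : sl4 ≃ₗ[ℂ] sl4 :=
  LinearEquiv.ofLinearMap (conjLinearMap g) (conjLinearMap g⁻¹)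
    (LinearMap.ext fun x => by
      change conjLinearMap g (conjLinearMap g⁻¹ x) = x
      rw [← conjLinearMap_mul, mul_inv_cancel, conjLinearMap_one])
    (LinearMap.ext fun x => by
      change conjLinearMap g⁻¹ (conjLinearMap g x) = x
      rw [← conjLinearMap_mul, inv_mul_cancel, conjLinearMap_one])

theorem conjEquiv_apply (g : GL (Fin 4) ℂ) (x : sl4) : conjEquiv g x = conjLinearMap g x := rfl

/-- The adjoint action of `GL₄` on `𝔰𝔩₄`. -/
def adjointRep : GL (Fin 4) ℂ →* (sl4 ≃ₗ[ℂ] sl4) where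
  toFun := conjEquiv
  map_one' := by
    apply LinearEquiv.ext
    intro x
    rw [conjEquiv_apply, conjLinearMap_one, LinearEquiv.coe_one, id]
  map_mul' g h := by
    apply LinearEquiv.ext
    intro x
    rw [LinearEquiv.mul_apply, conjEquiv_apply, conjEquiv_apply, conjEquiv_apply,
      conjLinearMap_mul]

instance Grass.mulActionGLStandard (k : ℕ) : MulAction (GL (Fin 4) ℂ) (Grass k C4) :=
  MulAction.compHom _ standardRep

instance Grass.mulActionGLAdjoint (k : ℕ) : MulAction (GL (Fin 4) ℂ) (Grass k sl4) :=
  MulAction.compHom _ adjointRep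

/-- `PGL₄` acts on the subspaces of `ℂ⁴`. -/
instance Grass.mulActionPGLStandard (k : ℕ) : MulAction PGL(Fin 4, ℂ) (Grass k C4) :=
  Matrix.ProjGenLinGroup.mulActionOfGL fun u W => by
    apply Subtype.ext
    have h : ∀ v : C4, standardRep (Matrix.GeneralLinearGroup.scalar (Fin 4) u) v = (u : ℂ) • v := by
      intro v
      change Matrix.mulVecLin _ v = _
      simp [Matrix.GeneralLinearGroup.scalar]
    change W.1.map _ = W.1
    ext v
    constructor
    · rintro ⟨w, hw, rfl⟩
      have : standardRep (Matrix.GeneralLinearGroup.scalar (Fin 4) u) w ∈ W.1 := by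
        rw [h]; exact W.1.smul_mem _ hw
      exact this
    · intro hv
      refine ⟨(u⁻¹ : ℂ) • v, W.1.smul_mem _ hv, ?_⟩
      have : standardRep (Matrix.GeneralLinearGroup.scalar (Fin 4) u) ((u⁻¹ : ℂ) • v) = v := by
        rw [h, smul_smul, mul_inv_cancel₀ u.ne_zero, one_smul]
      exact this

/-- `PGL₄` acts on the subspaces of `𝔰𝔩₄` by conjugation. -/
instance Grass.mulActionPGLAdjoint (k : ℕ) : MulAction PGL(Fin 4, ℂ) (Grass k sl4) :=
  Matrix.ProjGenLinGroup.mulActionOfGL fun u W => by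
    apply Subtype.ext
    have h : conjLinearMap (Matrix.GeneralLinearGroup.scalar (Fin 4) u) = LinearMap.id := by
      refine LinearMap.ext fun x => Subtype.ext ?_
      change (Matrix.GeneralLinearGroup.scalar (Fin 4) u : Matrix (Fin 4) (Fin 4) ℂ) * x.1 * _ = x.1
      have hc : (Matrix.GeneralLinearGroup.scalar (Fin 4) u : Matrix (Fin 4) (Fin 4) ℂ) * x.1 =
          x.1 * (Matrix.GeneralLinearGroup.scalar (Fin 4) u : Matrix (Fin 4) (Fin 4) ℂ) := by
        ext i j
        simp [Matrix.GeneralLinearGroup.scalar, mul_comm]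
      rw [hc, mul_assoc, ← Units.val_mul, mul_inv_cancel]
      simp
    change W.1.map (conjLinearMap (Matrix.GeneralLinearGroup.scalar (Fin 4) u)) = W.1
    rw [h, Submodule.map_id]

/-! ## Abelian subalgebras and reductions -/

/-- `Ab(4)`: the three-dimensional abelian subalgebras of `𝔰𝔩₄`. -/
def Ab4 : Set (Grass 3 sl4) :=
  {W | ∃ L : LieSubalgebra ℂ sl4, IsLieAbelian L ∧ L.toSubmodule = W.1}

/-- The Cartan subalgebras of `𝔰𝔩₄`, as points of `G(3, 𝔰𝔩₄)`. -/
def CartanPoints : Set (Grass 3 sl4) :=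
  {W | ∃ H : LieSubalgebra ℂ sl4, H.IsCartanSubalgebra ∧ H.toSubmodule = W.1}

/-- The variety of reductions `Red(4)`: the Zariski closure of the set of Cartan subalgebras. -/
def Red4 : Set (Grass 3 sl4) := zariskiClosure CartanPoints

/-! ## The projective space, its dual and the variety of complete flags -/

/-- `ℙ³`: the lines of `ℂ⁴`. -/
def P3 : Set (Grass 1 C4) := Set.univ

/-- The dual projective space: the hyperplanes of `ℂ⁴`. -/
def P3Dual : Set (Grass 3 C4) := Set.univ

/-- The variety of complete flags of `ℂ⁴`. -/
def Flags4 : Set (Grass 1 C4 × Grass 2 C4 × Grass 3 C4) :=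
  {F | F.1.1 ≤ F.2.1.1 ∧ F.2.1.1 ≤ F.2.2.1}

/-! ## The orbits and their degenerations -/

/-- Labels of the orbits. The number in a label is the dimension of the orbit. -/
inductive OrbitType : Type
  | O12 | O11 | O10' | O10'' | O9 | O8 | O8' | O8'' | O7' | O7'' | O7 | O6 | O3' | O3''

open OrbitType in
/-- The matrices of the algebra that represents an orbit; the condition that the trace is zero
is not included. -/
def normalForm (o : OrbitType) (a b c d : ℂ) : Matrix (Fin 4) (Fin 4) ℂ :=
  match o with
  | O12 => !![a, 0, 0, 0; 0, b, 0, 0; 0, 0, c, 0; 0, 0, 0, d]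
  | O11 => !![a, b, 0, 0; 0, a, 0, 0; 0, 0, c, 0; 0, 0, 0, d]
  | O10' => !![a, b, 0, 0; 0, a, 0, 0; 0, 0, c, d; 0, 0, 0, c]
  | O10'' => !![a, b, c, 0; 0, a, b, 0; 0, 0, a, 0; 0, 0, 0, d]
  | O9 => !![0, a, b, c; 0, 0, a, b; 0, 0, 0, a; 0, 0, 0, 0]
  | O8 => !![0, a, b, c; 0, 0, 0, a; 0, 0, 0, b; 0, 0, 0, 0]
  | O8' => !![c, b, a, 0; 0, c, 0, 0; 0, 0, c, 0; 0, 0, 0, d]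
  | O8'' => !![c, 0, a, 0; 0, c, b, 0; 0, 0, c, 0; 0, 0, 0, d]
  | O7' => !![0, a, b, c; 0, 0, 0, a; 0, 0, 0, 0; 0, 0, 0, 0]
  | O7'' => !![0, 0, a, c; 0, 0, 0, b; 0, 0, 0, a; 0, 0, 0, 0]
  | O7 => !![0, 0, a, b; 0, 0, b, c; 0, 0, 0, 0; 0, 0, 0, 0]
  | O6 => !![0, 0, a, b; 0, 0, 0, c; 0, 0, 0, 0; 0, 0, 0, 0]
  | O3' => !![0, a, b, c; 0, 0, 0, 0; 0, 0, 0, 0; 0, 0, 0, 0]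
  | O3'' => !![0, 0, 0, c; 0, 0, 0, b; 0, 0, 0, a; 0, 0, 0, 0]

open OrbitType in
/-- The arrows of the degeneration diagram. -/
inductive Arrow : OrbitType → OrbitType → Prop
  | a1 : Arrow O12 O11
  | a2 : Arrow O11 O10'
  | a3 : Arrow O11 O10''
  | a4 : Arrow O10' O9
  | a5 : Arrow O10'' O9
  | a6 : Arrow O10'' O8'
  | a7 : Arrow O10'' O8''
  | a8 : Arrow O9 O8
  | a9 : Arrow O9 O7
  | a10 : Arrow O8 O7'
  | a11 : Arrow O8 O7''
  | a12 : Arrow O8' O7'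
  | a13 : Arrow O8'' O7''
  | a14 : Arrow O7 O6
  | a15 : Arrow O7' O6
  | a16 : Arrow O7'' O6
  | a17 : Arrow O7' O3'
  | a18 : Arrow O7'' O3''

end

/-!
Three-dimensional abelian subalgebras of `𝔰𝔩₄` are spaces of commuting matrices, and these can be
brought to a normal form by linear algebra. A commuting family either splits `ℂ⁴` into two invariant
summands, on which commuting families of dimension at most three are classified, or consists of
nilpotent matrices up to scalars. In the nilpotent case the normal form is decided by the largest
power that does not vanish identically: a single Jordan block forces the polynomials in it; if all
cubes vanish but some square does not, a chain `x² v, x v, v` is completed to a basis; if all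
squares vanish, polarization makes all products vanish, and what remains is a space of maps from
`ℂ⁴` modulo the common image to that image. This is `exists_mem_orbit_normalAlgebra`.

For each arrow of the diagram an explicit one-parameter family, constant up to conjugation away from
the parameter `0`, degenerates one normal form to the other, since Plücker coordinates depend
continuously on the parameter (`orbit_subset_closure_of_family`). In particular every normal form is
in the closure of the orbit of the diagonal matrices. These are Cartan subalgebras, and conversely
Cartan subalgebras are abelian because `𝔰𝔩₄`, having a faithful irreducible representation on which
it acts without trace, is a Killing Lie algebra. Commuting is a closed condition, so the two
varieties agree (`ab4_eq_red4`).

That there are no other degenerations is seen from conditions on a subspace `W` of `𝔰𝔩₄` that are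
invariant and closed: the trace form is degenerate on `W`, certain traces of powers vanish on `W`,
`W v` or `α W` has dimension at most two for all vectors `v` or functionals `α`, all `2 × 2` minors
are degenerate quadratic forms on `W`, all of them vanish, or `W` is commutative. They are closed by
`forall_mem_eq_zero_of_mem_zariskiClosure`: Cramer's rule turns Plücker coordinates into elements of
the subspace. Their values on the normal forms separate all the pairs not linked by a chain of
arrows (`reflTransGen_of_mem_closure_orbit`). As the degeneration relation is a partial order, the
orbits are distinct, and the closed ones are those from which no arrow starts.

The three closed orbits consist of the algebras of matrices that map `ℂ⁴` to a subspace `U` and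
kill `U`, where `U` is a line or a hyperplane, or `U` is the plane of a complete flag and the
matrices map the hyperplane of the flag to the line. Such an algebra has bases of matrices
`u ↦ φ u • v` of rank one. Here `v` and `φ` come from Cramer's rule and are polynomial in the
Plücker coordinates of the line, hyperplane or flag. Conversely the line, the hyperplane and the
members of the flag are spanned by vectors that are polynomial in the Plücker coordinates of the
algebra. Both directions are instances of `HasSections`, and
`equivariantlyIsomorphic_of_hasSections` turns them into an isomorphism of varieties.
-/

open HomogeneousCoordinates

noncomputable section

/-! ### Polynomial functions of homogeneous coordinates -/

section Polynomial

variable {σ : Type}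

/-- A function of the coordinate vector that is given by a polynomial. -/
def IsPolyFun (f : (σ → ℂ) → ℂ) : Prop :=
  ∃ P : MvPolynomial σ ℂ, ∀ p, MvPolynomial.eval p P = f p

namespace IsPolyFun

theorem const (c : ℂ) : IsPolyFun fun _ : σ → ℂ => c := ⟨MvPolynomial.C c, by simp⟩

theorem coord (s : σ) : IsPolyFun fun p : σ → ℂ => p s := ⟨MvPolynomial.X s, by simp⟩

theorem add {f g : (σ → ℂ) → ℂ} (hf : IsPolyFun f) (hg : IsPolyFun g) :
    IsPolyFun fun p => f p + g p := by
  obtain ⟨P, hP⟩ := hf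
  obtain ⟨Q, hQ⟩ := hg
  exact ⟨P + Q, by simp [hP, hQ]⟩

theorem mul {f g : (σ → ℂ) → ℂ} (hf : IsPolyFun f) (hg : IsPolyFun g) :
    IsPolyFun fun p => f p * g p := by
  obtain ⟨P, hP⟩ := hf
  obtain ⟨Q, hQ⟩ := hg
  exact ⟨P * Q, by simp [hP, hQ]⟩

theorem neg {f : (σ → ℂ) → ℂ} (hf : IsPolyFun f) : IsPolyFun fun p => -f p := by
  obtain ⟨P, hP⟩ := hf
  exact ⟨-P, by simp [hP]⟩

theorem sub {f g : (σ → ℂ) → ℂ} (hf : IsPolyFun f) (hg : IsPolyFun g) :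
    IsPolyFun fun p => f p - g p := by
  simpa [sub_eq_add_neg] using hf.add hg.neg

theorem pow {f : (σ → ℂ) → ℂ} (hf : IsPolyFun f) (n : ℕ) : IsPolyFun fun p => f p ^ n := by
  obtain ⟨P, hP⟩ := hf
  exact ⟨P ^ n, by simp [hP]⟩

theorem sum {ι : Type*} {s : Finset ι} {f : ι → (σ → ℂ) → ℂ} (hf : ∀ i ∈ s, IsPolyFun (f i)) :
    IsPolyFun fun p => ∑ i ∈ s, f i p := by
  classical
  induction s using Finset.induction_on with
  | empty => simpa using const 0
  | insert a s ha ih =>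
    simp only [Finset.sum_insert ha]
    exact (hf a (Finset.mem_insert_self a s)).add
      (ih fun i hi => hf i (Finset.mem_insert_of_mem hi))

theorem prod {ι : Type*} {s : Finset ι} {f : ι → (σ → ℂ) → ℂ} (hf : ∀ i ∈ s, IsPolyFun (f i)) :
    IsPolyFun fun p => ∏ i ∈ s, f i p := by
  classical
  induction s using Finset.induction_on with
  | empty => simpa using const 1
  | insert a s ha ih =>
    simp only [Finset.prod_insert ha]
    exact (hf a (Finset.mem_insert_self a s)).mul
      (ih fun i hi => hf i (Finset.mem_insert_of_mem hi))

theorem det {n : Type*} [Fintype n] [DecidableEq n] {M : (σ → ℂ) → Matrix n n ℂ}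
    (hM : ∀ i j, IsPolyFun fun p => M p i j) : IsPolyFun fun p => (M p).det := by
  simp only [Matrix.det_apply']
  exact sum fun π _ => (const _).mul (prod fun i _ => hM _ _)

end IsPolyFun

variable {V : Type} [AddCommGroup V] [Module ℂ V]

/-- A vector that depends polynomially on the coordinate vector. -/
def IsPolyVec (w : (σ → ℂ) → V) : Prop :=
  ∀ f : V →ₗ[ℂ] ℂ, IsPolyFun fun p => f (w p)

namespace IsPolyVec

theorem const (v : V) : IsPolyVec fun _ : σ → ℂ => v := fun _ => IsPolyFun.const _

theorem sub {v w : (σ → ℂ) → V} (hv : IsPolyVec v) (hw : IsPolyVec w) :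
    IsPolyVec fun p => v p - w p := fun f => by
  simpa using (hv f).sub (hw f)

theorem smul {c : (σ → ℂ) → ℂ} {w : (σ → ℂ) → V} (hc : IsPolyFun c) (hw : IsPolyVec w) :
    IsPolyVec fun p => c p • w p := fun f => by
  simpa using hc.mul (hw f)

theorem sum {ι : Type*} {s : Finset ι} {w : ι → (σ → ℂ) → V} (hw : ∀ i ∈ s, IsPolyVec (w i)) :
    IsPolyVec fun p => ∑ i ∈ s, w i p := fun f => by
  simpa using IsPolyFun.sum fun i hi => hw i hi f

end IsPolyVec

/-- An alternating form is a polynomial in the coordinates of its arguments. -/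
theorem AlternatingMap.apply_eq_sum_repr {k : ℕ} {ι : Type} [Fintype ι]
    (b : Module.Basis ι ℂ V) (ω : V [⋀^Fin k]→ₗ[ℂ] ℂ) (w : Fin k → V) :
    ω w = ∑ r : Fin k → ι, (∏ i, b.repr (w i) (r i)) * ω (fun i => b (r i)) := by
  classical
  have h : w = fun i => ∑ j, b.repr (w i) j • b j := funext fun i => (b.sum_repr (w i)).symm
  conv_lhs => rw [h]
  change ω.toMultilinearMap _ = _
  rw [MultilinearMap.map_sum]
  refine Finset.sum_congr rfl fun r _ => ?_
  rw [MultilinearMap.map_smul_univ, smul_eq_mul]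
  rfl

theorem IsPolyVec.alternating [FiniteDimensional ℂ V] {k : ℕ} {w : (σ → ℂ) → Fin k → V}
    (hw : ∀ i, IsPolyVec fun p => w p i) (ω : V [⋀^Fin k]→ₗ[ℂ] ℂ) :
    IsPolyFun fun p => ω (w p) := by
  rw [show (fun p => ω (w p)) = _ from
    funext fun p => AlternatingMap.apply_eq_sum_repr (Module.finBasis ℂ V) ω (w p)]
  exact IsPolyFun.sum fun r _ =>
    (IsPolyFun.prod fun i _ => hw i ((Module.finBasis ℂ V).coord (r i))).mul (IsPolyFun.const _)

end Polynomial

/-! ### Plücker coordinates -/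

section Pluecker

variable {V : Type} [AddCommGroup V] [Module ℂ V] {k : ℕ}

theorem exists_dual_of_linearIndependent {w : Fin k → V} (hw : LinearIndependent ℂ w) :
    ∃ L : V →ₗ[ℂ] (Fin k → ℂ), ∀ j, L (w j) = Pi.single j 1 := by
  obtain ⟨L, hL⟩ := LinearMap.exists_leftInverse_of_injective (Fintype.linearCombination ℂ w)
    (LinearMap.ker_eq_bot.2 (linearIndependent_iff_injective_fintypeLinearCombination.1 hw))
  refine ⟨L, fun j => ?_⟩
  have := LinearMap.congr_fun hL (Pi.single j 1)
  simpa [Fintype.linearCombination_apply_single] using this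

theorem exists_alternating_ne_zero {w : Fin k → V} (hw : LinearIndependent ℂ w) :
    ∃ ω : V [⋀^Fin k]→ₗ[ℂ] ℂ, ω w ≠ 0 := by
  obtain ⟨L, hL⟩ := exists_dual_of_linearIndependent hw
  refine ⟨Matrix.detRowAlternating.compLinearMap L, ?_⟩
  have h : (fun i => L (w i)) = (1 : Matrix (Fin k) (Fin k) ℂ) := by
    ext i j
    rw [hL, Matrix.one_apply, Pi.single_apply]
    simp [eq_comm]
  rw [AlternatingMap.compLinearMap_apply]
  change Matrix.det (fun i => L (w i)) ≠ 0
  rw [h]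
  simp

theorem linearIndependent_of_alternating_ne_zero {w : Fin k → V} (ω : V [⋀^Fin k]→ₗ[ℂ] ℂ)
    (h : ω w ≠ 0) : LinearIndependent ℂ w := by
  by_contra hw
  exact h (ω.map_linearDependent w hw)

namespace Grass

/-- Linearly independent vectors in a subspace of the right dimension form a basis of it. -/
theorem span_eq [FiniteDimensional ℂ V] (W : Grass k V) {w : Fin k → V}
    (hw : LinearIndependent ℂ w) (hW : ∀ i, w i ∈ W.1) :
    Submodule.span ℂ (Set.range w) = W.1 := by
  refine Submodule.eq_of_le_of_finrank_eq (Submodule.span_le.2 ?_) ?_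
  · rintro _ ⟨i, rfl⟩
    exact hW i
  · rw [finrank_span_eq_card hw, Fintype.card_fin, W.2]

theorem exists_basis [FiniteDimensional ℂ V] (W : Grass k V) :
    ∃ w : Fin k → V, LinearIndependent ℂ w ∧ Submodule.span ℂ (Set.range w) = W.1 := by
  let b := Module.finBasisOfFinrankEq ℂ W.1 W.2
  have h : LinearIndependent ℂ fun i => (b i : V) :=
    b.linearIndependent.map' W.1.subtype (Submodule.ker_subtype _)
  exact ⟨_, h, span_eq W h fun i => (b i).2⟩

/-- A change of basis multiplies all Plücker coordinates by the same nonzero number. -/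
theorem exists_smul_of_span_eq {w w' : Fin k → V} (hw : LinearIndependent ℂ w)
    (hw' : LinearIndependent ℂ w')
    (h : Submodule.span ℂ (Set.range w) = Submodule.span ℂ (Set.range w')) :
    ∃ c : ℂ, c ≠ 0 ∧ ∀ ω : V [⋀^Fin k]→ₗ[ℂ] ℂ, ω w' = c * ω w := by
  let b := Module.Basis.span hw
  have hmem : ∀ i, w' i ∈ Submodule.span ℂ (Set.range w) := fun i => by
    rw [h]; exact Submodule.subset_span ⟨i, rfl⟩
  have key : ∀ ω : V [⋀^Fin k]→ₗ[ℂ] ℂ, ω w' = b.det (fun i => ⟨w' i, hmem i⟩) * ω w := fun ω => by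
    have := (ω.compLinearMap (Submodule.span ℂ (Set.range w)).subtype).eq_smul_basis_det b
    have h2 := congrArg (fun η => η (fun i => ⟨w' i, hmem i⟩)) this
    have h3 : (fun i => ((b i : Submodule.span ℂ (Set.range w)) : V)) = w :=
      funext fun i => by simp [b, Module.Basis.span_apply]
    simp only [AlternatingMap.compLinearMap_apply, AlternatingMap.smul_apply, smul_eq_mul,
      Submodule.subtype_apply] at h2
    rw [h3] at h2
    rw [h2, mul_comm]
  refine ⟨_, fun h0 => ?_, key⟩
  obtain ⟨ω, hω⟩ := exists_alternating_ne_zero hw'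
  exact hω (by rw [key, h0, zero_mul])

theorem exists_smul_of_mem_coords {W : Grass k V} {p q : (V [⋀^Fin k]→ₗ[ℂ] ℂ) → ℂ}
    (hp : p ∈ coords W) (hq : q ∈ coords W) : ∃ c : ℂ, c ≠ 0 ∧ q = c • p := by
  obtain ⟨w, hw, hW, hpw⟩ := hp
  obtain ⟨w', hw', hW', hqw⟩ := hq
  obtain ⟨c, hc, h⟩ := exists_smul_of_span_eq hw hw' (hW.trans hW'.symm)
  exact ⟨c, hc, funext fun ω => by rw [Pi.smul_apply, smul_eq_mul, hpw, hqw, h]⟩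

end Grass

end Pluecker

/-! ### The Zariski closure -/

section Closure

variable {X σ : Type} [HomogeneousCoordinates X σ]

theorem subset_zariskiClosure (A : Set X) : A ⊆ zariskiClosure A := fun _ hx _ h => h _ hx

theorem zariskiClosure_mono {A B : Set X} (h : A ⊆ B) : zariskiClosure A ⊆ zariskiClosure B :=
  fun _ hx P hP => hx P fun y hy => hP y (h hy)

theorem zariskiClosure_idem (A : Set X) : zariskiClosure (zariskiClosure A) = zariskiClosure A :=
  Set.Subset.antisymm (fun _ hx P hP => hx P fun _ hy => hy P hP) (subset_zariskiClosure _)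

theorem isZariskiClosed_vanishesAt (P : MvPolynomial σ ℂ) :
    IsZariskiClosed {x : X | VanishesAt P x} :=
  Set.Subset.antisymm (fun _ hx => hx P fun _ hy => hy) (subset_zariskiClosure _)

variable {V : Type} [AddCommGroup V] [Module ℂ V] {k m : ℕ}

/-- Polynomial conditions on tuples of elements of a subspace pass to the Zariski closure.

Fix a basis `w` of the limit point and a linear map `L` with `L (w j)` the `j`-th unit vector.
For a functional `f` and an index `i`, the `i`-th Cramer coordinate of `f ∘ u` with respect to the
matrix `L ∘ u` is an alternating form of `u`; its value at a basis `u` of any subspace is the value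
of `f` at a vector of that subspace which does not depend on `f`, and for `u = w` this vector is
`w i`. Hence arbitrary elements of the limit subspace are the values of polynomial functions of the
Plücker coordinates which on all the points of `A` have their values in the subspace. -/
theorem forall_mem_eq_zero_of_mem_zariskiClosure [FiniteDimensional ℂ V] {A : Set (Grass k V)}
    (f : (Fin m → V) → ℂ)
    (hf : ∀ g : ((V [⋀^Fin k]→ₗ[ℂ] ℂ) → ℂ) → Fin m → V, (∀ i, IsPolyVec fun p => g p i) →
      IsPolyFun fun p => f (g p))
    (hA : ∀ W ∈ A, ∀ x : Fin m → V, (∀ i, x i ∈ W.1) → f x = 0)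
    {W : Grass k V} (hW : W ∈ zariskiClosure A) (x : Fin m → V) (hx : ∀ i, x i ∈ W.1) :
    f x = 0 := by
  obtain ⟨w, hw, hspan⟩ := W.exists_basis
  obtain ⟨L, hL⟩ := exists_dual_of_linearIndependent hw
  have hc : ∀ i, ∃ c : Fin k → ℂ, ∑ j, c j • w j = x i := fun i => by
    have := hx i
    rw [← hspan] at this
    exact (Submodule.mem_span_range_iff_exists_fun ℂ).1 this
  choose c hc using hc
  let b := Module.finBasis ℂ V
  let M : (V →ₗ[ℂ] ℂ) → Fin k → V →ₗ[ℂ] (Fin k → ℂ) := fun φ i =>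
    LinearMap.pi fun j => if j = i then φ else LinearMap.proj j ∘ₗ L
  let ω : (V →ₗ[ℂ] ℂ) → Fin k → V [⋀^Fin k]→ₗ[ℂ] ℂ := fun φ i =>
    Matrix.detRowAlternating.compLinearMap (M φ i)
  have hω : ∀ φ i (u : Fin k → V), ω φ i u =
      Matrix.cramer (Matrix.of fun a => L (u a)) (fun a => φ (u a)) i := fun φ i u => by
    rw [Matrix.cramer_apply]
    change Matrix.det _ = _
    congr 1
    ext a j
    by_cases h : j = i
    · subst h; simp [M]
    · simp [M, h]
  let g : ((V [⋀^Fin k]→ₗ[ℂ] ℂ) → ℂ) → Fin m → V := fun p i =>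
    ∑ s, (∑ j, c i j * p (ω (b.coord s) j)) • b s
  have hg : ∀ i, IsPolyVec fun p => g p i := fun i =>
    IsPolyVec.sum fun s _ => IsPolyVec.smul
      (IsPolyFun.sum fun j _ => (IsPolyFun.const _).mul (IsPolyFun.coord _)) (IsPolyVec.const _)
  -- the value of `g` at the Plücker coordinates of the span of `u` is a combination of `u`
  have hgu : ∀ (u : Fin k → V) (i : Fin m), g (fun η => η u) i =
      ∑ j, c i j • ∑ a, (Matrix.of fun a => L (u a)).adjugate j a • u a := fun u i => by
    have h1 : ∀ s, (∑ j, c i j * ω (b.coord s) j u) =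
        b.coord s (∑ j, c i j • ∑ a, (Matrix.of fun a => L (u a)).adjugate j a • u a) := fun s => by
      rw [map_sum]
      refine Finset.sum_congr rfl fun j _ => ?_
      rw [hω, Matrix.cramer_eq_adjugate_mulVec, map_smul, smul_eq_mul, map_sum]
      simp [Matrix.mulVec, dotProduct]
    simp only [g, h1]
    exact b.sum_repr _
  obtain ⟨P, hP⟩ := hf g hg
  have hvan : VanishesAt P W := by
    refine hW P fun Y hY p hp => ?_
    obtain ⟨u, hu, huY, hpu⟩ := hp
    obtain rfl : p = fun η => η u := funext hpu
    rw [hP]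
    refine hA Y hY _ fun i => ?_
    rw [hgu, ← huY]
    exact Submodule.sum_mem _ fun j _ => Submodule.smul_mem _ _ <| Submodule.sum_mem _ fun a _ =>
      Submodule.smul_mem _ _ (Submodule.subset_span ⟨a, rfl⟩)
  have := hvan (fun η => η w) ⟨w, hw, hspan, fun _ => rfl⟩
  rw [hP] at this
  rw [← this]
  congr 1
  funext i
  have h1 : (Matrix.of fun a => L (w a)) = (1 : Matrix (Fin k) (Fin k) ℂ) := by
    ext i j
    rw [Matrix.of_apply, hL, Matrix.one_apply, Pi.single_apply]
    simp [eq_comm]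
  rw [hgu, h1, ← hc i]
  simp [Matrix.one_apply]

/-- A subspace that is the limit of a continuous family of points of `A` lies in the Zariski
closure of `A`. -/
theorem mem_zariskiClosure_of_continuous [FiniteDimensional ℂ V] {A : Set (Grass k V)}
    {W : Grass k V} (w : ℂ → Fin k → V)
    (hcont : ∀ (f : V →ₗ[ℂ] ℂ) (i : Fin k), Continuous fun t => f (w t i))
    (h0 : LinearIndependent ℂ (w 0)) (hW : ∀ i, w 0 i ∈ W.1)
    (hA : ∀ t ≠ 0, LinearIndependent ℂ (w t) → ∃ Y ∈ A, ∀ i, w t i ∈ Y.1) :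
    W ∈ zariskiClosure A := by
  intro P hP p hp
  have hω : ∀ ω : V [⋀^Fin k]→ₗ[ℂ] ℂ, Continuous fun t => ω (w t) := fun ω => by
    rw [show (fun t => ω (w t)) = _ from
      funext fun t => AlternatingMap.apply_eq_sum_repr (Module.finBasis ℂ V) ω (w t)]
    exact continuous_finsetSum _ fun r _ => Continuous.mul
      (continuous_finsetProd _ fun i _ => hcont ((Module.finBasis ℂ V).coord (r i)) i)
      continuous_const
  obtain ⟨w', hw', hspan', hpw'⟩ := hp
  obtain ⟨c, hc, hcw⟩ := Grass.exists_smul_of_span_eq h0 hw'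
    ((Grass.span_eq W h0 hW).trans hspan'.symm)
  have hpt : Continuous fun t => MvPolynomial.eval (fun ω => c * ω (w t)) P :=
    (MvPolynomial.continuous_eval P).comp
      (continuous_pi fun ω => continuous_const.mul (hω ω))
  have hp0 : p = fun ω => c * ω (w 0) := funext fun ω => by rw [hpw', hcw]
  rw [hp0]
  obtain ⟨η, hη⟩ := exists_alternating_ne_zero h0
  have hev : ∀ᶠ t in nhdsWithin (0 : ℂ) {0}ᶜ,
      MvPolynomial.eval (fun ω => c * ω (w t)) P = 0 := by
    have h1 : ∀ᶠ t in nhdsWithin (0 : ℂ) {0}ᶜ, η (w t) ≠ 0 :=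
      ((hω η).continuousAt.eventually_ne hη).filter_mono nhdsWithin_le_nhds
    filter_upwards [h1, self_mem_nhdsWithin] with t ht ht0
    have hli := linearIndependent_of_alternating_ne_zero η ht
    obtain ⟨Y, hY, hYw⟩ := hA t ht0 hli
    refine hP Y hY _ ?_
    have hk : k ≠ 0 ∨ k = 0 := ne_or_eq k 0
    rcases hk with hk | rfl
    · -- scale one basis vector by `c`
      let i0 : Fin k := ⟨0, Nat.pos_of_ne_zero hk⟩
      let d : Fin k → ℂˣ := Function.update 1 i0 (Units.mk0 c hc)
      refine ⟨fun i => (d i : ℂ) • w t i, hli.units_smul d, ?_, fun ω => ?_⟩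
      · exact Grass.span_eq Y (hli.units_smul d) fun i => Y.1.smul_mem _ (hYw i)
      · have := ω.toMultilinearMap.map_smul_univ (fun i => (d i : ℂ)) (w t)
        change _ = ω.toMultilinearMap _
        rw [this]
        have hd : ∏ i, (d i : ℂ) = c := by
          rw [← Units.coe_prod, Finset.prod_update_of_mem (Finset.mem_univ i0)]
          simp
        rw [hd]
        rfl
    · have hc1 : c = 1 := by
        have h1 := hcw (AlternatingMap.constOfIsEmpty ℂ V (Fin 0) (1 : ℂ))
        simpa using h1.symm
      refine ⟨w t, hli, Grass.span_eq Y hli hYw, fun ω => by simp [hc1]⟩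
  have hlim := (hpt.continuousAt (x := 0)).tendsto.mono_left
    (nhdsWithin_le_nhds (s := ({0}ᶜ : Set ℂ)))
  exact tendsto_nhds_unique (hlim.congr' hev) tendsto_const_nhds |>.trans rfl

end Closure

/-! ### Criteria for regularity -/

section Regular

variable {X Y Z σ τ υ : Type} [HomogeneousCoordinates X σ] [HomogeneousCoordinates Y τ]
  [HomogeneousCoordinates Z υ]

/-- A form of regularity that is stable under products: the domains of the local polynomial
formulas are basic open sets `P ≠ 0`, where the nonvanishing of `P` at a point of `A` does not depend
on the choice of homogeneous coordinates of that point. -/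
def IsBasicRegular {A : Set X} (f : A → Y) : Prop :=
  ∀ x : A, ∃ P : MvPolynomial σ ℂ, (∃ p ∈ coords (x : X), MvPolynomial.eval p P ≠ 0) ∧
    (∀ y : A, ∀ p ∈ coords (y : X), ∀ q ∈ coords (y : X),
      MvPolynomial.eval p P ≠ 0 → MvPolynomial.eval q P ≠ 0) ∧
    ∃ F : τ → MvPolynomial σ ℂ, ∀ y : A, ∀ p ∈ coords (y : X), MvPolynomial.eval p P ≠ 0 →
      (fun i => MvPolynomial.eval p (F i)) ∈ coords (f y)

theorem IsBasicRegular.isRegularMap {A : Set X} {B : Set Y} {f : A → B}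
    (hf : IsBasicRegular fun x => (f x : Y)) : IsRegularMap f := by
  intro x
  obtain ⟨P, ⟨p, hp, hpx⟩, hP, F, hF⟩ := hf x
  refine ⟨{y : X | VanishesAt P y}ᶜ, ?_, fun h => hpx (h p hp), F, fun y hy q hq => ?_⟩
  · rw [compl_compl]
    exact isZariskiClosed_vanishesAt P
  · have hy' : ¬ ∀ r ∈ coords (y : X), MvPolynomial.eval r P = 0 := hy
    push Not at hy'
    obtain ⟨r, hr, hry⟩ := hy'
    exact hF y q hq (hP y r hr q hq hry)

theorem IsBasicRegular.prodMk {A : Set X} {f : A → Y} {g : A → Z} (hf : IsBasicRegular f)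
    (hg : IsBasicRegular g) : IsBasicRegular fun x => (f x, g x) := by
  intro x
  obtain ⟨P, ⟨p, hp, hpx⟩, hP, F, hF⟩ := hf x
  obtain ⟨Q, ⟨q, hq, hqx⟩, hQ, G, hG⟩ := hg x
  refine ⟨P * Q, ⟨p, hp, ?_⟩, fun y r hr s hs h => ?_, Sum.elim F G, fun y r hr h => ?_⟩
  · rw [map_mul]
    exact mul_ne_zero hpx (hQ x q hq p hp hqx)
  · rw [map_mul] at h ⊢
    exact mul_ne_zero (hP y r hr s hs (left_ne_zero_of_mul h))
      (hQ y r hr s hs (right_ne_zero_of_mul h))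
  · rw [map_mul] at h
    exact ⟨hF y r hr (left_ne_zero_of_mul h), hG y r hr (right_ne_zero_of_mul h)⟩

variable {V : Type} [AddCommGroup V] [Module ℂ V] [FiniteDimensional ℂ V] {k : ℕ}

/-- A map to a Grassmannian is regular if near each point its value has a basis that depends
polynomially on homogeneous coordinates, each of the basis vectors being multiplied by a nonzero
number when the homogeneous coordinates change. -/
theorem isBasicRegular_of_basis {A : Set X} (f : A → Grass k V)
    (h : ∀ x : A, ∃ w : (σ → ℂ) → Fin k → V, (∀ i, IsPolyVec fun p => w p i) ∧
      (∀ y : A, ∀ p ∈ coords (y : X), ∀ i, w p i ∈ (f y).1) ∧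
      (∀ y : A, ∀ p ∈ coords (y : X), ∀ q ∈ coords (y : X),
        ∃ c : Fin k → ℂˣ, ∀ i, w q i = c i • w p i) ∧
      ∃ p ∈ coords (x : X), LinearIndependent ℂ (w p)) : IsBasicRegular f := by
  intro x
  obtain ⟨w, hw, hmem, hscale, p, hp, hli⟩ := h x
  obtain ⟨ω, hω⟩ := exists_alternating_ne_zero hli
  obtain ⟨P, hP⟩ := IsPolyVec.alternating hw ω
  choose F hF using fun η : V [⋀^Fin k]→ₗ[ℂ] ℂ => IsPolyVec.alternating hw η
  refine ⟨P, ⟨p, hp, by rwa [hP]⟩, fun y r hr s hs hne => ?_, F, fun y r hr hne => ?_⟩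
  · rw [hP] at hne ⊢
    obtain ⟨c, hc⟩ := hscale y r hr s hs
    have h1 : w s = fun i => (c i : ℂ) • w r i := funext hc
    have h2 := ω.toMultilinearMap.map_smul_univ (fun i => (c i : ℂ)) (w r)
    change ω.toMultilinearMap (w s) ≠ 0
    rw [h1, h2]
    exact smul_ne_zero (Finset.prod_ne_zero_iff.2 fun i _ => (c i).ne_zero) hne
  · rw [hP] at hne
    have hlr := linearIndependent_of_alternating_ne_zero ω hne
    exact ⟨w r, hlr, Grass.span_eq _ hlr (hmem y r hr), fun η => hF η r⟩

end Regular

/-! ### The normal forms as points of the Grassmannian -/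

open OrbitType in
/-- The matrices of trace zero of the shape `normalForm o`, parametrized linearly by the triples
`(r, s, u)` of complex numbers. -/
def tracelessForm (o : OrbitType) (r s u : ℂ) : Matrix (Fin 4) (Fin 4) ℂ :=
  match o with
  | O12 => normalForm O12 r s u (-r - s - u)
  | O11 => normalForm O11 r s u (-2 * r - u)
  | O10' => normalForm O10' r s (-r) u
  | O10'' => normalForm O10'' r s u (-3 * r)
  | O9 => normalForm O9 r s u 0
  | O8 => normalForm O8 r s u 0
  | O8' => normalForm O8' r s u (-3 * u)
  | O8'' => normalForm O8'' r s u (-3 * u)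
  | O7' => normalForm O7' r s u 0
  | O7'' => normalForm O7'' r s u 0
  | O7 => normalForm O7 r s u 0
  | O6 => normalForm O6 r s u 0
  | O3' => normalForm O3' r s u 0
  | O3'' => normalForm O3'' r s u 0

theorem exists_normalForm_eq_tracelessForm (o : OrbitType) (r s u : ℂ) :
    ∃ a b c d, tracelessForm o r s u = normalForm o a b c d := by
  cases o <;> exact ⟨_, _, _, _, by rw [tracelessForm]⟩

theorem trace_tracelessForm (o : OrbitType) (r s u : ℂ) : (tracelessForm o r s u).trace = 0 := by
  cases o <;> simp [tracelessForm, normalForm, Matrix.trace, Fin.sum_univ_four] <;> ring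

theorem exists_tracelessForm_eq (o : OrbitType) (a b c d : ℂ)
    (h : (normalForm o a b c d).trace = 0) :
    ∃ r s u, tracelessForm o r s u = normalForm o a b c d := by
  cases o <;> simp [normalForm, Matrix.trace, Fin.sum_univ_four] at h
  case O12 => exact ⟨a, b, c, by rw [show d = -a - b - c by linear_combination h]; rfl⟩
  case O11 => exact ⟨a, b, c, by rw [show d = -2 * a - c by linear_combination h]; rfl⟩
  case O10' => exact ⟨a, b, d, by rw [show c = -a by linear_combination h / 2]; rfl⟩
  case O10'' => exact ⟨a, b, c, by rw [show d = -3 * a by linear_combination h]; rfl⟩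
  case O8' => exact ⟨a, b, c, by rw [show d = -3 * c by linear_combination h]; rfl⟩
  case O8'' => exact ⟨a, b, c, by rw [show d = -3 * c by linear_combination h]; rfl⟩
  all_goals exact ⟨a, b, c, rfl⟩

theorem tracelessForm_add (o : OrbitType) (r s u r' s' u' : ℂ) :
    tracelessForm o (r + r') (s + s') (u + u') =
      tracelessForm o r s u + tracelessForm o r' s' u' := by
  cases o <;> simp [tracelessForm, normalForm] <;> try ring_nf

theorem tracelessForm_smul (o : OrbitType) (k r s u : ℂ) :
    tracelessForm o (k * r) (k * s) (k * u) = k • tracelessForm o r s u := by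
  cases o <;> simp [tracelessForm, normalForm] <;> ring_nf

theorem tracelessForm_eq_zero {o : OrbitType} {r s u : ℂ} (h : tracelessForm o r s u = 0) :
    r = 0 ∧ s = 0 ∧ u = 0 := by
  have h1 := fun i j => congrFun (congrFun h i) j
  cases o
  case O12 => exact ⟨h1 0 0, h1 1 1, h1 2 2⟩
  case O11 => exact ⟨h1 0 0, h1 0 1, h1 2 2⟩
  case O10' => exact ⟨h1 0 0, h1 0 1, h1 2 3⟩
  case O10'' => exact ⟨h1 0 0, h1 0 1, h1 0 2⟩
  case O9 => exact ⟨h1 0 1, h1 0 2, h1 0 3⟩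
  case O8 => exact ⟨h1 0 1, h1 0 2, h1 0 3⟩
  case O8' => exact ⟨h1 0 2, h1 0 1, h1 0 0⟩
  case O8'' => exact ⟨h1 0 2, h1 1 2, h1 0 0⟩
  case O7' => exact ⟨h1 0 1, h1 0 2, h1 0 3⟩
  case O7'' => exact ⟨h1 0 2, h1 1 3, h1 0 3⟩
  case O7 => exact ⟨h1 0 2, h1 0 3, h1 1 3⟩
  case O6 => exact ⟨h1 0 2, h1 0 3, h1 1 3⟩
  case O3' => exact ⟨h1 0 1, h1 0 2, h1 0 3⟩
  case O3'' => exact ⟨h1 2 3, h1 1 3, h1 0 3⟩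

/-- `tracelessForm` as a linear map to `𝔰𝔩₄`. -/
def tracelessFormMap (o : OrbitType) : (Fin 3 → ℂ) →ₗ[ℂ] sl4 where
  toFun v := ⟨tracelessForm o (v 0) (v 1) (v 2), trace_tracelessForm o _ _ _⟩
  map_add' _ _ := Subtype.ext (tracelessForm_add o _ _ _ _ _ _)
  map_smul' k _ := Subtype.ext (tracelessForm_smul o k _ _ _)

theorem coe_tracelessFormMap (o : OrbitType) (v : Fin 3 → ℂ) :
    (tracelessFormMap o v : Matrix (Fin 4) (Fin 4) ℂ) = tracelessForm o (v 0) (v 1) (v 2) := rfl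

theorem tracelessFormMap_injective (o : OrbitType) : Function.Injective (tracelessFormMap o) := by
  rw [← LinearMap.ker_eq_bot, LinearMap.ker_eq_bot']
  intro v hv
  obtain ⟨h0, h1, h2⟩ := tracelessForm_eq_zero (congrArg Subtype.val hv)
  ext i
  fin_cases i <;> assumption

/-- The algebra that represents an orbit. -/
def normalAlgebra (o : OrbitType) : Grass 3 sl4 :=
  ⟨LinearMap.range (tracelessFormMap o), by
    rw [LinearMap.finrank_range_of_inj (tracelessFormMap_injective o)]; simp⟩

theorem mem_normalAlgebra {o : OrbitType} {x : sl4} : x ∈ (normalAlgebra o).1 ↔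
    ∃ a b c d : ℂ, (x : Matrix (Fin 4) (Fin 4) ℂ) = normalForm o a b c d := by
  constructor
  · rintro ⟨v, rfl⟩
    exact exists_normalForm_eq_tracelessForm o _ _ _
  · rintro ⟨a, b, c, d, h⟩
    have hx : Matrix.trace x.1 = 0 := x.2
    obtain ⟨r, s, u, hr⟩ := exists_tracelessForm_eq o a b c d (by rw [← h]; exact hx)
    exact ⟨![r, s, u], Subtype.ext (hr.trans h.symm)⟩

theorem mem_normalAlgebra_iff_tracelessForm {o : OrbitType} {x : sl4} : x ∈ (normalAlgebra o).1 ↔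
    ∃ r s u : ℂ, (x : Matrix (Fin 4) (Fin 4) ℂ) = tracelessForm o r s u := by
  constructor
  · rintro ⟨v, rfl⟩
    exact ⟨_, _, _, rfl⟩
  · rintro ⟨r, s, u, h⟩
    exact ⟨![r, s, u], Subtype.ext h.symm⟩

/-! ### The adjoint action of `PGL₄` -/

theorem pgl_induction {C : PGL(Fin 4, ℂ) → Prop}
    (h : ∀ g : GL (Fin 4) ℂ, C (Matrix.ProjGenLinGroup.mk g)) (g : PGL(Fin 4, ℂ)) : C g := by
  obtain ⟨g, rfl⟩ := Matrix.ProjGenLinGroup.mk_surjective g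
  exact h g

theorem coe_conjLinearMap (g : GL (Fin 4) ℂ) (x : sl4) :
    (conjLinearMap g x : Matrix (Fin 4) (Fin 4) ℂ) =
      g * x.1 * ((g⁻¹ : GL (Fin 4) ℂ) : Matrix (Fin 4) (Fin 4) ℂ) := rfl

theorem mem_mk_smul {g : GL (Fin 4) ℂ} {W : Grass 3 sl4} {x : sl4} :
    x ∈ (Matrix.ProjGenLinGroup.mk g • W).1 ↔ ∃ y ∈ W.1, conjLinearMap g y = x := Iff.rfl

theorem conjLinearMap_eq_iff {g : GL (Fin 4) ℂ} {x y : sl4} :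
    conjLinearMap g y = x ↔ x.1 * (g : Matrix (Fin 4) (Fin 4) ℂ) = g * y.1 := by
  constructor
  · rintro rfl
    rw [coe_conjLinearMap, mul_assoc, ← Units.val_mul, inv_mul_cancel, Units.val_one, mul_one]
  · intro h
    apply Subtype.ext
    rw [coe_conjLinearMap, ← h, mul_assoc, ← Units.val_mul, mul_inv_cancel, Units.val_one, mul_one]

theorem Grass.eq_of_le {k : ℕ} {V : Type} [AddCommGroup V] [Module ℂ V] [FiniteDimensional ℂ V]
    {W W' : Grass k V} (h : W.1 ≤ W'.1) : W = W' :=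
  Subtype.ext (Submodule.eq_of_le_of_finrank_eq h (W.2.trans W'.2.symm))

/-- An invertible `g` that brings all the elements of `W` into the shape `normalForm o` conjugates
`W` to the whole algebra of matrices of that shape, the dimensions being equal. -/
theorem mem_orbit_normalAlgebra {o : OrbitType} {W : Grass 3 sl4}
    (g : Matrix (Fin 4) (Fin 4) ℂ) (hg : g.det ≠ 0)
    (h : ∀ x ∈ W.1, ∃ a b c d, x.1 * g = g * normalForm o a b c d) :
    W ∈ MulAction.orbit PGL(Fin 4, ℂ) (normalAlgebra o) := by
  refine ⟨Matrix.ProjGenLinGroup.mk (Matrix.GeneralLinearGroup.mkOfDetNeZero g hg), ?_⟩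
  refine (Grass.eq_of_le fun x hx => ?_).symm
  obtain ⟨a, b, c, d, habcd⟩ := h x hx
  have hx0 : Matrix.trace x.1 = 0 := x.2
  have hu : IsUnit g.det := isUnit_iff_ne_zero.2 hg
  have ht : (normalForm o a b c d).trace = 0 := by
    rw [← hx0, ← mul_one x.1, ← Matrix.mul_nonsing_inv g hu, ← mul_assoc, habcd,
      Matrix.trace_mul_comm, ← mul_assoc, Matrix.nonsing_inv_mul g hu, one_mul]
  exact mem_mk_smul.2 ⟨⟨normalForm o a b c d, ht⟩, mem_normalAlgebra.2 ⟨a, b, c, d, rfl⟩,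
    conjLinearMap_eq_iff.2 habcd⟩

/-- Linear functionals on `𝔰𝔩₄` are linear combinations of the matrix entries. -/
theorem exists_functional_eq_sum (f : sl4 →ₗ[ℂ] ℂ) :
    ∃ c : Fin 4 → Fin 4 → ℂ, ∀ x : sl4, f x = ∑ i, ∑ j, x.1 i j * c i j := by
  obtain ⟨f', hf'⟩ := LinearMap.exists_extend f
  refine ⟨fun i j => f' (Matrix.single i j 1), fun x => ?_⟩
  have h : f x = f' x.1 := (LinearMap.congr_fun hf' x).symm
  rw [h]
  conv_lhs => rw [Matrix.matrix_eq_sum_single x.1]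
  simp only [map_sum]
  refine Finset.sum_congr rfl fun i _ => Finset.sum_congr rfl fun j _ => ?_
  rw [← smul_eq_mul, ← map_smul, Matrix.smul_single, smul_eq_mul, mul_one]

theorem isPolyVec_sl4 {σ : Type} {w : (σ → ℂ) → sl4}
    (h : ∀ i j, IsPolyFun fun p => (w p).1 i j) : IsPolyVec w := fun f => by
  obtain ⟨c, hc⟩ := exists_functional_eq_sum f
  simp only [hc]
  exact IsPolyFun.sum fun i _ => IsPolyFun.sum fun j _ => (h i j).mul (IsPolyFun.const _)

/-- The functional `x ↦ x i j` on `𝔰𝔩₄`. -/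
def entryFunctional (i j : Fin 4) : sl4 →ₗ[ℂ] ℂ where
  toFun x := x.1 i j
  map_add' _ _ := rfl
  map_smul' _ _ := rfl

theorem IsPolyVec.entry {σ : Type} {w : (σ → ℂ) → sl4} (h : IsPolyVec w) (i j : Fin 4) :
    IsPolyFun fun p => (w p).1 i j := h (entryFunctional i j)

/-! ### Closed conditions that are invariant under conjugation -/

/-- A condition on three-dimensional subspaces of `𝔰𝔩₄` that is invariant under conjugation and
passes to Zariski closures. -/
structure IsClosedInvariant (C : Grass 3 sl4 → Prop) : Prop where
  mk_smul : ∀ (g : GL (Fin 4) ℂ) (W : Grass 3 sl4), C W → C (Matrix.ProjGenLinGroup.mk g • W)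
  closure : ∀ A : Set (Grass 3 sl4), (∀ W ∈ A, C W) → ∀ W ∈ zariskiClosure A, C W

theorem IsClosedInvariant.smul {C : Grass 3 sl4 → Prop} (hC : IsClosedInvariant C)
    (g : PGL(Fin 4, ℂ)) {W : Grass 3 sl4} (h : C W) : C (g • W) := by
  induction g using pgl_induction with
  | h g => exact hC.mk_smul g W h

theorem IsClosedInvariant.of_mem_closure_orbit {C : Grass 3 sl4 → Prop} (hC : IsClosedInvariant C)
    {W W' : Grass 3 sl4} (h : W' ∈ zariskiClosure (MulAction.orbit PGL(Fin 4, ℂ) W)) (hW : C W) :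
    C W' :=
  hC.closure _ (by rintro _ ⟨g, rfl⟩; exact hC.smul g hW) _ h

/-- A family `F` of polynomial functions of `m`-tuples of matrices that conjugation permutes
defines a closed invariant condition: all members of the family vanish on the tuples in `W`. -/
theorem isClosedInvariant_of_family {ι : Type} {m : ℕ}
    (F : ι → (Fin m → Matrix (Fin 4) (Fin 4) ℂ) → ℂ)
    (hpoly : ∀ (i : ι) (σ : Type) (w : (σ → ℂ) → Fin m → Matrix (Fin 4) (Fin 4) ℂ),
      (∀ k a b, IsPolyFun fun p => w p k a b) → IsPolyFun fun p => F i (w p))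
    (hconj : ∀ (i : ι) (g : GL (Fin 4) ℂ), ∃ j, ∀ x : Fin m → Matrix (Fin 4) (Fin 4) ℂ,
      F i (fun k => g * x k * ((g⁻¹ : GL (Fin 4) ℂ) : Matrix (Fin 4) (Fin 4) ℂ)) = F j x) :
    IsClosedInvariant fun W => ∀ (i : ι) (x : Fin m → sl4), (∀ k, x k ∈ W.1) →
      F i (fun k => (x k).1) = 0 where
  mk_smul g W h i x hx := by
    choose y hy hyx using fun k => mem_mk_smul.1 (hx k)
    obtain ⟨j, hj⟩ := hconj i g
    rw [← h j y hy, ← hj]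
    congr 1
    funext k
    rw [← hyx k, coe_conjLinearMap]
  closure A h W hW i x hx := by
    refine forall_mem_eq_zero_of_mem_zariskiClosure (fun x : Fin m → sl4 => F i fun k => (x k).1)
      (fun g hg => ?_) (fun Y hY x hx => h Y hY i x hx) hW x hx
    exact hpoly i _ _ fun k a b => (hg k).entry a b

section PolynomialMatrices

variable {σ : Type}

theorem IsPolyFun.matrix_mul {M N : (σ → ℂ) → Matrix (Fin 4) (Fin 4) ℂ}
    (hM : ∀ a b, IsPolyFun fun p => M p a b) (hN : ∀ a b, IsPolyFun fun p => N p a b) (a b : Fin 4) :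
    IsPolyFun fun p => (M p * N p) a b := by
  simp only [Matrix.mul_apply]
  exact IsPolyFun.sum fun i _ => (hM a i).mul (hN i b)

theorem IsPolyFun.trace {M : (σ → ℂ) → Matrix (Fin 4) (Fin 4) ℂ}
    (hM : ∀ a b, IsPolyFun fun p => M p a b) : IsPolyFun fun p => (M p).trace := by
  simp only [Matrix.trace, Matrix.diag]
  exact IsPolyFun.sum fun i _ => hM i i

theorem IsPolyFun.form {M : (σ → ℂ) → Matrix (Fin 4) (Fin 4) ℂ}
    (hM : ∀ a b, IsPolyFun fun p => M p a b) (α v : Fin 4 → ℂ) :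
    IsPolyFun fun p => α ⬝ᵥ (M p).mulVec v := by
  simp only [dotProduct, Matrix.mulVec]
  exact IsPolyFun.sum fun i _ => (IsPolyFun.const _).mul
    (IsPolyFun.sum fun j _ => (hM i j).mul (IsPolyFun.const _))

end PolynomialMatrices

theorem conj_mul_conj (g : GL (Fin 4) ℂ) (x y : Matrix (Fin 4) (Fin 4) ℂ) :
    (g * x * ((g⁻¹ : GL (Fin 4) ℂ) : Matrix (Fin 4) (Fin 4) ℂ)) *
      (g * y * ((g⁻¹ : GL (Fin 4) ℂ) : Matrix (Fin 4) (Fin 4) ℂ)) =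
      g * (x * y) * ((g⁻¹ : GL (Fin 4) ℂ) : Matrix (Fin 4) (Fin 4) ℂ) := by
  have h : ((g⁻¹ : GL (Fin 4) ℂ) : Matrix (Fin 4) (Fin 4) ℂ) * g = 1 := by
    rw [← Units.val_mul, inv_mul_cancel, Units.val_one]
  calc _ = g * x * (((g⁻¹ : GL (Fin 4) ℂ) : Matrix (Fin 4) (Fin 4) ℂ) * g) * y *
        ((g⁻¹ : GL (Fin 4) ℂ) : Matrix (Fin 4) (Fin 4) ℂ) := by simp only [mul_assoc]
    _ = _ := by rw [h, mul_one]; simp only [mul_assoc]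

theorem form_conj (g : GL (Fin 4) ℂ) (x : Matrix (Fin 4) (Fin 4) ℂ) (α v : Fin 4 → ℂ) :
    α ⬝ᵥ (g * x * ((g⁻¹ : GL (Fin 4) ℂ) : Matrix (Fin 4) (Fin 4) ℂ)).mulVec v =
      Matrix.vecMul α (g : Matrix (Fin 4) (Fin 4) ℂ) ⬝ᵥ
        x.mulVec (((g⁻¹ : GL (Fin 4) ℂ) : Matrix (Fin 4) (Fin 4) ℂ).mulVec v) := by
  rw [← Matrix.mulVec_mulVec, ← Matrix.mulVec_mulVec, Matrix.dotProduct_mulVec]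

/-- The `2 × 2` minor of `x` with respect to the functionals `α`, `β` and the vectors `v`, `w`. -/
def minorForm (α β v w : Fin 4 → ℂ) (x : Matrix (Fin 4) (Fin 4) ℂ) : ℂ :=
  (α ⬝ᵥ x.mulVec v) * (β ⬝ᵥ x.mulVec w) - (α ⬝ᵥ x.mulVec w) * (β ⬝ᵥ x.mulVec v)

/-- The polar form of the quadratic form `minorForm α β v w`. -/
def minorPolar (α β v w : Fin 4 → ℂ) (x y : Matrix (Fin 4) (Fin 4) ℂ) : ℂ :=
  (α ⬝ᵥ x.mulVec v) * (β ⬝ᵥ y.mulVec w) - (α ⬝ᵥ x.mulVec w) * (β ⬝ᵥ y.mulVec v) +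
    ((α ⬝ᵥ y.mulVec v) * (β ⬝ᵥ x.mulVec w) - (α ⬝ᵥ y.mulVec w) * (β ⬝ᵥ x.mulVec v))

/-- The trace form is degenerate on `W`. -/
def TraceFormDegenerate (W : Grass 3 sl4) : Prop :=
  ∀ (_ : Unit) (x : Fin 3 → sl4), (∀ k, x k ∈ W.1) →
    (Matrix.of fun i j => ((x i).1 * (x j).1).trace).det = 0

/-- `tr x² = 0` on `W`. -/
def TraceSqVanishes (W : Grass 3 sl4) : Prop :=
  ∀ (_ : Unit) (x : Fin 1 → sl4), (∀ k, x k ∈ W.1) → ((x 0).1 * (x 0).1).trace = 0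

/-- `tr x³ = 0` on `W`. For `x` of trace zero this holds if the characteristic polynomial is a
square. -/
def TraceCubeVanishes (W : Grass 3 sl4) : Prop :=
  ∀ (_ : Unit) (x : Fin 1 → sl4), (∀ k, x k ∈ W.1) →
    ((x 0).1 * (x 0).1 * (x 0).1).trace = 0

/-- `7 (tr x²)² = 12 tr x⁴` on `W`. For `x` of trace zero this holds if `x` has an eigenvalue of
multiplicity at least three. -/
def QuarticTraceVanishes (W : Grass 3 sl4) : Prop :=
  ∀ (_ : Unit) (x : Fin 1 → sl4), (∀ k, x k ∈ W.1) →
    7 * ((x 0).1 * (x 0).1).trace ^ 2 -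
      12 * (((x 0).1 * (x 0).1) * ((x 0).1 * (x 0).1)).trace = 0

/-- `dim W v ≤ 2` for all vectors `v`. -/
def ColumnsDependent (W : Grass 3 sl4) : Prop :=
  ∀ (P : (Fin 3 → Fin 4 → ℂ) × (Fin 4 → ℂ)) (x : Fin 3 → sl4), (∀ k, x k ∈ W.1) →
    (Matrix.of fun i j => P.1 i ⬝ᵥ (x j).1.mulVec P.2).det = 0

/-- `dim α W ≤ 2` for all functionals `α`. -/
def RowsDependent (W : Grass 3 sl4) : Prop :=
  ∀ (P : (Fin 4 → ℂ) × (Fin 3 → Fin 4 → ℂ)) (x : Fin 3 → sl4), (∀ k, x k ∈ W.1) →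
    (Matrix.of fun i j => P.1 ⬝ᵥ (x j).1.mulVec (P.2 i)).det = 0

/-- All `2 × 2` minors are degenerate quadratic forms on `W`. -/
def MinorsDegenerate (W : Grass 3 sl4) : Prop :=
  ∀ (P : (Fin 4 → ℂ) × (Fin 4 → ℂ) × (Fin 4 → ℂ) × (Fin 4 → ℂ)) (x : Fin 3 → sl4),
    (∀ k, x k ∈ W.1) →
      (Matrix.of fun i j => minorPolar P.1 P.2.1 P.2.2.1 P.2.2.2 (x i).1 (x j).1).det = 0

/-- All elements of `W` have rank at most one. -/
def RankLeOne (W : Grass 3 sl4) : Prop :=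
  ∀ (P : (Fin 4 → ℂ) × (Fin 4 → ℂ) × (Fin 4 → ℂ) × (Fin 4 → ℂ)) (x : Fin 1 → sl4),
    (∀ k, x k ∈ W.1) → minorForm P.1 P.2.1 P.2.2.1 P.2.2.2 (x 0).1 = 0

/-- The elements of `W` commute with each other. -/
def PairwiseCommute (W : Grass 3 sl4) : Prop :=
  ∀ (P : (Fin 4 → ℂ) × (Fin 4 → ℂ)) (x : Fin 2 → sl4), (∀ k, x k ∈ W.1) →
    P.1 ⬝ᵥ ((x 0).1 * (x 1).1).mulVec P.2 - P.1 ⬝ᵥ ((x 1).1 * (x 0).1).mulVec P.2 = 0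

theorem isClosedInvariant_traceFormDegenerate : IsClosedInvariant TraceFormDegenerate :=
  isClosedInvariant_of_family (fun (_ : Unit) (x : Fin 3 → Matrix (Fin 4) (Fin 4) ℂ) =>
      (Matrix.of fun i j => (x i * x j).trace).det)
    (fun _ _ _ hw => IsPolyFun.det fun i j =>
      IsPolyFun.trace (IsPolyFun.matrix_mul (hw i) (hw j)))
    fun _ g => ⟨(), fun x => by simp only [conj_mul_conj, Matrix.trace_units_conj]⟩

theorem isClosedInvariant_traceSqVanishes : IsClosedInvariant TraceSqVanishes :=
  isClosedInvariant_of_family (fun (_ : Unit) (x : Fin 1 → Matrix (Fin 4) (Fin 4) ℂ) =>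
      (x 0 * x 0).trace)
    (fun _ _ _ hw => IsPolyFun.trace (IsPolyFun.matrix_mul (hw 0) (hw 0)))
    fun _ g => ⟨(), fun x => by simp only [conj_mul_conj, Matrix.trace_units_conj]⟩

theorem isClosedInvariant_traceCubeVanishes : IsClosedInvariant TraceCubeVanishes :=
  isClosedInvariant_of_family (fun (_ : Unit) (x : Fin 1 → Matrix (Fin 4) (Fin 4) ℂ) =>
      (x 0 * x 0 * x 0).trace)
    (fun _ _ _ hw => IsPolyFun.trace (IsPolyFun.matrix_mul
      (IsPolyFun.matrix_mul (hw 0) (hw 0)) (hw 0)))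
    fun _ g => ⟨(), fun x => by simp only [conj_mul_conj, Matrix.trace_units_conj]⟩

theorem isClosedInvariant_quarticTraceVanishes : IsClosedInvariant QuarticTraceVanishes :=
  isClosedInvariant_of_family (fun (_ : Unit) (x : Fin 1 → Matrix (Fin 4) (Fin 4) ℂ) =>
      7 * (x 0 * x 0).trace ^ 2 - 12 * ((x 0 * x 0) * (x 0 * x 0)).trace)
    (fun _ _ _ hw => by
      have h := IsPolyFun.matrix_mul (hw 0) (hw 0)
      exact ((IsPolyFun.const _).mul ((IsPolyFun.trace h).pow 2)).sub
        ((IsPolyFun.const _).mul (IsPolyFun.trace (IsPolyFun.matrix_mul h h))))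
    fun _ g => ⟨(), fun x => by simp only [conj_mul_conj, Matrix.trace_units_conj]⟩

theorem isClosedInvariant_columnsDependent : IsClosedInvariant ColumnsDependent :=
  isClosedInvariant_of_family (fun (P : (Fin 3 → Fin 4 → ℂ) × (Fin 4 → ℂ))
      (x : Fin 3 → Matrix (Fin 4) (Fin 4) ℂ) =>
      (Matrix.of fun i j => P.1 i ⬝ᵥ (x j).mulVec P.2).det)
    (fun _ _ _ hw => IsPolyFun.det fun _ j => IsPolyFun.form (hw j) _ _)
    fun P g => ⟨(fun i => Matrix.vecMul (P.1 i) (g : Matrix (Fin 4) (Fin 4) ℂ),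
      ((g⁻¹ : GL (Fin 4) ℂ) : Matrix (Fin 4) (Fin 4) ℂ).mulVec P.2),
      fun x => by simp only [form_conj]⟩

theorem isClosedInvariant_rowsDependent : IsClosedInvariant RowsDependent :=
  isClosedInvariant_of_family (fun (P : (Fin 4 → ℂ) × (Fin 3 → Fin 4 → ℂ))
      (x : Fin 3 → Matrix (Fin 4) (Fin 4) ℂ) =>
      (Matrix.of fun i j => P.1 ⬝ᵥ (x j).mulVec (P.2 i)).det)
    (fun _ _ _ hw => IsPolyFun.det fun _ j => IsPolyFun.form (hw j) _ _)
    fun P g => ⟨(Matrix.vecMul P.1 (g : Matrix (Fin 4) (Fin 4) ℂ),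
      fun i => ((g⁻¹ : GL (Fin 4) ℂ) : Matrix (Fin 4) (Fin 4) ℂ).mulVec (P.2 i)),
      fun x => by simp only [form_conj]⟩

theorem isClosedInvariant_minorsDegenerate : IsClosedInvariant MinorsDegenerate :=
  isClosedInvariant_of_family (fun (P : (Fin 4 → ℂ) × (Fin 4 → ℂ) × (Fin 4 → ℂ) × (Fin 4 → ℂ))
      (x : Fin 3 → Matrix (Fin 4) (Fin 4) ℂ) =>
      (Matrix.of fun i j => minorPolar P.1 P.2.1 P.2.2.1 P.2.2.2 (x i) (x j)).det)
    (fun P _ w hw => IsPolyFun.det fun i j => by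
      have h := fun k α v => IsPolyFun.form (hw k) α v
      exact (((h i _ _).mul (h j _ _)).sub ((h i _ _).mul (h j _ _))).add
        (((h j _ _).mul (h i _ _)).sub ((h j _ _).mul (h i _ _))))
    fun P g => ⟨(Matrix.vecMul P.1 (g : Matrix (Fin 4) (Fin 4) ℂ),
      Matrix.vecMul P.2.1 (g : Matrix (Fin 4) (Fin 4) ℂ),
      ((g⁻¹ : GL (Fin 4) ℂ) : Matrix (Fin 4) (Fin 4) ℂ).mulVec P.2.2.1,
      ((g⁻¹ : GL (Fin 4) ℂ) : Matrix (Fin 4) (Fin 4) ℂ).mulVec P.2.2.2),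
      fun x => by simp only [minorPolar, form_conj]⟩

theorem isClosedInvariant_rankLeOne : IsClosedInvariant RankLeOne :=
  isClosedInvariant_of_family (fun (P : (Fin 4 → ℂ) × (Fin 4 → ℂ) × (Fin 4 → ℂ) × (Fin 4 → ℂ))
      (x : Fin 1 → Matrix (Fin 4) (Fin 4) ℂ) =>
      minorForm P.1 P.2.1 P.2.2.1 P.2.2.2 (x 0))
    (fun P _ w hw => by
      have h := fun α v => IsPolyFun.form (hw 0) α v
      exact ((h _ _).mul (h _ _)).sub ((h _ _).mul (h _ _)))
    fun P g => ⟨(Matrix.vecMul P.1 (g : Matrix (Fin 4) (Fin 4) ℂ),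
      Matrix.vecMul P.2.1 (g : Matrix (Fin 4) (Fin 4) ℂ),
      ((g⁻¹ : GL (Fin 4) ℂ) : Matrix (Fin 4) (Fin 4) ℂ).mulVec P.2.2.1,
      ((g⁻¹ : GL (Fin 4) ℂ) : Matrix (Fin 4) (Fin 4) ℂ).mulVec P.2.2.2),
      fun x => by simp only [minorForm, form_conj]⟩

theorem isClosedInvariant_pairwiseCommute : IsClosedInvariant PairwiseCommute :=
  isClosedInvariant_of_family (fun (P : (Fin 4 → ℂ) × (Fin 4 → ℂ))
      (x : Fin 2 → Matrix (Fin 4) (Fin 4) ℂ) =>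
      P.1 ⬝ᵥ (x 0 * x 1).mulVec P.2 - P.1 ⬝ᵥ (x 1 * x 0).mulVec P.2)
    (fun P _ w hw => (IsPolyFun.form (IsPolyFun.matrix_mul (hw 0) (hw 1)) _ _).sub
      (IsPolyFun.form (IsPolyFun.matrix_mul (hw 1) (hw 0)) _ _))
    fun P g => ⟨(Matrix.vecMul P.1 (g : Matrix (Fin 4) (Fin 4) ℂ),
      ((g⁻¹ : GL (Fin 4) ℂ) : Matrix (Fin 4) (Fin 4) ℂ).mulVec P.2),
      fun x => by simp only [conj_mul_conj, form_conj]⟩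

theorem pairwiseCommute_iff {W : Grass 3 sl4} :
    PairwiseCommute W ↔ ∀ x ∈ W.1, ∀ y ∈ W.1, x.1 * y.1 = y.1 * x.1 := by
  constructor
  · intro h x hx y hy
    ext i j
    have := h (Pi.single i 1, Pi.single j 1) ![x, y] (by intro k; fin_cases k <;> assumption)
    simpa [sub_eq_zero] using this
  · intro h P x hx
    rw [h _ (hx 0) _ (hx 1), sub_self]

theorem mem_Ab4_iff {W : Grass 3 sl4} : W ∈ Ab4 ↔ PairwiseCommute W := by
  rw [pairwiseCommute_iff]
  constructor
  · rintro ⟨L, hL, h⟩ x hx y hy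
    rw [← h] at hx hy
    have h1 : ⁅(⟨x, hx⟩ : L), (⟨y, hy⟩ : L)⁆ = 0 := hL.trivial _ _
    have h2 : ⁅x, y⁆ = 0 := congrArg Subtype.val h1
    have h3 : (⁅x, y⁆ : sl4).1 = 0 := congrArg Subtype.val h2
    rw [LieAlgebra.SpecialLinear.sl_bracket] at h3
    exact sub_eq_zero.1 h3
  · intro h
    have hb : ∀ x ∈ W.1, ∀ y ∈ W.1, ⁅x, y⁆ = 0 := fun x hx y hy => Subtype.ext (by
      rw [LieAlgebra.SpecialLinear.sl_bracket, h x hx y hy, sub_self]; rfl)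
    refine ⟨{ W.1 with lie_mem' := fun {x y} hx hy => ?_ }, ⟨fun x y => ?_⟩, rfl⟩
    · have := hb x hx y hy
      rw [this]
      exact W.1.zero_mem
    · exact Subtype.ext (hb x.1 x.2 y.1 y.2)

/-! ### Values of the invariant conditions on the normal forms -/

theorem det_eq_zero_of_rank_two {M : Matrix (Fin 3) (Fin 3) ℂ} (p q P Q : Fin 3 → ℂ)
    (h : ∀ i j, M i j = p i * P j + q i * Q j) : M.det = 0 := by
  rw [Matrix.det_fin_three]
  simp only [h]
  ring

theorem tracelessFormMap_mem (o : OrbitType) (v : Fin 3 → ℂ) :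
    tracelessFormMap o v ∈ (normalAlgebra o).1 := ⟨v, rfl⟩

theorem exists_tracelessForm_of_mem {o : OrbitType} {m : ℕ} {x : Fin m → sl4}
    (hx : ∀ k, x k ∈ (normalAlgebra o).1) :
    ∃ r s u : Fin m → ℂ, ∀ k, (x k).1 = tracelessForm o (r k) (s k) (u k) := by
  choose r s u h using fun k => mem_normalAlgebra_iff_tracelessForm.1 (hx k)
  exact ⟨r, s, u, h⟩

open OrbitType

theorem traceFormDegenerate_O11 : TraceFormDegenerate (normalAlgebra O11) := fun _ x hx => by
  obtain ⟨r, s, u, h⟩ := exists_tracelessForm_of_mem hx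
  -- the trace form only sees the diagonal entries `r`, `r`, `u`, `-2 r - u`
  refine det_eq_zero_of_rank_two r u (fun j => 6 * r j + 2 * u j) (fun j => 2 * r j + 2 * u j)
    fun i j => ?_
  simp [h, tracelessForm, normalForm, Matrix.trace, Fin.sum_univ_four]
  ring

theorem not_traceFormDegenerate_O12 : ¬ TraceFormDegenerate (normalAlgebra O12) := fun h => by
  have := h () (fun k => tracelessFormMap O12 (Pi.single k 1)) fun k => tracelessFormMap_mem _ _
  simp [Matrix.det_fin_three, coe_tracelessFormMap, tracelessForm, normalForm, Matrix.trace,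
    Fin.sum_univ_four] at this
  norm_num at this

theorem traceCubeVanishes_O10' : TraceCubeVanishes (normalAlgebra O10') := fun _ x hx => by
  obtain ⟨r, s, u, h⟩ := exists_tracelessForm_of_mem hx
  simp [h, tracelessForm, normalForm, Matrix.trace, Fin.sum_univ_four]
  try ring

theorem not_traceCubeVanishes {o : OrbitType}
    (ho : o = O12 ∨ o = O11 ∨ o = O10'' ∨ o = O8' ∨ o = O8'') :
    ¬ TraceCubeVanishes (normalAlgebra o) := fun h => by
  rcases ho with rfl | rfl | rfl | rfl | rfl
  case inl =>
    have := h () (fun _ => tracelessFormMap O12 ![1, 1, 0]) fun _ => tracelessFormMap_mem _ _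
    simp [coe_tracelessFormMap, tracelessForm, normalForm, Matrix.trace, Fin.sum_univ_four] at this
    norm_num at this
  case inr.inl =>
    have := h () (fun _ => tracelessFormMap O11 ![1, 0, 0]) fun _ => tracelessFormMap_mem _ _
    simp [coe_tracelessFormMap, tracelessForm, normalForm, Matrix.trace, Fin.sum_univ_four] at this
    norm_num at this
  all_goals
    have := h () (fun _ => tracelessFormMap _ ![1, 0, 1]) fun _ => tracelessFormMap_mem _ _
    simp [coe_tracelessFormMap, tracelessForm, normalForm, Matrix.trace, Fin.sum_univ_four] at this
    norm_num at this

theorem quarticTraceVanishes_O10'' : QuarticTraceVanishes (normalAlgebra O10'') :=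
  fun _ x hx => by
    obtain ⟨r, s, u, h⟩ := exists_tracelessForm_of_mem hx
    simp [h, tracelessForm, normalForm, Matrix.trace, Fin.sum_univ_four]
    ring

theorem not_quarticTraceVanishes {o : OrbitType} (ho : o = O12 ∨ o = O11 ∨ o = O10') :
    ¬ QuarticTraceVanishes (normalAlgebra o) := fun h => by
  rcases ho with rfl | rfl | rfl
  case inl =>
    have := h () (fun _ => tracelessFormMap O12 ![1, -1, 0]) fun _ => tracelessFormMap_mem _ _
    simp [coe_tracelessFormMap, tracelessForm, normalForm, Matrix.trace, Fin.sum_univ_four] at this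
    norm_num at this
  case inr.inl =>
    have := h () (fun _ => tracelessFormMap O11 ![0, 0, 1]) fun _ => tracelessFormMap_mem _ _
    simp [coe_tracelessFormMap, tracelessForm, normalForm, Matrix.trace, Fin.sum_univ_four] at this
    norm_num at this
  case inr.inr =>
    have := h () (fun _ => tracelessFormMap O10' ![1, 0, 0]) fun _ => tracelessFormMap_mem _ _
    simp [coe_tracelessFormMap, tracelessForm, normalForm, Matrix.trace, Fin.sum_univ_four] at this
    norm_num at this

theorem traceSqVanishes {o : OrbitType}
    (ho : o = O9 ∨ o = O8 ∨ o = O7' ∨ o = O7'' ∨ o = O7 ∨ o = O6) :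
    TraceSqVanishes (normalAlgebra o) := fun _ x hx => by
  obtain ⟨r, s, u, h⟩ := exists_tracelessForm_of_mem hx
  rcases ho with rfl | rfl | rfl | rfl | rfl | rfl <;>
  simp [h, tracelessForm, normalForm, Matrix.trace, Fin.sum_univ_four]

theorem not_traceSqVanishes {o : OrbitType}
    (ho : o = O12 ∨ o = O11 ∨ o = O10' ∨ o = O10'' ∨ o = O8' ∨ o = O8'') :
    ¬ TraceSqVanishes (normalAlgebra o) := fun h => by
  rcases ho with rfl | rfl | rfl | rfl | rfl | rfl
  all_goals
    have := h () (fun _ => tracelessFormMap _ ![1, 0, 1]) fun _ => tracelessFormMap_mem _ _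
    simp [coe_tracelessFormMap, tracelessForm, normalForm, Matrix.trace, Fin.sum_univ_four] at this
    norm_num at this

theorem columnsDependent {o : OrbitType} (ho : o = O8' ∨ o = O7 ∨ o = O7' ∨ o = O6 ∨ o = O3') :
    ColumnsDependent (normalAlgebra o) := fun ⟨α, v⟩ x hx => by
  obtain ⟨r, s, u, h⟩ := exists_tracelessForm_of_mem hx
  rcases ho with rfl | rfl | rfl | rfl | rfl
  · refine det_eq_zero_of_rank_two (fun i => α i 0)
      (fun i => α i 0 * v 0 + α i 1 * v 1 + α i 2 * v 2 - 3 * α i 3 * v 3)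
      (fun j => s j * v 1 + r j * v 2) u fun i j => ?_
    simp [h, tracelessForm, normalForm, dotProduct, Matrix.mulVec, Fin.sum_univ_four]
    ring
  all_goals
    refine det_eq_zero_of_rank_two (fun i => α i 0) (fun i => α i 1)
      (fun j => ((x j).1.mulVec v) 0) (fun j => ((x j).1.mulVec v) 1) fun i j => ?_
    simp [h, tracelessForm, normalForm, dotProduct, Matrix.mulVec, Fin.sum_univ_four]

theorem not_columnsDependent {o : OrbitType} (ho : o = O12 ∨ o = O11 ∨ o = O10' ∨ o = O10'' ∨
    o = O9 ∨ o = O8 ∨ o = O8'' ∨ o = O7'' ∨ o = O3'') : ¬ ColumnsDependent (normalAlgebra o) := by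
  -- a vector `v`, and three coordinates in which the image of `W` under `x ↦ x v` is everything
  have key : ∀ (v : Fin 4 → ℂ) (I : Fin 3 → Fin 4),
      (Matrix.of fun i j => Pi.single (M := fun _ => ℂ) (I i) 1 ⬝ᵥ
        ((tracelessFormMap o (Pi.single j 1)).1).mulVec v).det ≠ 0 →
      ¬ ColumnsDependent (normalAlgebra o) := fun v I hne h =>
    hne (h (fun i => Pi.single (I i) 1, v) _ fun j => tracelessFormMap_mem _ _)
  rcases ho with rfl | rfl | rfl | rfl | rfl | rfl | rfl | rfl | rfl
  · refine key 1 ![0, 1, 2] ?_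
    simp [Matrix.det_fin_three, coe_tracelessFormMap, tracelessForm, normalForm,
      Matrix.mulVec, dotProduct, Fin.sum_univ_four]
  · refine key ![0, 1, 1, 1] ![0, 1, 2] ?_
    simp [Matrix.det_fin_three, coe_tracelessFormMap, tracelessForm, normalForm,
      Matrix.mulVec, dotProduct, Fin.sum_univ_four]
  · refine key ![0, 1, 0, 1] ![0, 1, 2] ?_
    simp [Matrix.det_fin_three, coe_tracelessFormMap, tracelessForm, normalForm,
      Matrix.mulVec, dotProduct, Fin.sum_univ_four]
  · refine key ![0, 0, 1, 1] ![0, 1, 2] ?_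
    simp [Matrix.det_fin_three, coe_tracelessFormMap, tracelessForm, normalForm,
      Matrix.mulVec, dotProduct, Fin.sum_univ_four]
  · refine key ![0, 0, 0, 1] ![0, 1, 2] ?_
    simp [Matrix.det_fin_three, coe_tracelessFormMap, tracelessForm, normalForm,
      Matrix.mulVec, dotProduct, Fin.sum_univ_four]
  · refine key ![0, 0, 0, 1] ![0, 1, 2] ?_
    simp [Matrix.det_fin_three, coe_tracelessFormMap, tracelessForm, normalForm,
      Matrix.mulVec, dotProduct, Fin.sum_univ_four]
  · refine key ![0, 0, 1, 0] ![0, 1, 2] ?_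
    simp [Matrix.det_fin_three, coe_tracelessFormMap, tracelessForm, normalForm,
      Matrix.mulVec, dotProduct, Fin.sum_univ_four]
  · refine key ![0, 0, 0, 1] ![0, 1, 2] ?_
    simp [Matrix.det_fin_three, coe_tracelessFormMap, tracelessForm, normalForm,
      Matrix.mulVec, dotProduct, Fin.sum_univ_four]
  · refine key ![0, 0, 0, 1] ![0, 1, 2] ?_
    simp [Matrix.det_fin_three, coe_tracelessFormMap, tracelessForm, normalForm,
      Matrix.mulVec, dotProduct, Fin.sum_univ_four]

theorem rowsDependent {o : OrbitType}
    (ho : o = O8'' ∨ o = O7 ∨ o = O7'' ∨ o = O6 ∨ o = O3'') :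
    RowsDependent (normalAlgebra o) := fun ⟨α, v⟩ x hx => by
  obtain ⟨r, s, u, h⟩ := exists_tracelessForm_of_mem hx
  rcases ho with rfl | rfl | rfl | rfl | rfl
  · refine det_eq_zero_of_rank_two (fun i => v i 2)
      (fun i => α 0 * v i 0 + α 1 * v i 1 + α 2 * v i 2 - 3 * α 3 * v i 3)
      (fun j => α 0 * r j + α 1 * s j) u fun i j => ?_
    simp [h, tracelessForm, normalForm, dotProduct, Matrix.mulVec, Fin.sum_univ_four]
    ring
  all_goals
    refine det_eq_zero_of_rank_two (fun i => v i 2) (fun i => v i 3)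
      (fun j => (Matrix.vecMul α (x j).1) 2) (fun j => (Matrix.vecMul α (x j).1) 3) fun i j => ?_
    simp [h, tracelessForm, normalForm, dotProduct, Matrix.mulVec, Matrix.vecMul,
      Fin.sum_univ_four]
    try ring

theorem not_rowsDependent {o : OrbitType} (ho : o = O12 ∨ o = O11 ∨ o = O10' ∨ o = O10'' ∨
    o = O9 ∨ o = O8 ∨ o = O8' ∨ o = O7' ∨ o = O3') : ¬ RowsDependent (normalAlgebra o) := by
  have key : ∀ (α : Fin 4 → ℂ) (I : Fin 3 → Fin 4),
      (Matrix.of fun i j => α ⬝ᵥ ((tracelessFormMap o (Pi.single j 1)).1).mulVec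
        (Pi.single (M := fun _ => ℂ) (I i) 1)).det ≠ 0 →
      ¬ RowsDependent (normalAlgebra o) := fun α I hne h =>
    hne (h (α, fun i => Pi.single (I i) 1) _ fun j => tracelessFormMap_mem _ _)
  rcases ho with rfl | rfl | rfl | rfl | rfl | rfl | rfl | rfl | rfl
  · refine key 1 ![0, 1, 2] ?_
    simp [Matrix.det_fin_three, coe_tracelessFormMap, tracelessForm, normalForm,
      Matrix.mulVec, dotProduct, Fin.sum_univ_four]
  · refine key ![1, 0, 1, 1] ![0, 1, 2] ?_
    simp [Matrix.det_fin_three, coe_tracelessFormMap, tracelessForm, normalForm,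
      Matrix.mulVec, dotProduct, Fin.sum_univ_four]
  · refine key ![1, 0, 1, 0] ![0, 1, 3] ?_
    simp [Matrix.det_fin_three, coe_tracelessFormMap, tracelessForm, normalForm,
      Matrix.mulVec, dotProduct, Fin.sum_univ_four]
  · refine key ![1, 0, 0, 1] ![0, 1, 2] ?_
    simp [Matrix.det_fin_three, coe_tracelessFormMap, tracelessForm, normalForm,
      Matrix.mulVec, dotProduct, Fin.sum_univ_four]
  · refine key ![1, 0, 0, 0] ![1, 2, 3] ?_
    simp [Matrix.det_fin_three, coe_tracelessFormMap, tracelessForm, normalForm,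
      Matrix.mulVec, dotProduct, Fin.sum_univ_four]
  · refine key ![1, 0, 0, 0] ![1, 2, 3] ?_
    simp [Matrix.det_fin_three, coe_tracelessFormMap, tracelessForm, normalForm,
      Matrix.mulVec, dotProduct, Fin.sum_univ_four]
  · refine key ![1, 0, 0, 0] ![0, 1, 2] ?_
    simp [Matrix.det_fin_three, coe_tracelessFormMap, tracelessForm, normalForm,
      Matrix.mulVec, dotProduct, Fin.sum_univ_four]
  · refine key ![1, 0, 0, 0] ![1, 2, 3] ?_
    simp [Matrix.det_fin_three, coe_tracelessFormMap, tracelessForm, normalForm,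
      Matrix.mulVec, dotProduct, Fin.sum_univ_four]
  · refine key ![1, 0, 0, 0] ![1, 2, 3] ?_
    simp [Matrix.det_fin_three, coe_tracelessFormMap, tracelessForm, normalForm,
      Matrix.mulVec, dotProduct, Fin.sum_univ_four]

theorem minorsDegenerate {o : OrbitType}
    (ho : o = O8 ∨ o = O8' ∨ o = O8'' ∨ o = O7' ∨ o = O7'' ∨ o = O6) :
    MinorsDegenerate (normalAlgebra o) := fun ⟨α, β, v, w⟩ x hx => by
  obtain ⟨r, s, u, h⟩ := exists_tracelessForm_of_mem hx
  rcases ho with rfl | rfl | rfl | rfl | rfl | rfl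
  · -- the minors are quadratic forms in `r` and `s`
    refine det_eq_zero_of_rank_two r s
      (fun j =>
        2 * ((α 0 * v 1 + α 1 * v 3) * (β 0 * w 1 + β 1 * w 3) -
          (α 0 * w 1 + α 1 * w 3) * (β 0 * v 1 + β 1 * v 3)) * r j +
        ((α 0 * v 1 + α 1 * v 3) * (β 0 * w 2 + β 2 * w 3) +
          (α 0 * v 2 + α 2 * v 3) * (β 0 * w 1 + β 1 * w 3) -
          (α 0 * w 1 + α 1 * w 3) * (β 0 * v 2 + β 2 * v 3) -
          (α 0 * w 2 + α 2 * w 3) * (β 0 * v 1 + β 1 * v 3)) * s j)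
      (fun j =>
        ((α 0 * v 1 + α 1 * v 3) * (β 0 * w 2 + β 2 * w 3) +
          (α 0 * v 2 + α 2 * v 3) * (β 0 * w 1 + β 1 * w 3) -
          (α 0 * w 1 + α 1 * w 3) * (β 0 * v 2 + β 2 * v 3) -
          (α 0 * w 2 + α 2 * w 3) * (β 0 * v 1 + β 1 * v 3)) * r j +
        2 * ((α 0 * v 2 + α 2 * v 3) * (β 0 * w 2 + β 2 * w 3) -
          (α 0 * w 2 + α 2 * w 3) * (β 0 * v 2 + β 2 * v 3)) * s j) fun i j => ?_
    simp [minorPolar, h, tracelessForm, normalForm, dotProduct, Matrix.mulVec, Fin.sum_univ_four]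
    ring
  -- in the remaining cases the minors are divisible by a linear form
  · let e : (Fin 4 → ℂ) → (Fin 4 → ℂ) → ℂ := fun a b =>
      a 0 * b 0 + a 1 * b 1 + a 2 * b 2 - 3 * a 3 * b 3
    let n : (Fin 4 → ℂ) → Fin 3 → ℂ := fun b j => s j * b 1 + r j * b 2
    let l : Fin 3 → ℂ := fun j => u j * (e α v * e β w - e α w * e β v) +
      (e α v * β 0 * n w j + e β w * α 0 * n v j - e α w * β 0 * n v j - e β v * α 0 * n w j)
    refine det_eq_zero_of_rank_two u l l u fun i j => ?_
    simp [l, e, n, minorPolar, h, tracelessForm, normalForm, dotProduct, Matrix.mulVec,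
      Fin.sum_univ_four]
    ring
  · let e : (Fin 4 → ℂ) → (Fin 4 → ℂ) → ℂ := fun a b =>
      a 0 * b 0 + a 1 * b 1 + a 2 * b 2 - 3 * a 3 * b 3
    let n : (Fin 4 → ℂ) → Fin 3 → ℂ := fun a j => a 0 * r j + a 1 * s j
    let l : Fin 3 → ℂ := fun j => u j * (e α v * e β w - e α w * e β v) +
      (e α v * w 2 * n β j + e β w * v 2 * n α j - e α w * v 2 * n β j - e β v * w 2 * n α j)
    refine det_eq_zero_of_rank_two u l l u fun i j => ?_
    simp [l, e, n, minorPolar, h, tracelessForm, normalForm, dotProduct, Matrix.mulVec,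
      Fin.sum_univ_four]
    ring
  · let l : Fin 3 → ℂ := fun j => (α 0 * β 1 - α 1 * β 0) *
      ((r j * v 1 + s j * v 2 + u j * v 3) * w 3 - (r j * w 1 + s j * w 2 + u j * w 3) * v 3)
    refine det_eq_zero_of_rank_two r l l r fun i j => ?_
    simp [l, minorPolar, h, tracelessForm, normalForm, dotProduct, Matrix.mulVec,
      Fin.sum_univ_four]
    ring
  · let l : Fin 3 → ℂ := fun j => (v 2 * w 3 - v 3 * w 2) *
      (α 0 * (β 0 * u j + β 1 * s j + β 2 * r j) - β 0 * (α 0 * u j + α 1 * s j + α 2 * r j))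
    refine det_eq_zero_of_rank_two r l l r fun i j => ?_
    simp [l, minorPolar, h, tracelessForm, normalForm, dotProduct, Matrix.mulVec,
      Fin.sum_univ_four]
    ring
  · let l : Fin 3 → ℂ := fun j => (α 0 * β 1 - α 1 * β 0) * (v 2 * w 3 - v 3 * w 2) * u j
    refine det_eq_zero_of_rank_two r l l r fun i j => ?_
    simp [l, minorPolar, h, tracelessForm, normalForm, dotProduct, Matrix.mulVec,
      Fin.sum_univ_four]
    ring

theorem not_minorsDegenerate {o : OrbitType} (ho : o = O9 ∨ o = O7) :
    ¬ MinorsDegenerate (normalAlgebra o) := fun h => by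
  have := h (Pi.single 0 1, Pi.single 1 1, Pi.single 2 1, Pi.single 3 1)
    (fun k => tracelessFormMap o (Pi.single k 1)) fun k => tracelessFormMap_mem _ _
  rcases ho with rfl | rfl
  all_goals
    simp [Matrix.det_fin_three, minorPolar, coe_tracelessFormMap, tracelessForm, normalForm] at this

theorem rankLeOne {o : OrbitType} (ho : o = O3' ∨ o = O3'') : RankLeOne (normalAlgebra o) :=
  fun ⟨α, β, v, w⟩ x hx => by
    obtain ⟨r, s, u, h⟩ := exists_tracelessForm_of_mem hx
    rcases ho with rfl | rfl
    all_goals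
      simp [minorForm, h, tracelessForm, normalForm, dotProduct, Matrix.mulVec, Fin.sum_univ_four]
      ring

theorem not_rankLeOne {o : OrbitType} (h1 : o ≠ O3') (h2 : o ≠ O3'') :
    ¬ RankLeOne (normalAlgebra o) := by
  have key : ∀ (y : Fin 3 → ℂ) (a b v w : Fin 4),
      minorForm (Pi.single a 1) (Pi.single b 1) (Pi.single v 1) (Pi.single w 1)
        (tracelessFormMap o y).1 ≠ 0 → ¬ RankLeOne (normalAlgebra o) := fun y a b v w hne h =>
    hne (h (_, _, _, _) (fun _ => tracelessFormMap o y) fun _ => tracelessFormMap_mem _ _)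
  cases o
  case O3' => exact absurd rfl h1
  case O3'' => exact absurd rfl h2
  case O12 => exact key ![1, 1, 0] 0 1 0 1 (by
    simp [minorForm, coe_tracelessFormMap, tracelessForm, normalForm])
  case O11 => exact key ![1, 0, 0] 0 1 0 1 (by
    simp [minorForm, coe_tracelessFormMap, tracelessForm, normalForm])
  case O10' => exact key ![1, 0, 0] 0 1 0 1 (by
    simp [minorForm, coe_tracelessFormMap, tracelessForm, normalForm])
  case O10'' => exact key ![1, 0, 0] 0 1 0 1 (by
    simp [minorForm, coe_tracelessFormMap, tracelessForm, normalForm])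
  case O9 => exact key ![1, 0, 0] 0 1 1 2 (by
    simp [minorForm, coe_tracelessFormMap, tracelessForm, normalForm])
  case O8 => exact key ![1, 0, 0] 0 1 1 3 (by
    simp [minorForm, coe_tracelessFormMap, tracelessForm, normalForm])
  case O8' => exact key ![0, 0, 1] 0 1 0 1 (by
    simp [minorForm, coe_tracelessFormMap, tracelessForm, normalForm])
  case O8'' => exact key ![0, 0, 1] 0 1 0 1 (by
    simp [minorForm, coe_tracelessFormMap, tracelessForm, normalForm])
  case O7' => exact key ![1, 0, 0] 0 1 1 3 (by
    simp [minorForm, coe_tracelessFormMap, tracelessForm, normalForm])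
  case O7'' => exact key ![1, 0, 0] 0 2 2 3 (by
    simp [minorForm, coe_tracelessFormMap, tracelessForm, normalForm])
  case O7 => exact key ![1, 0, 1] 0 1 2 3 (by
    simp [minorForm, coe_tracelessFormMap, tracelessForm, normalForm])
  case O6 => exact key ![1, 0, 1] 0 1 2 3 (by
    simp [minorForm, coe_tracelessFormMap, tracelessForm, normalForm])

/-! ### The degeneration order -/

section Order

open OrbitType Relation

theorem reflTransGen_O7' {o : OrbitType} (h : o = O7' ∨ o = O6 ∨ o = O3') :
    ReflTransGen Arrow O7' o := by
  rcases h with rfl | rfl | rfl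
  exacts [.refl, .single .a15, .single .a17]

theorem reflTransGen_O7'' {o : OrbitType} (h : o = O7'' ∨ o = O6 ∨ o = O3'') :
    ReflTransGen Arrow O7'' o := by
  rcases h with rfl | rfl | rfl
  exacts [.refl, .single .a16, .single .a18]

theorem reflTransGen_O8 {o : OrbitType}
    (h : o = O8 ∨ o = O7' ∨ o = O7'' ∨ o = O6 ∨ o = O3' ∨ o = O3'') :
    ReflTransGen Arrow O8 o := by
  rcases h with rfl | rfl | rfl | rfl | rfl | rfl
  exacts [.refl, .single .a10, .single .a11, .head .a10 (.single .a15),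
    .head .a10 (.single .a17), .head .a11 (.single .a18)]

theorem reflTransGen_O9 {o : OrbitType}
    (h : o = O9 ∨ o = O8 ∨ o = O7 ∨ o = O7' ∨ o = O7'' ∨ o = O6 ∨ o = O3' ∨ o = O3'') :
    ReflTransGen Arrow O9 o := by
  rcases h with rfl | rfl | rfl | h
  exacts [.refl, .single .a8, .single .a9, .head .a8 (reflTransGen_O8 (.inr h))]

theorem reflTransGen_O10'' {o : OrbitType}
    (h : o ≠ O12 ∧ o ≠ O11 ∧ o ≠ O10') : ReflTransGen Arrow O10'' o := by
  cases o
  case O12 => exact absurd rfl h.1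
  case O11 => exact absurd rfl h.2.1
  case O10' => exact absurd rfl h.2.2
  case O10'' => exact .refl
  case O8' => exact .single .a6
  case O8'' => exact .single .a7
  all_goals exact .head .a5 (reflTransGen_O9 (by simp))

theorem reflTransGen_O11 {o : OrbitType} (h : o ≠ O12) : ReflTransGen Arrow O11 o := by
  cases o
  case O12 => exact absurd rfl h
  case O11 => exact .refl
  case O10' => exact .single .a2
  all_goals exact .head .a3 (reflTransGen_O10'' (by simp))

theorem reflTransGen_O12 (o : OrbitType) : ReflTransGen Arrow O12 o := by
  by_cases h : o = O12
  · rw [h]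
  · exact .head .a1 (reflTransGen_O11 h)

/-- There are no degenerations other than the chains of arrows: for any other pair of types, one of
the closed invariant conditions holds for `o` and fails for `o'`. -/
theorem reflTransGen_of_mem_closure_orbit {o o' : OrbitType} {W : Grass 3 sl4}
    (hW : W ∈ MulAction.orbit PGL(Fin 4, ℂ) (normalAlgebra o'))
    (h : W ∈ zariskiClosure (MulAction.orbit PGL(Fin 4, ℂ) (normalAlgebra o))) :
    ReflTransGen Arrow o o' := by
  obtain ⟨g, rfl⟩ := hW
  have inv : ∀ {C : Grass 3 sl4 → Prop}, IsClosedInvariant C → C (normalAlgebra o) →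
      ¬ ¬ C (normalAlgebra o') := fun hC ho => not_not.2 (by
    rw [← inv_smul_smul g (normalAlgebra o')]
    exact hC.smul g⁻¹ (hC.of_mem_closure_orbit h ho))
  have sq := fun ho => mt not_traceSqVanishes (inv isClosedInvariant_traceSqVanishes ho)
  have col := fun ho => mt not_columnsDependent (inv isClosedInvariant_columnsDependent ho)
  have row := fun ho => mt not_rowsDependent (inv isClosedInvariant_rowsDependent ho)
  have minor := fun ho => mt not_minorsDegenerate (inv isClosedInvariant_minorsDegenerate ho)
  have rank := fun ho (hne : o' ≠ O3' ∧ o' ≠ O3'') =>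
    inv isClosedInvariant_rankLeOne ho (not_rankLeOne hne.1 hne.2)
  cases o
  case O12 => exact reflTransGen_O12 o'
  case O11 =>
    refine reflTransGen_O11 fun h0 => ?_
    subst h0
    exact inv isClosedInvariant_traceFormDegenerate traceFormDegenerate_O11
      not_traceFormDegenerate_O12
  case O10' =>
    have h1 := mt not_traceCubeVanishes
      (inv isClosedInvariant_traceCubeVanishes traceCubeVanishes_O10')
    cases o'
    case O10' => exact .refl
    case O12 | O11 | O10'' | O8' | O8'' => exact absurd (by simp) h1
    all_goals exact .head .a4 (reflTransGen_O9 (by simp))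
  case O10'' =>
    have h1 := mt not_quarticTraceVanishes
      (inv isClosedInvariant_quarticTraceVanishes quarticTraceVanishes_O10'')
    exact reflTransGen_O10'' (by simpa only [not_or] using h1)
  case O9 =>
    have h1 := sq (traceSqVanishes (by simp))
    cases o'
    case O12 | O11 | O10' | O10'' | O8' | O8'' => exact absurd (by simp) h1
    all_goals exact reflTransGen_O9 (by simp)
  case O8 =>
    have h1 := sq (traceSqVanishes (by simp))
    have h2 := minor (minorsDegenerate (by simp))
    cases o'
    case O12 | O11 | O10' | O10'' | O8' | O8'' => exact absurd (by simp) h1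
    case O9 | O7 => exact absurd (by simp) h2
    all_goals exact reflTransGen_O8 (by simp)
  case O8' =>
    have h1 := col (columnsDependent (by simp))
    have h2 := minor (minorsDegenerate (by simp))
    cases o'
    case O7 => exact absurd (by simp) h2
    case O8' => exact .refl
    case O7' | O6 | O3' => exact .head .a12 (reflTransGen_O7' (by simp))
    all_goals exact absurd (by simp) h1
  case O8'' =>
    have h1 := row (rowsDependent (by simp))
    have h2 := minor (minorsDegenerate (by simp))
    cases o'
    case O7 => exact absurd (by simp) h2
    case O8'' => exact .refl
    case O7'' | O6 | O3'' => exact .head .a13 (reflTransGen_O7'' (by simp))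
    all_goals exact absurd (by simp) h1
  case O7' =>
    have h1 := sq (traceSqVanishes (by simp))
    have h2 := col (columnsDependent (by simp))
    have h3 := minor (minorsDegenerate (by simp))
    cases o'
    case O7 => exact absurd (by simp) h3
    case O8' => exact absurd (by simp) h1
    case O7' | O6 | O3' => exact reflTransGen_O7' (by simp)
    all_goals exact absurd (by simp) h2
  case O7'' =>
    have h1 := sq (traceSqVanishes (by simp))
    have h2 := row (rowsDependent (by simp))
    have h3 := minor (minorsDegenerate (by simp))
    cases o'
    case O7 => exact absurd (by simp) h3
    case O8'' => exact absurd (by simp) h1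
    case O7'' | O6 | O3'' => exact reflTransGen_O7'' (by simp)
    all_goals exact absurd (by simp) h2
  case O7 =>
    have h1 := sq (traceSqVanishes (by simp))
    have h2 := col (columnsDependent (by simp))
    have h3 := row (rowsDependent (by simp))
    cases o'
    case O7 => exact .refl
    case O6 => exact .single .a14
    case O8' => exact absurd (by simp) h1
    case O7' | O3' => exact absurd (by simp) h3
    all_goals exact absurd (by simp) h2
  case O6 =>
    have h1 := sq (traceSqVanishes (by simp))
    have h2 := col (columnsDependent (by simp))
    have h3 := row (rowsDependent (by simp))
    have h4 := minor (minorsDegenerate (by simp))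
    cases o'
    case O6 => exact .refl
    case O7 => exact absurd (by simp) h4
    case O8' => exact absurd (by simp) h1
    case O7' | O3' => exact absurd (by simp) h3
    all_goals exact absurd (by simp) h2
  case O3' =>
    have h1 := col (columnsDependent (by simp))
    have h2 := rank (rankLeOne (by simp))
    cases o'
    case O3' => exact .refl
    case O3'' => exact absurd (by simp) h1
    all_goals exact absurd (by simp) h2
  case O3'' =>
    have h1 := row (rowsDependent (by simp))
    have h2 := rank (rankLeOne (by simp))
    cases o'
    case O3'' => exact .refl
    case O3' => exact absurd (by simp) h1
    all_goals exact absurd (by simp) h2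

/-- The dimensions of the orbits. All that matters about these numbers is that they decrease along
the arrows. -/
def orbitDim : OrbitType → ℕ
  | O12 => 12 | O11 => 11 | O10' => 10 | O10'' => 10 | O9 => 9 | O8 => 8 | O8' => 8 | O8'' => 8
  | O7' => 7 | O7'' => 7 | O7 => 7 | O6 => 6 | O3' => 3 | O3'' => 3

theorem orbitDim_lt_of_arrow {o o' : OrbitType} (h : Arrow o o') : orbitDim o' < orbitDim o := by
  cases h <;> simp [orbitDim]

theorem eq_or_orbitDim_lt {o o' : OrbitType} (h : ReflTransGen Arrow o o') :
    o' = o ∨ orbitDim o' < orbitDim o := by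
  induction h with
  | refl => exact .inl rfl
  | tail _ h ih =>
    have := orbitDim_lt_of_arrow h
    rcases ih with rfl | ih
    · exact .inr this
    · exact .inr (this.trans ih)

theorem eq_of_reflTransGen {o o' : OrbitType} (h : ReflTransGen Arrow o o')
    (h' : ReflTransGen Arrow o' o) : o = o' := by
  rcases eq_or_orbitDim_lt h with h1 | h1
  · exact h1.symm
  · rcases eq_or_orbitDim_lt h' with h2 | h2
    · exact h2
    · exact absurd h1 h2.not_gt

end Order

/-! ### One-parameter degenerations -/

/-- If the matrices `N t r s u` are of trace zero, depend continuously on `t`, are for `t ≠ 0`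
simultaneously brought into the shape `normalForm o` by an invertible matrix `g t`, and are the
elements of the normal form `o'` for `t = 0`, then the orbit of type `o'` lies in the closure of the
orbit of type `o`. When the `g t` are diagonal, this is the limit of the normal form `o` under a
one-parameter group of diagonal matrices. -/
theorem orbit_subset_closure_of_family {o o' : OrbitType} (g : ℂ → Matrix (Fin 4) (Fin 4) ℂ)
    (N : ℂ → ℂ → ℂ → ℂ → Matrix (Fin 4) (Fin 4) ℂ)
    (hcont : ∀ r s u i j, Continuous fun t => N t r s u i j)
    (htrace : ∀ t r s u, (N t r s u).trace = 0)
    (hdet : ∀ t ≠ 0, (g t).det ≠ 0)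
    (hN : ∀ t ≠ 0, ∀ r s u, ∃ a b c d, N t r s u * g t = g t * normalForm o a b c d)
    (h0 : ∀ r s u, N 0 r s u = tracelessForm o' r s u) :
    MulAction.orbit PGL(Fin 4, ℂ) (normalAlgebra o') ⊆
      zariskiClosure (MulAction.orbit PGL(Fin 4, ℂ) (normalAlgebra o)) := by
  rintro _ ⟨h, rfl⟩
  induction h using pgl_induction with | h h => ?_
  let e : Fin 3 → Fin 3 → ℂ := fun k => Pi.single k 1
  let x : ℂ → Fin 3 → sl4 := fun t k => ⟨N t (e k 0) (e k 1) (e k 2), htrace _ _ _ _⟩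
  have hx0 : ∀ k, x 0 k = tracelessFormMap o' (e k) := fun k => Subtype.ext (h0 _ _ _)
  refine mem_zariskiClosure_of_continuous (fun t k => conjLinearMap h (x t k)) (fun f k => ?_)
    ?_ (fun k => ?_) fun t ht hli => ?_
  · obtain ⟨c, hc⟩ := exists_functional_eq_sum (f ∘ₗ conjLinearMap h)
    have h1 : ∀ t, f (conjLinearMap h (x t k)) = _ := fun t => hc (x t k)
    simp only [h1]
    exact continuous_finsetSum _ fun i _ => continuous_finsetSum _ fun j _ =>
      (hcont _ _ _ i j).mul continuous_const
  · have h1 : LinearIndependent ℂ e := by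
      have : e = Pi.basisFun ℂ (Fin 3) := funext fun k => by simp [e]
      rw [this]
      exact (Pi.basisFun ℂ (Fin 3)).linearIndependent
    have h2 : LinearIndependent ℂ fun k => conjEquiv h (tracelessFormMap o' (e k)) :=
      (h1.map' (tracelessFormMap o')
        (LinearMap.ker_eq_bot.2 (tracelessFormMap_injective o'))).map'
        (conjEquiv h : sl4 →ₗ[ℂ] sl4) (LinearEquiv.ker _)
    simp only [hx0]
    exact h2
  · rw [hx0]
    exact mem_mk_smul.2 ⟨_, tracelessFormMap_mem o' _, rfl⟩
  · -- the span of the vectors at time `t`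
    let Y : Grass 3 sl4 := ⟨Submodule.span ℂ (Set.range (x t)), by
      rw [finrank_span_eq_card, Fintype.card_fin]
      exact hli.of_comp (conjLinearMap h)⟩
    have hY : Y ∈ MulAction.orbit PGL(Fin 4, ℂ) (normalAlgebra o) := by
      refine mem_orbit_normalAlgebra (g t) (hdet t ht) fun y hy => ?_
      obtain ⟨c, rfl⟩ := (Submodule.mem_span_range_iff_exists_fun ℂ).1 hy
      choose a b c' d h1 using fun k => hN t ht (e k 0) (e k 1) (e k 2)
      have key : ∀ v : Fin 4 → Fin 3 → ℂ, ∑ k, c k • normalForm o (v 0 k) (v 1 k) (v 2 k) (v 3 k) =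
          normalForm o (∑ k, c k * v 0 k) (∑ k, c k * v 1 k) (∑ k, c k * v 2 k)
            (∑ k, c k * v 3 k) := fun v => by
        cases o <;> simp [Fin.sum_univ_three, normalForm]
      refine ⟨_, _, _, _, Eq.trans ?_ (congrArg (g t * ·) (key ![a, b, c', d]))⟩
      rw [Matrix.mul_sum]
      have h2 : (∑ k, c k • x t k : sl4).1 = ∑ k, c k • (x t k).1 := by
        simp
      rw [h2, Matrix.sum_mul]
      refine Finset.sum_congr rfl fun k _ => ?_
      rw [Matrix.smul_mul, Matrix.mul_smul]
      exact congrArg (c k • ·) (h1 k)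
    obtain ⟨g', hg'⟩ := hY
    refine ⟨Matrix.ProjGenLinGroup.mk h • Y, ⟨Matrix.ProjGenLinGroup.mk h * g', ?_⟩, fun k => ?_⟩
    · rw [← hg']
      exact mul_smul _ _ _
    · exact mem_mk_smul.2 ⟨x t k, Submodule.subset_span ⟨k, rfl⟩, rfl⟩

section Arrows

open OrbitType

theorem orbit_O11_subset_closure_O12 :
    MulAction.orbit PGL(Fin 4, ℂ) (normalAlgebra O11) ⊆
      zariskiClosure (MulAction.orbit PGL(Fin 4, ℂ) (normalAlgebra O12)) := by
  -- two distinct eigenvalues collide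
  refine orbit_subset_closure_of_family
    (fun t => !![1, 1, 0, 0; 0, t, 0, 0; 0, 0, 1, 0; 0, 0, 0, 1])
    (fun t r s u => !![r, s, 0, 0; 0, r + t * s, 0, 0; 0, 0, u, 0; 0, 0, 0, -2 * r - t * s - u])
    (fun r s u i j => ?_) (fun t r s u => ?_) (fun t ht => ?_) (fun t ht r s u => ?_)
    fun r s u => ?_
  · fin_cases i <;> fin_cases j <;> simp <;> fun_prop
  · simp [Matrix.trace, Fin.sum_univ_four]
    ring
  · simpa [Matrix.det_succ_row_zero, Fin.sum_univ_succ] using ht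
  · refine ⟨r, r + t * s, u, -2 * r - t * s - u, ?_⟩
    ext i j
    fin_cases i <;> fin_cases j <;> simp [normalForm, Matrix.mul_apply, Fin.sum_univ_four] <;>
      ring
  · simp [tracelessForm, normalForm]

theorem orbit_O10'_subset_closure_O11 :
    MulAction.orbit PGL(Fin 4, ℂ) (normalAlgebra O10') ⊆
      zariskiClosure (MulAction.orbit PGL(Fin 4, ℂ) (normalAlgebra O11)) := by
  -- the two simple eigenvalues collide
  refine orbit_subset_closure_of_family
    (fun t => !![1, 0, 0, 0; 0, 1, 0, 0; 0, 0, 1, 1; 0, 0, 0, t])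
    (fun t r s u => !![r, s, 0, 0; 0, r, 0, 0; 0, 0, -r - t * u / 2, u; 0, 0, 0, -r + t * u / 2])
    (fun r s u i j => ?_) (fun t r s u => ?_) (fun t ht => ?_) (fun t ht r s u => ?_)
    fun r s u => ?_
  · fin_cases i <;> fin_cases j <;> simp <;> fun_prop
  · simp [Matrix.trace, Fin.sum_univ_four]
    ring
  · simpa [Matrix.det_succ_row_zero, Fin.sum_univ_succ] using ht
  · refine ⟨r, s, -r - t * u / 2, -r + t * u / 2, ?_⟩
    ext i j
    fin_cases i <;> fin_cases j <;> simp [normalForm, Matrix.mul_apply, Fin.sum_univ_four] <;>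
      ring
  · simp [tracelessForm, normalForm]

theorem orbit_O10''_subset_closure_O11 :
    MulAction.orbit PGL(Fin 4, ℂ) (normalAlgebra O10'') ⊆
      zariskiClosure (MulAction.orbit PGL(Fin 4, ℂ) (normalAlgebra O11)) := by
  -- polynomials in a matrix with minimal polynomial `X ^ 2 * (X - t)` on a summand of
  -- dimension three
  refine orbit_subset_closure_of_family
    (fun t => !![1, 0, 1, 0; 0, 1, t, 0; 0, 0, t ^ 2, 0; 0, 0, 0, 1])
    (fun t r s u => !![r, s, u, 0;
        0, r, s + t * u, 0;
        0, 0, r + t * s + t ^ 2 * u, 0;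
        0, 0, 0, -3 * r - t * s - t ^ 2 * u])
    (fun r s u i j => ?_) (fun t r s u => ?_) (fun t ht => ?_) (fun t ht r s u => ?_)
    fun r s u => ?_
  · fin_cases i <;> fin_cases j <;> simp <;> fun_prop
  · simp [Matrix.trace, Fin.sum_univ_four]
    ring
  · simpa [Matrix.det_succ_row_zero, Fin.sum_univ_succ] using ht
  · refine ⟨r, s, r + t * s + t ^ 2 * u, -3 * r - t * s - t ^ 2 * u, ?_⟩
    ext i j
    fin_cases i <;> fin_cases j <;> simp [normalForm, Matrix.mul_apply, Fin.sum_univ_four] <;>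
      ring
  · simp [tracelessForm, normalForm]

theorem orbit_O9_subset_closure_O10' :
    MulAction.orbit PGL(Fin 4, ℂ) (normalAlgebra O9) ⊆
      zariskiClosure (MulAction.orbit PGL(Fin 4, ℂ) (normalAlgebra O10')) := by
  -- polynomials in a matrix with minimal polynomial `X ^ 2 * (X - t) ^ 2`
  refine orbit_subset_closure_of_family
    (fun t => !![1, 0, 1, 0; 0, 1, t, 1; 0, 0, t ^ 2, 2 * t; 0, 0, 0, t ^ 2])
    (fun t r s u => !![-((t * r + t ^ 2 * s + t ^ 3 * u) / 2), r, s + t * u, u;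
        0, -((t * r + t ^ 2 * s + t ^ 3 * u) / 2), r + t * s + t ^ 2 * u, s + 2 * t * u;
        0, 0, (t * r + t ^ 2 * s + t ^ 3 * u) / 2, r + 2 * t * s + 3 * t ^ 2 * u;
        0, 0, 0, (t * r + t ^ 2 * s + t ^ 3 * u) / 2])
    (fun r s u i j => ?_) (fun t r s u => ?_) (fun t ht => ?_) (fun t ht r s u => ?_)
    fun r s u => ?_
  · fin_cases i <;> fin_cases j <;> simp <;> fun_prop
  · simp [Matrix.trace, Fin.sum_univ_four]
  · simpa [Matrix.det_succ_row_zero, Fin.sum_univ_succ] using ht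
  · refine ⟨-((t * r + t ^ 2 * s + t ^ 3 * u) / 2), r, (t * r + t ^ 2 * s + t ^ 3 * u) / 2,
      r + 2 * t * s + 3 * t ^ 2 * u, ?_⟩
    ext i j
    fin_cases i <;> fin_cases j <;> simp [normalForm, Matrix.mul_apply, Fin.sum_univ_four] <;>
      ring
  · simp [tracelessForm, normalForm]

theorem orbit_O9_subset_closure_O10'' :
    MulAction.orbit PGL(Fin 4, ℂ) (normalAlgebra O9) ⊆
      zariskiClosure (MulAction.orbit PGL(Fin 4, ℂ) (normalAlgebra O10'')) := by
  -- polynomials in a matrix with minimal polynomial `X ^ 3 * (X - t)`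
  refine orbit_subset_closure_of_family
    (fun t => !![1, 0, 0, 1; 0, 1, 0, t; 0, 0, 1, t ^ 2; 0, 0, 0, t ^ 3])
    (fun t r s u => !![-((t * r + t ^ 2 * s + t ^ 3 * u) / 4), r, s, u;
        0, -((t * r + t ^ 2 * s + t ^ 3 * u) / 4), r, s + t * u;
        0, 0, -((t * r + t ^ 2 * s + t ^ 3 * u) / 4), r + t * s + t ^ 2 * u;
        0, 0, 0, 3 * (t * r + t ^ 2 * s + t ^ 3 * u) / 4])
    (fun r s u i j => ?_) (fun t r s u => ?_) (fun t ht => ?_) (fun t ht r s u => ?_)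
    fun r s u => ?_
  · fin_cases i <;> fin_cases j <;> simp <;> fun_prop
  · simp [Matrix.trace, Fin.sum_univ_four]
    ring
  · simpa [Matrix.det_succ_row_zero, Fin.sum_univ_succ] using ht
  · refine ⟨-((t * r + t ^ 2 * s + t ^ 3 * u) / 4), r, s,
      3 * (t * r + t ^ 2 * s + t ^ 3 * u) / 4, ?_⟩
    ext i j
    fin_cases i <;> fin_cases j <;> simp [normalForm, Matrix.mul_apply, Fin.sum_univ_four] <;>
      ring
  · simp [tracelessForm, normalForm]

theorem orbit_O8'_subset_closure_O10'' :
    MulAction.orbit PGL(Fin 4, ℂ) (normalAlgebra O8') ⊆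
      zariskiClosure (MulAction.orbit PGL(Fin 4, ℂ) (normalAlgebra O10'')) := by
  refine orbit_subset_closure_of_family
    (fun t => !![t, 0, 0, 0; 0, t, 0, 0; 0, 0, 1, 0; 0, 0, 0, 1])
    (fun t r s u => !![u, s, r, 0; 0, u, t * s, 0; 0, 0, u, 0; 0, 0, 0, -3 * u])
    (fun r s u i j => ?_) (fun t r s u => ?_) (fun t ht => ?_) (fun t ht r s u => ?_)
    fun r s u => ?_
  · fin_cases i <;> fin_cases j <;> simp <;> fun_prop
  · simp [Matrix.trace, Fin.sum_univ_four]
    ring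
  · simpa [Matrix.det_succ_row_zero, Fin.sum_univ_succ] using ht
  · refine ⟨u, s, r / t, -3 * u, ?_⟩
    ext i j
    fin_cases i <;> fin_cases j <;> simp [normalForm, Matrix.mul_apply, Fin.sum_univ_four] <;>
      field_simp
  · simp [tracelessForm, normalForm]

theorem orbit_O8''_subset_closure_O10'' :
    MulAction.orbit PGL(Fin 4, ℂ) (normalAlgebra O8'') ⊆
      zariskiClosure (MulAction.orbit PGL(Fin 4, ℂ) (normalAlgebra O10'')) := by
  refine orbit_subset_closure_of_family
    (fun t => !![t, 0, 0, 0; 0, 1, 0, 0; 0, 0, 1, 0; 0, 0, 0, 1])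
    (fun t r s u => !![u, t * s, r, 0; 0, u, s, 0; 0, 0, u, 0; 0, 0, 0, -3 * u])
    (fun r s u i j => ?_) (fun t r s u => ?_) (fun t ht => ?_) (fun t ht r s u => ?_)
    fun r s u => ?_
  · fin_cases i <;> fin_cases j <;> simp <;> fun_prop
  · simp [Matrix.trace, Fin.sum_univ_four]
    ring
  · simpa [Matrix.det_succ_row_zero, Fin.sum_univ_succ] using ht
  · refine ⟨u, s, r / t, -3 * u, ?_⟩
    ext i j
    fin_cases i <;> fin_cases j <;> simp [normalForm, Matrix.mul_apply, Fin.sum_univ_four] <;>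
      field_simp
  · simp [tracelessForm, normalForm]

theorem orbit_O8_subset_closure_O9 :
    MulAction.orbit PGL(Fin 4, ℂ) (normalAlgebra O8) ⊆
      zariskiClosure (MulAction.orbit PGL(Fin 4, ℂ) (normalAlgebra O9)) := by
  -- Let `X` and `Y` be the elements of the limit algebra with the parameters `(r, s, u) = (1, 0, 0)`
  -- and `(0, 1, 0)`. The algebra is spanned by `X`, `Y`, `X ^ 2` with `X ^ 2 = Y ^ 2` and
  -- `X * Y = 0`, that is, with `U ^ 2 = V ^ 2 = 0` for `U = X + I * Y` and `V = X - I * Y`. It is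
  -- deformed to `U ^ 2 = 4 * t * V`, `V ^ 2 = 0`, where the algebra is spanned by the powers of `U`.
  refine orbit_subset_closure_of_family
    (fun t => !![8 * t, 0, 0, 0;
        0, 4 * t, 1, 0;
        0, -4 * t * Complex.I, Complex.I, 0;
        0, 0, 0, 1])
    (fun t r s u => !![0, r, s, u;
        0, t * (r - Complex.I * s), -Complex.I * t * (r - Complex.I * s), r;
        0, -Complex.I * t * (r - Complex.I * s), -t * (r - Complex.I * s), s;
        0, 0, 0, 0])
    (fun r s u i j => ?_) (fun t r s u => ?_) (fun t ht => ?_) (fun t ht r s u => ?_)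
    fun r s u => ?_
  · fin_cases i <;> fin_cases j <;> simp <;> fun_prop
  · simp [Matrix.trace, Fin.sum_univ_four]
  · simpa [Matrix.det_succ_row_zero, Fin.sum_univ_succ] using ht
  · refine ⟨(r - Complex.I * s) / 2, (r + Complex.I * s) / (8 * t), u / (8 * t), 0, ?_⟩
    ext i j
    fin_cases i <;> fin_cases j <;> simp [normalForm, Matrix.mul_apply, Fin.sum_univ_four] <;>
      field_simp <;> ring_nf <;> simp only [Complex.I_sq, Complex.I_pow_three] <;> ring
  · simp [tracelessForm, normalForm]

theorem orbit_O7_subset_closure_O9 :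
    MulAction.orbit PGL(Fin 4, ℂ) (normalAlgebra O7) ⊆
      zariskiClosure (MulAction.orbit PGL(Fin 4, ℂ) (normalAlgebra O9)) := by
  -- the first two vectors of a Jordan basis are interchanged, and the basis is scaled by powers
  -- of `t`
  refine orbit_subset_closure_of_family
    (fun t => !![0, t, 0, 0; t ^ 2, 0, 0, 0; 0, 0, t, 0; 0, 0, 0, 1])
    (fun t r s u => !![0, 0, r, s; t * r, 0, s, u; 0, 0, 0, t * r; 0, 0, 0, 0])
    (fun r s u i j => ?_) (fun t r s u => ?_) (fun t ht => ?_) (fun t ht r s u => ?_)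
    fun r s u => ?_
  · fin_cases i <;> fin_cases j <;> simp <;> fun_prop
  · simp [Matrix.trace, Fin.sum_univ_four]
  · simpa [Matrix.det_succ_row_zero, Fin.sum_univ_succ, Fin.succAbove] using ht
  · refine ⟨r, s / t, u / t ^ 2, 0, ?_⟩
    ext i j
    fin_cases i <;> fin_cases j <;> simp [normalForm, Matrix.mul_apply, Fin.sum_univ_four] <;>
      field_simp
  · simp [tracelessForm, normalForm]

theorem orbit_O7'_subset_closure_O8 :
    MulAction.orbit PGL(Fin 4, ℂ) (normalAlgebra O7') ⊆
      zariskiClosure (MulAction.orbit PGL(Fin 4, ℂ) (normalAlgebra O8)) := by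
  refine orbit_subset_closure_of_family
    (fun t => !![1, 0, 0, 0; 0, 1, 0, 0; 0, 0, t, 0; 0, 0, 0, 1])
    (fun t r s u => !![0, r, s, u; 0, 0, 0, r; 0, 0, 0, t ^ 2 * s; 0, 0, 0, 0])
    (fun r s u i j => ?_) (fun t r s u => ?_) (fun t ht => ?_) (fun t ht r s u => ?_)
    fun r s u => ?_
  · fin_cases i <;> fin_cases j <;> simp <;> fun_prop
  · simp [Matrix.trace, Fin.sum_univ_four]
  · simpa [Matrix.det_succ_row_zero, Fin.sum_univ_succ] using ht
  · refine ⟨r, t * s, u, 0, ?_⟩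
    ext i j
    fin_cases i <;> fin_cases j <;> simp [normalForm, Matrix.mul_apply, Fin.sum_univ_four] <;>
      ring
  · simp [tracelessForm, normalForm]

theorem orbit_O7''_subset_closure_O8 :
    MulAction.orbit PGL(Fin 4, ℂ) (normalAlgebra O7'') ⊆
      zariskiClosure (MulAction.orbit PGL(Fin 4, ℂ) (normalAlgebra O8)) := by
  refine orbit_subset_closure_of_family
    (fun t => !![t, 0, 0, 0; 0, 1, 0, 0; 0, 0, t, 0; 0, 0, 0, t])
    (fun t r s u => !![0, t ^ 2 * s, r, u; 0, 0, 0, s; 0, 0, 0, r; 0, 0, 0, 0])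
    (fun r s u i j => ?_) (fun t r s u => ?_) (fun t ht => ?_) (fun t ht r s u => ?_)
    fun r s u => ?_
  · fin_cases i <;> fin_cases j <;> simp <;> fun_prop
  · simp [Matrix.trace, Fin.sum_univ_four]
  · simpa [Matrix.det_succ_row_zero, Fin.sum_univ_succ] using ht
  · refine ⟨t * s, r, u, 0, ?_⟩
    ext i j
    fin_cases i <;> fin_cases j <;> simp [normalForm, Matrix.mul_apply, Fin.sum_univ_four] <;>
      ring
  · simp [tracelessForm, normalForm]

theorem orbit_O7'_subset_closure_O8' :
    MulAction.orbit PGL(Fin 4, ℂ) (normalAlgebra O7') ⊆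
      zariskiClosure (MulAction.orbit PGL(Fin 4, ℂ) (normalAlgebra O8')) := by
  -- the simple eigenvalue collides with the triple one
  refine orbit_subset_closure_of_family
    (fun t => !![1, 0, 0, 1; 0, 1, 0, t; 0, 0, 1, 0; 0, 0, 0, t ^ 2])
    (fun t r s u => !![-((t * r + t ^ 2 * u) / 4), r, s, u;
        0, -((t * r + t ^ 2 * u) / 4), 0, r + t * u;
        0, 0, -((t * r + t ^ 2 * u) / 4), 0;
        0, 0, 0, 3 * (t * r + t ^ 2 * u) / 4])
    (fun r s u i j => ?_) (fun t r s u => ?_) (fun t ht => ?_) (fun t ht r s u => ?_)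
    fun r s u => ?_
  · fin_cases i <;> fin_cases j <;> simp <;> fun_prop
  · simp [Matrix.trace, Fin.sum_univ_four]
    ring
  · simpa [Matrix.det_succ_row_zero, Fin.sum_univ_succ] using ht
  · refine ⟨s, r, -((t * r + t ^ 2 * u) / 4), 3 * (t * r + t ^ 2 * u) / 4, ?_⟩
    ext i j
    fin_cases i <;> fin_cases j <;> simp [normalForm, Matrix.mul_apply, Fin.sum_univ_four] <;>
      ring
  · simp [tracelessForm, normalForm]

theorem orbit_O7''_subset_closure_O8'' :
    MulAction.orbit PGL(Fin 4, ℂ) (normalAlgebra O7'') ⊆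
      zariskiClosure (MulAction.orbit PGL(Fin 4, ℂ) (normalAlgebra O8'')) := by
  -- the simple eigenvalue collides with the triple one
  refine orbit_subset_closure_of_family
    (fun t => !![-t, 0, -1, 1; 0, 1, 0, 0; t ^ 2, 0, 0, 0; 0, 0, t ^ 2, 0])
    (fun t r s u => !![3 * (t * r + t ^ 2 * u) / 4, 0, r + t * u, u;
        0, -((t * r + t ^ 2 * u) / 4), 0, s;
        0, 0, -((t * r + t ^ 2 * u) / 4), r;
        0, 0, 0, -((t * r + t ^ 2 * u) / 4)])
    (fun r s u i j => ?_) (fun t r s u => ?_) (fun t ht => ?_) (fun t ht r s u => ?_)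
    fun r s u => ?_
  · fin_cases i <;> fin_cases j <;> simp <;> fun_prop
  · simp [Matrix.trace, Fin.sum_univ_four]
    ring
  · simpa [Matrix.det_succ_row_zero, Fin.sum_univ_succ, Fin.succAbove] using ht
  · refine ⟨r, t ^ 2 * s, -((t * r + t ^ 2 * u) / 4), 3 * (t * r + t ^ 2 * u) / 4, ?_⟩
    ext i j
    fin_cases i <;> fin_cases j <;> simp [normalForm, Matrix.mul_apply, Fin.sum_univ_four] <;>
      ring
  · simp [tracelessForm, normalForm]

theorem orbit_O6_subset_closure_O7 :
    MulAction.orbit PGL(Fin 4, ℂ) (normalAlgebra O6) ⊆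
      zariskiClosure (MulAction.orbit PGL(Fin 4, ℂ) (normalAlgebra O7)) := by
  refine orbit_subset_closure_of_family
    (fun t => !![1, 0, 0, 0; 0, t, 0, 0; 0, 0, 1, 0; 0, 0, 0, 1])
    (fun t r s u => !![0, 0, r, s; 0, 0, t * s, u; 0, 0, 0, 0; 0, 0, 0, 0])
    (fun r s u i j => ?_) (fun t r s u => ?_) (fun t ht => ?_) (fun t ht r s u => ?_)
    fun r s u => ?_
  · fin_cases i <;> fin_cases j <;> simp <;> fun_prop
  · simp [Matrix.trace, Fin.sum_univ_four]
  · simpa [Matrix.det_succ_row_zero, Fin.sum_univ_succ] using ht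
  · refine ⟨r, s, u / t, 0, ?_⟩
    ext i j
    fin_cases i <;> fin_cases j <;> simp [normalForm, Matrix.mul_apply, Fin.sum_univ_four] <;>
      field_simp
  · simp [tracelessForm, normalForm]

theorem orbit_O6_subset_closure_O7' :
    MulAction.orbit PGL(Fin 4, ℂ) (normalAlgebra O6) ⊆
      zariskiClosure (MulAction.orbit PGL(Fin 4, ℂ) (normalAlgebra O7')) := by
  refine orbit_subset_closure_of_family
    (fun t => !![t, 0, 0, 0; 0, 1, 0, 0; 0, 0, t, 0; 0, 0, 0, 1])
    (fun t r s u => !![0, t * u, r, s; 0, 0, 0, u; 0, 0, 0, 0; 0, 0, 0, 0])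
    (fun r s u i j => ?_) (fun t r s u => ?_) (fun t ht => ?_) (fun t ht r s u => ?_)
    fun r s u => ?_
  · fin_cases i <;> fin_cases j <;> simp <;> fun_prop
  · simp [Matrix.trace, Fin.sum_univ_four]
  · simpa [Matrix.det_succ_row_zero, Fin.sum_univ_succ] using ht
  · refine ⟨u, r, s / t, 0, ?_⟩
    ext i j
    fin_cases i <;> fin_cases j <;> simp [normalForm, Matrix.mul_apply, Fin.sum_univ_four] <;>
      field_simp
  · simp [tracelessForm, normalForm]

theorem orbit_O6_subset_closure_O7'' :
    MulAction.orbit PGL(Fin 4, ℂ) (normalAlgebra O6) ⊆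
      zariskiClosure (MulAction.orbit PGL(Fin 4, ℂ) (normalAlgebra O7'')) := by
  refine orbit_subset_closure_of_family
    (fun t => !![t, 0, 0, 0; 0, 1, 0, 0; 0, 0, t, 0; 0, 0, 0, 1])
    (fun t r s u => !![0, 0, r, s; 0, 0, 0, u; 0, 0, 0, t * r; 0, 0, 0, 0])
    (fun r s u i j => ?_) (fun t r s u => ?_) (fun t ht => ?_) (fun t ht r s u => ?_)
    fun r s u => ?_
  · fin_cases i <;> fin_cases j <;> simp <;> fun_prop
  · simp [Matrix.trace, Fin.sum_univ_four]
  · simpa [Matrix.det_succ_row_zero, Fin.sum_univ_succ] using ht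
  · refine ⟨r, u, s / t, 0, ?_⟩
    ext i j
    fin_cases i <;> fin_cases j <;> simp [normalForm, Matrix.mul_apply, Fin.sum_univ_four] <;>
      field_simp
  · simp [tracelessForm, normalForm]

theorem orbit_O3'_subset_closure_O7' :
    MulAction.orbit PGL(Fin 4, ℂ) (normalAlgebra O3') ⊆
      zariskiClosure (MulAction.orbit PGL(Fin 4, ℂ) (normalAlgebra O7')) := by
  refine orbit_subset_closure_of_family
    (fun t => !![t, 0, 0, 0; 0, t, 0, 0; 0, 0, t, 0; 0, 0, 0, 1])
    (fun t r s u => !![0, r, s, u; 0, 0, 0, t * r; 0, 0, 0, 0; 0, 0, 0, 0])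
    (fun r s u i j => ?_) (fun t r s u => ?_) (fun t ht => ?_) (fun t ht r s u => ?_)
    fun r s u => ?_
  · fin_cases i <;> fin_cases j <;> simp <;> fun_prop
  · simp [Matrix.trace, Fin.sum_univ_four]
  · simpa [Matrix.det_succ_row_zero, Fin.sum_univ_succ] using ht
  · refine ⟨r, s, u / t, 0, ?_⟩
    ext i j
    fin_cases i <;> fin_cases j <;> simp [normalForm, Matrix.mul_apply, Fin.sum_univ_four] <;>
      field_simp
  · simp [tracelessForm, normalForm]

theorem orbit_O3''_subset_closure_O7'' :
    MulAction.orbit PGL(Fin 4, ℂ) (normalAlgebra O3'') ⊆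
      zariskiClosure (MulAction.orbit PGL(Fin 4, ℂ) (normalAlgebra O7'')) := by
  refine orbit_subset_closure_of_family
    (fun t => !![t, 0, 0, 0; 0, 1, 0, 0; 0, 0, 1, 0; 0, 0, 0, 1])
    (fun t r s u => !![0, 0, t * r, u; 0, 0, 0, s; 0, 0, 0, r; 0, 0, 0, 0])
    (fun r s u i j => ?_) (fun t r s u => ?_) (fun t ht => ?_) (fun t ht r s u => ?_)
    fun r s u => ?_
  · fin_cases i <;> fin_cases j <;> simp <;> fun_prop
  · simp [Matrix.trace, Fin.sum_univ_four]
  · simpa [Matrix.det_succ_row_zero, Fin.sum_univ_succ] using ht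
  · refine ⟨r, s, u / t, 0, ?_⟩
    ext i j
    fin_cases i <;> fin_cases j <;> simp [normalForm, Matrix.mul_apply, Fin.sum_univ_four] <;>
      field_simp
  · simp [tracelessForm, normalForm]

theorem orbit_subset_closure_of_arrow {o o' : OrbitType} (h : Arrow o o') :
    MulAction.orbit PGL(Fin 4, ℂ) (normalAlgebra o') ⊆
      zariskiClosure (MulAction.orbit PGL(Fin 4, ℂ) (normalAlgebra o)) := by
  cases h
  case a1 => exact orbit_O11_subset_closure_O12
  case a2 => exact orbit_O10'_subset_closure_O11
  case a3 => exact orbit_O10''_subset_closure_O11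
  case a4 => exact orbit_O9_subset_closure_O10'
  case a5 => exact orbit_O9_subset_closure_O10''
  case a6 => exact orbit_O8'_subset_closure_O10''
  case a7 => exact orbit_O8''_subset_closure_O10''
  case a8 => exact orbit_O8_subset_closure_O9
  case a9 => exact orbit_O7_subset_closure_O9
  case a10 => exact orbit_O7'_subset_closure_O8
  case a11 => exact orbit_O7''_subset_closure_O8
  case a12 => exact orbit_O7'_subset_closure_O8'
  case a13 => exact orbit_O7''_subset_closure_O8''
  case a14 => exact orbit_O6_subset_closure_O7
  case a15 => exact orbit_O6_subset_closure_O7'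
  case a16 => exact orbit_O6_subset_closure_O7''
  case a17 => exact orbit_O3'_subset_closure_O7'
  case a18 => exact orbit_O3''_subset_closure_O7''

theorem orbit_subset_closure_of_reflTransGen {o o' : OrbitType}
    (h : Relation.ReflTransGen Arrow o o') :
    MulAction.orbit PGL(Fin 4, ℂ) (normalAlgebra o') ⊆
      zariskiClosure (MulAction.orbit PGL(Fin 4, ℂ) (normalAlgebra o)) := by
  induction h with
  | refl => exact subset_zariskiClosure _
  | tail _ h ih =>
    have h1 := zariskiClosure_mono ih
    rw [zariskiClosure_idem] at h1
    exact (orbit_subset_closure_of_arrow h).trans h1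

end Arrows

/-! ### Commuting families of endomorphisms in dimensions at most three -/

section CommutingFamilies

open Module

variable {E : Type*} [AddCommGroup E] [Module ℂ E]

theorem exists_coeff [FiniteDimensional ℂ E] {n : ℕ} {b : Fin n → E} (hb : LinearIndependent ℂ b)
    (hE : finrank ℂ E = n) (u : E) : ∃ c : Fin n → ℂ, ∑ i, c i • b i = u := by
  have h := hb.span_eq_top_of_card_eq_finrank' (by rw [Fintype.card_fin, hE])
  exact (Submodule.mem_span_range_iff_exists_fun ℂ).1 (h ▸ Submodule.mem_top)

theorem exists_extension [FiniteDimensional ℂ E] {n k : ℕ} {v : Fin k → E}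
    (hv : LinearIndependent ℂ v) (hE : finrank ℂ E = n) (hk : k ≤ n) :
    ∃ b : Fin n → E, LinearIndependent ℂ b ∧ ∀ i, b (Fin.castLE hk i) = v i := by
  obtain ⟨d, rfl⟩ := Nat.exists_eq_add_of_le hk
  induction d generalizing k with
  | zero => exact ⟨v, hv, fun i => rfl⟩
  | succ d ih =>
    obtain ⟨x, hx⟩ := exists_linearIndependent_snoc_of_lt_finrank hv (by omega)
    have e : k + (d + 1) = (k + 1) + d := by omega
    obtain ⟨b, hb, hbv⟩ := ih hx (by omega) (by omega)
    refine ⟨b ∘ Fin.cast e, hb.comp _ (Fin.cast_injective e), fun i => ?_⟩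
    have := hbv i.castSucc
    rw [Fin.snoc_castSucc] at this
    exact this

theorem linearIndependent_combination {n : ℕ} {b : Fin n → E} (hb : LinearIndependent ℂ b)
    (A : Matrix (Fin n) (Fin n) ℂ) (hA : A.det ≠ 0) :
    LinearIndependent ℂ fun j => ∑ i, A i j • b i := by
  rw [Fintype.linearIndependent_iff] at hb ⊢
  intro c hc
  have h : A.mulVec c = 0 := by
    funext i
    refine hb (A.mulVec c) ?_ i
    rw [← hc]
    simp only [Matrix.mulVec, dotProduct, Finset.sum_smul, Finset.smul_sum]
    rw [Finset.sum_comm]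
    refine Finset.sum_congr rfl fun j _ => Finset.sum_congr rfl fun i _ => ?_
    rw [smul_smul, mul_comm]
  exact fun i => congrFun (Matrix.eq_zero_of_mulVec_eq_zero hA h) i

/-- Linearly independent vectors of two complementary subspaces, put together. -/
theorem linearIndependent_append {p q : Submodule ℂ E} (h : IsCompl p q) {m n : ℕ}
    {v : Fin m → p} {w : Fin n → q} (hv : LinearIndependent ℂ v) (hw : LinearIndependent ℂ w) :
    LinearIndependent ℂ (Fin.append (fun i => (v i : E)) fun j => (w j : E)) := by
  have h1 := hv.map' p.subtype (Submodule.ker_subtype p)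
  have h2 := hw.map' q.subtype (Submodule.ker_subtype q)
  have h3 := h1.sum_type h2 (h.disjoint.mono
    (Submodule.span_le.2 (by rintro _ ⟨i, rfl⟩; exact (v i).2))
    (Submodule.span_le.2 (by rintro _ ⟨i, rfl⟩; exact (w i).2)))
  have h4 := h3.comp finSumFinEquiv.symm finSumFinEquiv.symm.injective
  have h5 : (Fin.append (fun i => (v i : E)) fun j => (w j : E)) =
      Sum.elim (p.subtype ∘ v) (q.subtype ∘ w) ∘ finSumFinEquiv.symm :=
    funext fun i => by refine Fin.addCases (fun i => ?_) (fun i => ?_) i <;> simp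
  rw [h5]
  exact h4

theorem eq_zero_of_isNilpotent_of_apply_eq_smul {y : End ℂ E} (hy : IsNilpotent y) {w : E}
    (hw : w ≠ 0) {c : ℂ} (h : y w = c • w) : c = 0 := by
  obtain ⟨n, hn⟩ := hy
  have h1 : ∀ k, (y ^ k) w = c ^ k • w := fun k => by
    induction k with
    | zero => simp
    | succ k ih => rw [pow_succ', Module.End.mul_apply, ih, map_smul, h, smul_smul, pow_succ]
  have h2 := h1 n
  rw [hn, LinearMap.zero_apply] at h2
  exact eq_zero_of_pow_eq_zero ((smul_eq_zero.1 h2.symm).resolve_right hw)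

theorem pow_eq_zero_of_isNilpotent [FiniteDimensional ℂ E] {n : ℕ} (hE : finrank ℂ E = n)
    {y : End ℂ E} (hy : IsNilpotent y) : y ^ n = 0 := by
  have h := LinearMap.aeval_self_charpoly y
  rw [hy.charpoly_eq_X_pow_finrank, hE] at h
  simpa using h

theorem linearIndependent_pow_apply {x : End ℂ E} {v : E} {n : ℕ} (hx : x ^ (n + 1) = 0)
    (hv : (x ^ n) v ≠ 0) : LinearIndependent ℂ fun k : Fin (n + 1) => (x ^ (k : ℕ)) v := by
  rw [Fintype.linearIndependent_iff]
  intro c hc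
  have key : ∀ m : ℕ, ∀ k : Fin (n + 1), (k : ℕ) = m → c k = 0 := fun m => by
    induction m using Nat.strong_induction_on with
    | _ m ih =>
      intro k hk
      have h1 := congrArg (x ^ (n - m)) hc
      rw [map_zero, map_sum, Finset.sum_eq_single k] at h1
      · rw [map_smul, ← Module.End.mul_apply, ← pow_add, hk, Nat.sub_add_cancel (by omega)] at h1
        exact (smul_eq_zero.1 h1).resolve_right hv
      · intro j _ hj
        rcases lt_or_gt_of_ne (fun h => hj (Fin.ext h) : (j : ℕ) ≠ k) with h | h
        · rw [ih j (hk ▸ h) j rfl, zero_smul, map_zero]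
        · rw [map_smul, ← Module.End.mul_apply, ← pow_add,
            pow_eq_zero_of_le (by omega : n + 1 ≤ n - m + j) hx, LinearMap.zero_apply, smul_zero]
      · simp
  exact fun k => key k k rfl

/-- A nilpotent endomorphism that commutes with a nilpotent endomorphism `x` with a single Jordan
block is a polynomial in `x` without constant term. -/
theorem exists_apply_eq_sum_pow [FiniteDimensional ℂ E] {x y : End ℂ E} {v : E} {n : ℕ}
    (hE : finrank ℂ E = n + 1) (hx : IsNilpotent x) (hy : IsNilpotent y) (hxy : Commute x y)
    (hv : (x ^ n) v ≠ 0) :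
    ∃ c : Fin (n + 1) → ℂ, c 0 = 0 ∧ y v = ∑ k, c k • (x ^ (k : ℕ)) v := by
  have hx0 := pow_eq_zero_of_isNilpotent hE hx
  obtain ⟨c, hc⟩ := exists_coeff (linearIndependent_pow_apply hx0 hv) hE (y v)
  refine ⟨c, eq_zero_of_isNilpotent_of_apply_eq_smul hy hv ?_, hc.symm⟩
  rw [← Module.End.mul_apply, ← (hxy.pow_left n).eq, Module.End.mul_apply, ← hc, map_sum,
    Finset.sum_eq_single 0]
  · simp
  · intro k _ hk
    have : 0 < (k : ℕ) := Fin.pos_iff_ne_zero.2 hk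
    rw [map_smul, ← Module.End.mul_apply, ← pow_add, pow_eq_zero_of_le (by omega) hx0,
      LinearMap.zero_apply, smul_zero]
  · simp

/-- A family of pairwise commuting endomorphisms that is closed under addition. -/
structure IsCommutingFamily {ι : Type*} (f : ι → End ℂ E) : Prop where
  comm : ∀ i j, Commute (f i) (f j)
  add : ∀ i j, ∃ k, f k = f i + f j

variable {ι : Type*} {f : ι → End ℂ E}

theorem IsCommutingFamily.restrict (hf : IsCommutingFamily f) {p : Submodule ℂ E}
    (hp : ∀ i, ∀ v ∈ p, f i v ∈ p) : IsCommutingFamily fun i => (f i).restrict (hp i) where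
  comm i j := LinearMap.ext fun v => Subtype.ext (LinearMap.congr_fun (hf.comm i j).eq (v : E))
  add i j := by
    obtain ⟨k, hk⟩ := hf.add i j
    exact ⟨k, LinearMap.ext fun v => Subtype.ext (LinearMap.congr_fun hk (v : E))⟩

/-- Either every member of the family has only one eigenvalue, or the space splits into two
nonzero invariant subspaces. -/
theorem IsCommutingFamily.exists_isNilpotent_or_isCompl [FiniteDimensional ℂ E] [Nontrivial E]
    (hf : IsCommutingFamily f) :
    (∃ μ : ι → ℂ, (∀ i, IsNilpotent (f i - algebraMap ℂ _ (μ i))) ∧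
      IsCommutingFamily fun i => f i - algebraMap ℂ _ (μ i)) ∨
    ∃ p q : Submodule ℂ E, IsCompl p q ∧ p ≠ ⊥ ∧ q ≠ ⊥ ∧ (∀ i, ∀ v ∈ p, f i v ∈ p) ∧
      ∀ i, ∀ v ∈ q, f i v ∈ q := by
  choose μ hμ using fun i => Module.End.exists_eigenvalue (f i)
  have hcomm : ∀ i j, Commute (f i - algebraMap ℂ _ (μ i)) (f j) := fun i j =>
    (hf.comm i j).sub_left (Algebra.commutes _ _)
  by_cases hnil : ∀ i, IsNilpotent (f i - algebraMap ℂ _ (μ i))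
  · have hcomm' : ∀ i j, Commute (f i - algebraMap ℂ _ (μ i)) (f j - algebraMap ℂ _ (μ j)) :=
      fun i j => (hcomm i j).sub_right (Algebra.commutes _ _).symm
    refine .inl ⟨μ, hnil, hcomm', fun i j => ?_⟩
    obtain ⟨k, hk⟩ := hf.add i j
    refine ⟨k, ?_⟩
    -- the difference of the two sides is nilpotent and scalar
    have h1 : IsNilpotent (f k - algebraMap ℂ _ (μ k) -
        ((f i - algebraMap ℂ _ (μ i)) + (f j - algebraMap ℂ _ (μ j)))) :=
      Commute.isNilpotent_sub ((hcomm' k i).add_right (hcomm' k j)) (hnil k)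
        ((hcomm' i j).isNilpotent_add (hnil i) (hnil j))
    have h2 : f k - algebraMap ℂ _ (μ k) -
        ((f i - algebraMap ℂ _ (μ i)) + (f j - algebraMap ℂ _ (μ j))) =
        algebraMap ℂ (End ℂ E) (μ i + μ j - μ k) := by
      rw [hk, map_sub, map_add]
      abel
    rw [h2] at h1
    obtain ⟨v, hv⟩ := exists_ne (0 : E)
    have h3 := eq_zero_of_isNilpotent_of_apply_eq_smul h1 hv
      (by rw [Module.algebraMap_end_apply])
    rw [h3, map_zero, sub_eq_zero] at h2
    exact h2
  · push Not at hnil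
    obtain ⟨i, hi⟩ := hnil
    set N := f i - algebraMap ℂ (End ℂ E) (μ i) with hN
    obtain ⟨n, hn, hn0⟩ := ((LinearMap.eventually_isCompl_ker_pow_range_pow N).and
      (Filter.eventually_ge_atTop 1)).exists
    have hc : ∀ j v, f j ((N ^ n) v) = (N ^ n) (f j v) := fun j v =>
      (LinearMap.congr_fun ((hcomm i j).pow_left n).eq v).symm
    refine .inr ⟨_, _, hn, fun h => ?_, fun h => ?_, fun j v hv => ?_, fun j v hv => ?_⟩
    · obtain ⟨v, hv⟩ := (hμ i).exists_hasEigenvector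
      have h1 : v ∈ LinearMap.ker (N ^ n) := by
        have h2 : N v = 0 := by
          rw [hN, LinearMap.sub_apply, hv.apply_eq_smul, Module.algebraMap_end_apply, sub_self]
        obtain ⟨m, rfl⟩ : ∃ m, n = m + 1 := ⟨n - 1, by omega⟩
        rw [LinearMap.mem_ker, pow_succ, Module.End.mul_apply, h2, map_zero]
      rw [h] at h1
      exact hv.2 ((Submodule.mem_bot ℂ).1 h1)
    · exact hi ⟨n, LinearMap.range_eq_bot.1 h⟩
    · rw [LinearMap.mem_ker] at hv ⊢
      rw [← hc, hv, map_zero]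
    · obtain ⟨w, rfl⟩ := hv
      exact ⟨f j w, (hc j w).symm⟩

theorem apply_eq_of_sub_algebraMap_apply_eq {x : End ℂ E} {c : ℂ} {v u : E}
    (h : (x - algebraMap ℂ _ c) v = u) : x v = c • v + u := by
  rw [← h, LinearMap.sub_apply, Module.algebraMap_end_apply]
  abel

theorem exists_eigenvector_of_finrank_one (hE : finrank ℂ E = 1) (f : ι → End ℂ E) :
    ∃ b : Fin 1 → E, LinearIndependent ℂ b ∧ ∀ i, ∃ p : ℂ, f i (b 0) = p • b 0 := by
  obtain ⟨v, hv, h⟩ := finrank_eq_one_iff'.1 hE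
  refine ⟨fun _ => v, LinearIndependent.of_subsingleton (ι := Fin 1) 0 hv, fun i => ?_⟩
  obtain ⟨c, hc⟩ := h (f i v)
  exact ⟨c, hc.symm⟩

/-- In dimension two, commuting nilpotent endomorphisms are multiples of one of them. -/
theorem IsCommutingFamily.exists_basis_of_isNilpotent_two (hf : IsCommutingFamily f)
    (hnil : ∀ i, IsNilpotent (f i)) (hE : finrank ℂ E = 2) :
    ∃ b : Fin 2 → E, LinearIndependent ℂ b ∧
      ∀ i, ∃ q : ℂ, f i (b 0) = 0 ∧ f i (b 1) = q • b 0 := by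
  have : FiniteDimensional ℂ E := FiniteDimensional.of_finrank_pos (by omega)
  by_cases h0 : ∀ i v, f i v = 0
  · let b := Module.finBasisOfFinrankEq ℂ E hE
    exact ⟨b, b.linearIndependent, fun i => ⟨0, h0 i _, by rw [h0, zero_smul]⟩⟩
  · push Not at h0
    obtain ⟨i, v, hv⟩ := h0
    have hx2 : f i ^ 2 = 0 := pow_eq_zero_of_isNilpotent hE (hnil i)
    have hli := linearIndependent_pow_apply (x := f i) (v := v) (n := 1) hx2 (by simpa using hv)
    refine ⟨![f i v, v], ?_, fun j => ?_⟩
    · have h1 := hli.comp ![1, 0] (by decide)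
      have h2 : ![f i v, v] = (fun k : Fin 2 => (f i ^ (k : ℕ)) v) ∘ ![1, 0] := by
        funext k
        fin_cases k <;> simp
      rw [h2]
      exact h1
    · obtain ⟨c, hc0, hc⟩ := exists_apply_eq_sum_pow (n := 1) hE (hnil i) (hnil j)
        (hf.comm i j) (v := v) (by simpa using hv)
      rw [Fin.sum_univ_two, hc0] at hc
      simp only [Fin.val_zero, Fin.val_one, pow_one, zero_smul, zero_add] at hc
      refine ⟨c 1, ?_, by simpa using hc⟩
      change f j (f i v) = 0
      rw [← Module.End.mul_apply, ← (hf.comm i j).eq, Module.End.mul_apply, hc, map_smul,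
        ← Module.End.mul_apply, ← pow_two, hx2, LinearMap.zero_apply, smul_zero]

/-- In dimension two a commuting family is diagonalizable or consists of upper triangular matrices
with equal diagonal entries. -/
theorem IsCommutingFamily.exists_basis_of_finrank_two (hf : IsCommutingFamily f)
    (hE : finrank ℂ E = 2) :
    (∃ b : Fin 2 → E, LinearIndependent ℂ b ∧
      ∀ i, ∃ p q : ℂ, f i (b 0) = p • b 0 ∧ f i (b 1) = q • b 1) ∨
    ∃ b : Fin 2 → E, LinearIndependent ℂ b ∧
      ∀ i, ∃ p q : ℂ, f i (b 0) = p • b 0 ∧ f i (b 1) = q • b 0 + p • b 1 := by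
  have : FiniteDimensional ℂ E := FiniteDimensional.of_finrank_pos (by omega)
  have : Nontrivial E := Module.nontrivial_of_finrank_pos (R := ℂ) (by omega)
  rcases hf.exists_isNilpotent_or_isCompl with ⟨μ, hnil, hN⟩ | ⟨p, q, hpq, hp, hq, hfp, hfq⟩
  · right
    obtain ⟨b, hb, h⟩ := hN.exists_basis_of_isNilpotent_two hnil hE
    refine ⟨b, hb, fun i => ?_⟩
    obtain ⟨c, h0, h1⟩ := h i
    exact ⟨μ i, c, by rw [apply_eq_of_sub_algebraMap_apply_eq h0, add_zero],
      by rw [apply_eq_of_sub_algebraMap_apply_eq h1, add_comm]⟩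
  · left
    have h1 := Submodule.finrank_add_eq_of_isCompl hpq
    have h2 := Submodule.one_le_finrank_iff.2 hp
    have h3 := Submodule.one_le_finrank_iff.2 hq
    obtain ⟨b, hb, hfb⟩ := exists_eigenvector_of_finrank_one (by omega : finrank ℂ p = 1)
      fun i => (f i).restrict (hfp i)
    obtain ⟨c, hc, hfc⟩ := exists_eigenvector_of_finrank_one (by omega : finrank ℂ q = 1)
      fun i => (f i).restrict (hfq i)
    refine ⟨_, linearIndependent_append hpq hb hc, fun i => ?_⟩
    obtain ⟨s, hs⟩ := hfb i
    obtain ⟨t, ht⟩ := hfc i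
    exact ⟨s, t, congrArg Subtype.val hs, congrArg Subtype.val ht⟩

/-- Polarization: if all members of the family square to zero, all products vanish. -/
theorem IsCommutingFamily.apply_apply_eq_zero (hf : IsCommutingFamily f)
    (h : ∀ i v, f i (f i v) = 0) (i j : ι) (v : E) : f i (f j v) = 0 := by
  obtain ⟨k, hk⟩ := hf.add i j
  have h1 := h k v
  have h2 : f j (f i v) = f i (f j v) := LinearMap.congr_fun (hf.comm j i).eq v
  simp only [hk, LinearMap.add_apply, map_add, h, h2, zero_add, add_zero] at h1
  have h3 : (2 : ℂ) • f i (f j v) = 0 := by rw [two_smul]; exact h1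
  exact (smul_eq_zero.1 h3).resolve_left two_ne_zero

theorem eq_zero_or_apply_eq_zero {y : End ℂ E} {u w : E} {c : ℂ}
    (h : y u = c • u + w) (hw : y w = 0) (hy : y (y u) = 0) : c = 0 ∨ y u = 0 := by
  rw [h, map_add, hw, add_zero, map_smul] at hy
  exact smul_eq_zero.1 hy

/-- The shapes of commuting families of nilpotent endomorphisms in dimension three: polynomials in
a regular nilpotent matrix, or matrices with image in a fixed line that they kill, or matrices that
kill a fixed plane containing their image. -/
theorem IsCommutingFamily.exists_basis_of_isNilpotent_three (hf : IsCommutingFamily f)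
    (hnil : ∀ i, IsNilpotent (f i)) (hE : finrank ℂ E = 3) :
    (∃ b : Fin 3 → E, LinearIndependent ℂ b ∧ ∀ i, ∃ q r : ℂ,
      f i (b 0) = 0 ∧ f i (b 1) = q • b 0 ∧ f i (b 2) = r • b 0 + q • b 1) ∨
    (∃ b : Fin 3 → E, LinearIndependent ℂ b ∧ ∀ i, ∃ q r : ℂ,
      f i (b 0) = 0 ∧ f i (b 1) = q • b 0 ∧ f i (b 2) = r • b 0) ∨
    ∃ b : Fin 3 → E, LinearIndependent ℂ b ∧ ∀ i, ∃ q r : ℂ,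
      f i (b 0) = 0 ∧ f i (b 1) = 0 ∧ f i (b 2) = q • b 0 + r • b 1 := by
  have : FiniteDimensional ℂ E := FiniteDimensional.of_finrank_pos (by omega)
  have hpow : ∀ i v, f i (f i (f i v)) = 0 := fun i v => by
    have := LinearMap.congr_fun (pow_eq_zero_of_isNilpotent hE (hnil i)) v
    simpa [pow_succ] using this
  by_cases hsq : ∀ i v, f i (f i v) = 0
  · right
    have hprod := hf.apply_apply_eq_zero hsq
    by_cases h0 : ∀ i v, f i v = 0
    · left
      let b := Module.finBasisOfFinrankEq ℂ E hE
      exact ⟨b, b.linearIndependent, fun i => ⟨0, 0, by simp [h0]⟩⟩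
    push Not at h0
    obtain ⟨i, v, hv⟩ := h0
    have hli1 : LinearIndependent ℂ ![f i v] :=
      LinearIndependent.of_subsingleton (ι := Fin 1) 0 (by simpa using hv)
    by_cases h1 : ∀ j u, ∃ c : ℂ, f j u = c • f i v
    · left
      obtain ⟨b, hb, hbv⟩ := exists_extension hli1 hE (by omega)
      have hb0 : b 0 = f i v := hbv 0
      refine ⟨b, hb, fun j => ?_⟩
      obtain ⟨q, hq⟩ := h1 j (b 1)
      obtain ⟨r, hr⟩ := h1 j (b 2)
      exact ⟨q, r, by rw [hb0, hprod], by rw [hb0, hq], by rw [hb0, hr]⟩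
    · right
      push Not at h1
      obtain ⟨j, u, hju⟩ := h1
      have hli2 : LinearIndependent ℂ ![f i v, f j u] :=
        (LinearIndependent.pair_iff' hv).2 fun c hc => hju c hc.symm
      obtain ⟨b, hb, hbv⟩ := exists_extension hli2 hE (by omega)
      have hb0 : b 0 = f i v := hbv 0
      have hb1 : b 1 = f j u := hbv 1
      refine ⟨b, hb, fun k => ?_⟩
      obtain ⟨c, hc⟩ := exists_coeff hb hE (f k (b 2))
      rw [Fin.sum_univ_three] at hc
      have h0 : f k (b 0) = 0 := by rw [hb0, hprod]
      have h1 : f k (b 1) = 0 := by rw [hb1, hprod]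
      rcases eq_zero_or_apply_eq_zero (u := b 2) (c := c 2)
        (w := c 0 • b 0 + c 1 • b 1) (by rw [← hc, add_comm])
        (by rw [map_add, map_smul, map_smul, h0, h1]; simp) (hsq k _) with h2 | h2
      · exact ⟨c 0, c 1, h0, h1, by rw [← hc, h2, zero_smul, add_zero]⟩
      · exact ⟨0, 0, h0, h1, by rw [h2]; simp⟩
  · left
    push Not at hsq
    obtain ⟨i, v, hv⟩ := hsq
    have hx3 : f i ^ 3 = 0 := pow_eq_zero_of_isNilpotent hE (hnil i)
    have hv' : (f i ^ 2) v ≠ 0 := by simpa [pow_succ] using hv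
    have hli := linearIndependent_pow_apply (x := f i) (v := v) (n := 2) hx3 hv'
    refine ⟨![f i (f i v), f i v, v], ?_, fun j => ?_⟩
    · have h1 := hli.comp ![2, 1, 0] (by decide)
      have h2 : ![f i (f i v), f i v, v] = (fun k : Fin 3 => (f i ^ (k : ℕ)) v) ∘ ![2, 1, 0] := by
        funext k
        fin_cases k <;> simp [pow_succ]
      rw [h2]
      exact h1
    · obtain ⟨c, hc0, hc⟩ := exists_apply_eq_sum_pow (n := 2) hE (hnil i) (hnil j)
        (hf.comm i j) (v := v) hv'
      have hji : ∀ u, f j (f i u) = f i (f j u) := fun u =>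
        (LinearMap.congr_fun (hf.comm i j).eq u).symm
      have hc' : f j v = c 1 • f i v + c 2 • f i (f i v) := by
        rw [hc, Fin.sum_univ_three, hc0]
        simp [pow_succ]
      refine ⟨c 1, c 2, ?_, ?_, ?_⟩
      · simp [hji, hc', hpow]
      · simp [hji, hc', hpow]
      · simpa [add_comm] using hc'

end CommutingFamilies

/-! ### Commuting families in dimension four -/

section NormalForms

open Module OrbitType

variable {E : Type*} [AddCommGroup E] [Module ℂ E] {ι : Type*} {f : ι → End ℂ E}

/-- In some basis all members of the family are matrices of the shape `normalForm o`. -/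
def HasNormalForm (f : ι → End ℂ E) (o : OrbitType) : Prop :=
  ∃ v : Fin 4 → E, LinearIndependent ℂ v ∧ ∀ i, ∃ a b c d : ℂ,
    ∀ j, f i (v j) = ∑ k, normalForm o a b c d k j • v k

theorem hasNormalForm_of_columns {o : OrbitType} {v : Fin 4 → E} (hv : LinearIndependent ℂ v)
    (h : ∀ i, ∃ a b c d : ℂ, f i (v 0) = ∑ k, normalForm o a b c d k 0 • v k ∧
      f i (v 1) = ∑ k, normalForm o a b c d k 1 • v k ∧
      f i (v 2) = ∑ k, normalForm o a b c d k 2 • v k ∧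
      f i (v 3) = ∑ k, normalForm o a b c d k 3 • v k) : HasNormalForm f o := by
  refine ⟨v, hv, fun i => ?_⟩
  obtain ⟨a, b, c, d, h0, h1, h2, h3⟩ := h i
  refine ⟨a, b, c, d, fun j => ?_⟩
  fin_cases j
  exacts [h0, h1, h2, h3]

theorem IsCommutingFamily.exists_basis_of_finrank_three (hf : IsCommutingFamily f)
    (hE : finrank ℂ E = 3) :
    (∃ b : Fin 3 → E, LinearIndependent ℂ b ∧ ∀ i, ∃ p q r : ℂ,
      f i (b 0) = p • b 0 ∧ f i (b 1) = q • b 1 ∧ f i (b 2) = r • b 2) ∨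
    (∃ b : Fin 3 → E, LinearIndependent ℂ b ∧ ∀ i, ∃ p q r : ℂ,
      f i (b 0) = p • b 0 ∧ f i (b 1) = q • b 0 + p • b 1 ∧ f i (b 2) = r • b 2) ∨
    (∃ b : Fin 3 → E, LinearIndependent ℂ b ∧ ∀ i, ∃ p q r : ℂ,
      f i (b 0) = p • b 0 ∧ f i (b 1) = q • b 0 + p • b 1 ∧
        f i (b 2) = r • b 0 + q • b 1 + p • b 2) ∨
    (∃ b : Fin 3 → E, LinearIndependent ℂ b ∧ ∀ i, ∃ p q r : ℂ,
      f i (b 0) = p • b 0 ∧ f i (b 1) = q • b 0 + p • b 1 ∧ f i (b 2) = r • b 0 + p • b 2) ∨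
    ∃ b : Fin 3 → E, LinearIndependent ℂ b ∧ ∀ i, ∃ p q r : ℂ,
      f i (b 0) = p • b 0 ∧ f i (b 1) = p • b 1 ∧ f i (b 2) = q • b 0 + r • b 1 + p • b 2 := by
  have : FiniteDimensional ℂ E := FiniteDimensional.of_finrank_pos (by omega)
  have : Nontrivial E := Module.nontrivial_of_finrank_pos (R := ℂ) (by omega)
  rcases hf.exists_isNilpotent_or_isCompl with ⟨μ, hnil, hN⟩ | ⟨p, q, hpq, hp, hq, hfp, hfq⟩
  · right
    right
    rcases hN.exists_basis_of_isNilpotent_three hnil hE with ⟨b, hb, h⟩ | ⟨b, hb, h⟩ | ⟨b, hb, h⟩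
    · refine .inl ⟨b, hb, fun i => ?_⟩
      obtain ⟨q, r, h0, h1, h2⟩ := h i
      refine ⟨μ i, q, r, ?_, ?_, ?_⟩
      · rw [apply_eq_of_sub_algebraMap_apply_eq h0, add_zero]
      · rw [apply_eq_of_sub_algebraMap_apply_eq h1, add_comm]
      · rw [apply_eq_of_sub_algebraMap_apply_eq h2, add_comm]
    · refine .inr (.inl ⟨b, hb, fun i => ?_⟩)
      obtain ⟨q, r, h0, h1, h2⟩ := h i
      refine ⟨μ i, q, r, ?_, ?_, ?_⟩
      · rw [apply_eq_of_sub_algebraMap_apply_eq h0, add_zero]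
      · rw [apply_eq_of_sub_algebraMap_apply_eq h1, add_comm]
      · rw [apply_eq_of_sub_algebraMap_apply_eq h2, add_comm]
    · refine .inr (.inr ⟨b, hb, fun i => ?_⟩)
      obtain ⟨q, r, h0, h1, h2⟩ := h i
      refine ⟨μ i, q, r, ?_, ?_, ?_⟩
      · rw [apply_eq_of_sub_algebraMap_apply_eq h0, add_zero]
      · rw [apply_eq_of_sub_algebraMap_apply_eq h1, add_zero]
      · rw [apply_eq_of_sub_algebraMap_apply_eq h2, add_comm]
  · have key : ∀ p q : Submodule ℂ E, IsCompl p q → finrank ℂ p = 2 → finrank ℂ q = 1 →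
        (∀ i, ∀ v ∈ p, f i v ∈ p) → (∀ i, ∀ v ∈ q, f i v ∈ q) →
        (∃ b : Fin 3 → E, LinearIndependent ℂ b ∧ ∀ i, ∃ p q r : ℂ,
          f i (b 0) = p • b 0 ∧ f i (b 1) = q • b 1 ∧ f i (b 2) = r • b 2) ∨
        ∃ b : Fin 3 → E, LinearIndependent ℂ b ∧ ∀ i, ∃ p q r : ℂ,
          f i (b 0) = p • b 0 ∧ f i (b 1) = q • b 0 + p • b 1 ∧ f i (b 2) = r • b 2 := by
      intro p q hpq hp hq hfp hfq
      obtain ⟨c, hc, hfc⟩ := exists_eigenvector_of_finrank_one hq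
        fun i => (f i).restrict (hfq i)
      rcases (hf.restrict hfp).exists_basis_of_finrank_two hp with ⟨b, hb, hfb⟩ | ⟨b, hb, hfb⟩
      · refine .inl ⟨_, linearIndependent_append hpq hb hc, fun i => ?_⟩
        obtain ⟨s, t, hs, ht⟩ := hfb i
        obtain ⟨u, hu⟩ := hfc i
        exact ⟨s, t, u, congrArg Subtype.val hs, congrArg Subtype.val ht, congrArg Subtype.val hu⟩
      · refine .inr ⟨_, linearIndependent_append hpq hb hc, fun i => ?_⟩
        obtain ⟨s, t, hs, ht⟩ := hfb i
        obtain ⟨u, hu⟩ := hfc i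
        exact ⟨s, t, u, congrArg Subtype.val hs, congrArg Subtype.val ht, congrArg Subtype.val hu⟩
    have h1 := Submodule.finrank_add_eq_of_isCompl hpq
    have h2 := Submodule.one_le_finrank_iff.2 hp
    have h3 := Submodule.one_le_finrank_iff.2 hq
    have h4 : finrank ℂ p = 2 ∧ finrank ℂ q = 1 ∨ finrank ℂ q = 2 ∧ finrank ℂ p = 1 := by omega
    rcases h4 with ⟨h4, h5⟩ | ⟨h4, h5⟩
    · rcases key p q hpq h4 h5 hfp hfq with h | h
      exacts [.inl h, .inr (.inl h)]
    · rcases key q p hpq.symm h4 h5 hfq hfp with h | h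
      exacts [.inl h, .inr (.inl h)]

theorem IsCommutingFamily.exists_normalForm_of_two_two (hf : IsCommutingFamily f)
    {p q : Submodule ℂ E} (hpq : IsCompl p q) (hp : finrank ℂ p = 2) (hq : finrank ℂ q = 2)
    (hfp : ∀ i, ∀ v ∈ p, f i v ∈ p) (hfq : ∀ i, ∀ v ∈ q, f i v ∈ q) :
    ∃ o, HasNormalForm f o := by
  rcases (hf.restrict hfp).exists_basis_of_finrank_two hp with ⟨b, hb, hfb⟩ | ⟨b, hb, hfb⟩ <;>
  rcases (hf.restrict hfq).exists_basis_of_finrank_two hq with ⟨c, hc, hfc⟩ | ⟨c, hc, hfc⟩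
  case inl.inl =>
    refine ⟨O12, hasNormalForm_of_columns (linearIndependent_append hpq hb hc) fun i => ?_⟩
    obtain ⟨s, t, hs, ht⟩ := hfb i
    obtain ⟨s', t', hs', ht'⟩ := hfc i
    refine ⟨s, t, s', t', ?_⟩
    simp only [normalForm, Fin.sum_univ_four]
    simpa using ⟨congrArg Subtype.val hs, congrArg Subtype.val ht, congrArg Subtype.val hs',
      congrArg Subtype.val ht'⟩
  case inl.inr =>
    refine ⟨O11, hasNormalForm_of_columns (linearIndependent_append hpq.symm hc hb) fun i => ?_⟩
    obtain ⟨s, t, hs, ht⟩ := hfc i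
    obtain ⟨s', t', hs', ht'⟩ := hfb i
    refine ⟨s, t, s', t', ?_⟩
    simp only [normalForm, Fin.sum_univ_four]
    simpa using ⟨congrArg Subtype.val hs, congrArg Subtype.val ht, congrArg Subtype.val hs',
      congrArg Subtype.val ht'⟩
  case inr.inl =>
    refine ⟨O11, hasNormalForm_of_columns (linearIndependent_append hpq hb hc) fun i => ?_⟩
    obtain ⟨s, t, hs, ht⟩ := hfb i
    obtain ⟨s', t', hs', ht'⟩ := hfc i
    refine ⟨s, t, s', t', ?_⟩
    simp only [normalForm, Fin.sum_univ_four]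
    simpa using ⟨congrArg Subtype.val hs, congrArg Subtype.val ht, congrArg Subtype.val hs',
      congrArg Subtype.val ht'⟩
  case inr.inr =>
    refine ⟨O10', hasNormalForm_of_columns (linearIndependent_append hpq hb hc) fun i => ?_⟩
    obtain ⟨s, t, hs, ht⟩ := hfb i
    obtain ⟨s', t', hs', ht'⟩ := hfc i
    refine ⟨s, t, s', t', ?_⟩
    simp only [normalForm, Fin.sum_univ_four]
    simpa using ⟨congrArg Subtype.val hs, congrArg Subtype.val ht, congrArg Subtype.val hs',
      congrArg Subtype.val ht'⟩

theorem IsCommutingFamily.exists_normalForm_of_three_one (hf : IsCommutingFamily f)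
    {p q : Submodule ℂ E} (hpq : IsCompl p q) (hp : finrank ℂ p = 3) (hq : finrank ℂ q = 1)
    (hfp : ∀ i, ∀ v ∈ p, f i v ∈ p) (hfq : ∀ i, ∀ v ∈ q, f i v ∈ q) :
    ∃ o, HasNormalForm f o := by
  obtain ⟨c, hc, hfc⟩ := exists_eigenvector_of_finrank_one hq fun i => (f i).restrict (hfq i)
  rcases (hf.restrict hfp).exists_basis_of_finrank_three hp with
    ⟨b, hb, hfb⟩ | ⟨b, hb, hfb⟩ | ⟨b, hb, hfb⟩ | ⟨b, hb, hfb⟩ | ⟨b, hb, hfb⟩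
  · refine ⟨O12, hasNormalForm_of_columns (linearIndependent_append hpq hb hc) fun i => ?_⟩
    obtain ⟨s, t, u, hs, ht, hu⟩ := hfb i
    obtain ⟨d, hd⟩ := hfc i
    refine ⟨s, t, u, d, ?_⟩
    simp only [normalForm, Fin.sum_univ_four]
    simpa using ⟨congrArg Subtype.val hs, congrArg Subtype.val ht, congrArg Subtype.val hu,
      congrArg Subtype.val hd⟩
  · refine ⟨O11, hasNormalForm_of_columns (linearIndependent_append hpq hb hc) fun i => ?_⟩
    obtain ⟨s, t, u, hs, ht, hu⟩ := hfb i
    obtain ⟨d, hd⟩ := hfc i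
    refine ⟨s, t, u, d, ?_⟩
    simp only [normalForm, Fin.sum_univ_four]
    simpa using ⟨congrArg Subtype.val hs, congrArg Subtype.val ht, congrArg Subtype.val hu,
      congrArg Subtype.val hd⟩
  · refine ⟨O10'', hasNormalForm_of_columns (linearIndependent_append hpq hb hc) fun i => ?_⟩
    obtain ⟨s, t, u, hs, ht, hu⟩ := hfb i
    obtain ⟨d, hd⟩ := hfc i
    refine ⟨s, t, u, d, ?_⟩
    simp only [normalForm, Fin.sum_univ_four]
    simpa using ⟨congrArg Subtype.val hs, congrArg Subtype.val ht, congrArg Subtype.val hu,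
      congrArg Subtype.val hd⟩
  · refine ⟨O8', hasNormalForm_of_columns (linearIndependent_append hpq hb hc) fun i => ?_⟩
    obtain ⟨s, t, u, hs, ht, hu⟩ := hfb i
    obtain ⟨d, hd⟩ := hfc i
    refine ⟨u, t, s, d, ?_⟩
    simp only [normalForm, Fin.sum_univ_four]
    simpa using ⟨congrArg Subtype.val hs, congrArg Subtype.val ht, congrArg Subtype.val hu,
      congrArg Subtype.val hd⟩
  · refine ⟨O8'', hasNormalForm_of_columns (linearIndependent_append hpq hb hc) fun i => ?_⟩
    obtain ⟨s, t, u, hs, ht, hu⟩ := hfb i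
    obtain ⟨d, hd⟩ := hfc i
    refine ⟨t, u, s, d, ?_⟩
    simp only [normalForm, Fin.sum_univ_four]
    simpa using ⟨congrArg Subtype.val hs, congrArg Subtype.val ht, congrArg Subtype.val hu,
      congrArg Subtype.val hd⟩

/-- Commuting nilpotent endomorphisms one of which has a single Jordan block. -/
theorem IsCommutingFamily.hasNormalForm_O9 [FiniteDimensional ℂ E] (hf : IsCommutingFamily f)
    (hnil : ∀ i, IsNilpotent (f i)) (hE : finrank ℂ E = 4) {i : ι} {v : E}
    (hv : (f i ^ 3) v ≠ 0) : HasNormalForm f O9 := by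
  have hx4 : f i ^ 4 = 0 := pow_eq_zero_of_isNilpotent hE (hnil i)
  have hx : f i (f i (f i (f i v))) = 0 := by
    simpa [pow_succ] using LinearMap.congr_fun hx4 v
  have hli := (linearIndependent_pow_apply (x := f i) (v := v) (n := 3) hx4 hv).comp ![3, 2, 1, 0]
    (by decide)
  have h2 : ![f i (f i (f i v)), f i (f i v), f i v, v] =
      (fun k : Fin 4 => (f i ^ (k : ℕ)) v) ∘ ![3, 2, 1, 0] := by
    funext k
    fin_cases k <;> simp [pow_succ]
  rw [← h2] at hli
  refine hasNormalForm_of_columns hli fun j => ?_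
  obtain ⟨c, hc0, hc⟩ := exists_apply_eq_sum_pow (n := 3) hE (hnil i) (hnil j)
    (hf.comm i j) hv
  have hji : ∀ u, f j (f i u) = f i (f j u) := fun u =>
    (LinearMap.congr_fun (hf.comm i j).eq u).symm
  have hc' : f j v = c 3 • f i (f i (f i v)) + c 2 • f i (f i v) + c 1 • f i v := by
    rw [hc, Fin.sum_univ_four, hc0]
    simp [pow_succ]
    abel
  refine ⟨c 1, c 2, c 3, 0, ?_⟩
  simp only [normalForm, Fin.sum_univ_four]
  simp [hji, hc', hx]

theorem coeff_eq_zero_of_linearIndependent {b : Fin 4 → E} (hb : LinearIndependent ℂ b)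
    {a₀ a₁ a₂ a₃ : ℂ} (h : a₀ • b 0 + a₁ • b 1 + a₂ • b 2 + a₃ • b 3 = 0) :
    a₀ = 0 ∧ a₁ = 0 ∧ a₂ = 0 ∧ a₃ = 0 := by
  have h1 := Fintype.linearIndependent_iff.1 hb ![a₀, a₁, a₂, a₃] (by simpa [Fin.sum_univ_four])
  exact ⟨h1 0, h1 1, h1 2, h1 3⟩

/-- A chain `x ^ 2 v, x v, v` of maximal length in dimension four can be completed to a basis by a
vector that `x` kills. -/
theorem exists_basis_of_sq_ne_zero [FiniteDimensional ℂ E] (hE : finrank ℂ E = 4) {x : End ℂ E}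
    (hcube : ∀ v, x (x (x v)) = 0) {v : E} (hv : x (x v) ≠ 0) :
    ∃ w, x w = 0 ∧ LinearIndependent ℂ ![x (x v), x v, v, w] := by
  have hx3 : x ^ 3 = 0 := LinearMap.ext fun u => by simpa [pow_succ] using hcube u
  have hli := (linearIndependent_pow_apply (x := x) (v := v) (n := 2) hx3
    (by simpa [pow_succ] using hv)).comp ![2, 1, 0] (by decide)
  have h2 : ![x (x v), x v, v] = (fun k : Fin 3 => (x ^ (k : ℕ)) v) ∘ ![2, 1, 0] := by
    funext k
    fin_cases k <;> simp [pow_succ]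
  rw [← h2] at hli
  obtain ⟨b, hb, hbv⟩ := exists_extension hli hE (by omega)
  have hb0 : b 0 = x (x v) := hbv 0
  have hb1 : b 1 = x v := hbv 1
  have hb2 : b 2 = v := hbv 2
  obtain ⟨c, hc⟩ := exists_coeff hb hE (x (b 3))
  rw [Fin.sum_univ_four, hb0, hb1, hb2] at hc
  have h4 : x (x (b 3)) = c 1 • x (x v) + c 2 • x v + c 3 • x (b 3) := by
    conv_lhs => rw [← hc]
    simp only [map_add, map_smul, hcube]
    simp
  have h5 : c 2 • x (x v) + c 3 • x (x (b 3)) = 0 := by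
    have h6 := congrArg x h4
    simp only [map_add, map_smul, hcube] at h6
    simpa using h6.symm
  have hc3 : c 3 = 0 := by
    rw [h4, ← hc] at h5
    have h6 := (coeff_eq_zero_of_linearIndependent hb
      (a₀ := c 2 + c 3 * c 1 + c 3 ^ 2 * c 0) (a₁ := c 3 * c 2 + c 3 ^ 2 * c 1)
      (a₂ := c 3 ^ 2 * c 2) (a₃ := c 3 ^ 3) (by
        rw [hb0, hb1, hb2, ← h5]
        module)).2.2.2
    exact eq_zero_of_pow_eq_zero h6
  rw [hc3, zero_smul, add_zero] at h5
  have hc2 : c 2 = 0 := (smul_eq_zero.1 h5).resolve_right hv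
  rw [hc2, hc3, zero_smul, zero_smul, add_zero, add_zero] at hc
  refine ⟨b 3 - c 0 • x v - c 1 • v, ?_, ?_⟩
  · rw [map_sub, map_sub, map_smul, map_smul, ← hc]
    abel
  · have h6 := linearIndependent_combination hb
      !![1, 0, 0, 0; 0, 1, 0, -c 0; 0, 0, 1, -c 1; 0, 0, 0, 1]
      (by simp [Matrix.det_succ_row_zero, Fin.sum_univ_succ])
    convert h6 using 1
    funext k
    fin_cases k <;> simp [Fin.sum_univ_four, hb0, hb1, hb2]
    abel

/-- Commuting nilpotent endomorphisms with cubes zero, one of which has nonzero square.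

Let `x ^ 2 v ≠ 0` and complete `x ^ 2 v, x v, v` by a vector `w` with `x w = 0` to a basis. Each
member `y` of the family is determined by `y v = p x v + q x ^ 2 v + β w` and `y w = α x ^ 2 v`, and
commutativity means that the vectors `(α, β)` are proportional. The three types correspond to
`β = 0`, to `α = 0` and to `α β ≠ 0`. -/
theorem IsCommutingFamily.exists_normalForm_of_sq_ne_zero [FiniteDimensional ℂ E]
    (hf : IsCommutingFamily f) (hnil : ∀ i, IsNilpotent (f i)) (hE : finrank ℂ E = 4)
    (hcube : ∀ i v, f i (f i (f i v)) = 0) {i : ι} {v : E} (hv : f i (f i v) ≠ 0) :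
    ∃ o, HasNormalForm f o := by
  obtain ⟨w, hxw, hb⟩ := exists_basis_of_sq_ne_zero hE (hcube i) hv
  have hcomm : ∀ j u, f j (f i u) = f i (f j u) := fun j u =>
    (LinearMap.congr_fun (hf.comm i j).eq u).symm
  have hxv : ∀ j, ∃ p q β : ℂ, f j v = q • f i (f i v) + p • f i v + β • w := fun j => by
    obtain ⟨c, hc⟩ := exists_coeff hb hE (f j v)
    simp only [Fin.sum_univ_four] at hc
    change c 0 • f i (f i v) + c 1 • f i v + c 2 • v + c 3 • w = f j v at hc
    have h1 : c 2 = 0 := by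
      refine eq_zero_of_isNilpotent_of_apply_eq_smul (hnil j) hv ?_
      rw [hcomm, hcomm, ← hc]
      simp [hcube, hxw]
    exact ⟨c 1, c 0, c 3, by rw [← hc, h1, zero_smul, add_zero]⟩
  have hw : ∀ j, ∃ α : ℂ, f j w = α • f i (f i v) := fun j => by
    obtain ⟨c, hc⟩ := exists_coeff hb hE (f j w)
    simp only [Fin.sum_univ_four] at hc
    change c 0 • f i (f i v) + c 1 • f i v + c 2 • v + c 3 • w = f j w at hc
    have h1 : f i (f j w) = 0 := by rw [← hcomm, hxw, map_zero]
    have h2 : c 1 • f i (f i v) + c 2 • f i v = 0 := by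
      rw [← h1, ← hc]
      simp [hcube, hxw]
    have h3 := coeff_eq_zero_of_linearIndependent hb (a₀ := c 1) (a₁ := c 2) (a₂ := 0) (a₃ := 0)
      (by simpa using h2)
    rw [h3.1, h3.2.1, zero_smul, zero_smul, add_zero, add_zero] at hc
    have h4 : f j (f i (f i v)) = 0 := by
      obtain ⟨p, q, β, h⟩ := hxv j
      rw [hcomm, hcomm, h]
      simp [hcube, hxw]
    have hc3 : c 3 = 0 := by
      by_contra hne
      have h5 : f j (f j w) = c 3 • f j w := by
        conv_lhs => rw [← hc]
        rw [map_add, map_smul, map_smul, h4, smul_zero, zero_add]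
      by_cases h6 : f j w = 0
      · rw [h6] at hc
        have h7 := coeff_eq_zero_of_linearIndependent hb (a₀ := c 0) (a₁ := 0) (a₂ := 0)
          (a₃ := c 3) (by simpa using hc)
        exact hne h7.2.2.2
      · exact hne (eq_zero_of_isNilpotent_of_apply_eq_smul (hnil j) h6 h5)
    exact ⟨c 0, by rw [← hc, hc3, zero_smul, add_zero]⟩
  choose p q β hxv using hxv
  choose α hw using hw
  have hxx : ∀ j, f j (f i (f i v)) = 0 := fun j => by
    rw [hcomm, hcomm, hxv]
    simp [hcube, hxw]
  have hx1 : ∀ j, f j (f i v) = p j • f i (f i v) := fun j => by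
    rw [hcomm, hxv]
    simp [hcube, hxw]
  generalize f i (f i v) = e₁ at hv hb hxv hw hxx hx1
  generalize f i v = e₂ at hb hxv hx1
  have hprop : ∀ j k, β j * α k = β k * α j := fun j k => by
    have h1 : f k (f j v) = f j (f k v) := LinearMap.congr_fun (hf.comm k j).eq v
    rw [hxv j, hxv k] at h1
    simp only [map_add, map_smul, hxx, hx1, hw, smul_zero, zero_add] at h1
    have h2 : (β j * α k - β k * α j) • e₁ = 0 := by
      have h3 := sub_eq_zero.2 h1
      rw [← h3]
      module
    exact sub_eq_zero.1 ((smul_eq_zero.1 h2).resolve_right hv)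
  by_cases hβ : ∀ j, β j = 0
  · -- basis `x ^ 2 v, x v, w, v`
    have hb' := hb.comp ![0, 1, 3, 2] (by decide)
    refine ⟨O7', hasNormalForm_of_columns hb' fun j => ⟨p j, α j, q j, 0, ?_⟩⟩
    simp [normalForm, Fin.sum_univ_four, hxx, hx1, hw, hxv, hβ]
  · push Not at hβ
    obtain ⟨j, hj⟩ := hβ
    by_cases hα : α j = 0
    · have hα' : ∀ k, α k = 0 := fun k => by
        have := hprop j k
        rw [hα, mul_zero] at this
        exact (mul_eq_zero.1 this).resolve_left hj
      -- basis `x ^ 2 v, w, x v, v`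
      have hb' := hb.comp ![0, 3, 1, 2] (by decide)
      refine ⟨O7'', hasNormalForm_of_columns hb' fun j => ⟨p j, β j, q j, 0, ?_⟩⟩
      simp [normalForm, Fin.sum_univ_four, hxx, hx1, hw, hxv, hα']
      abel
    · -- basis `x ^ 2 v, x v, m w, v` with `m` such that `β / m = m * α`
      obtain ⟨m, hm⟩ := IsAlgClosed.exists_pow_nat_eq (β j / α j) two_pos
      have hm0 : m ≠ 0 := by
        rintro rfl
        exact div_ne_zero hj hα (by simpa using hm.symm)
      have hmα : ∀ k, β k = m ^ 2 * α k := fun k => by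
        rw [hm, div_mul_eq_mul_div, eq_div_iff hα, hprop]
      have hb' := linearIndependent_combination hb
        !![1, 0, 0, 0; 0, 1, 0, 0; 0, 0, 0, 1; 0, 0, m, 0]
        (by simpa [Matrix.det_succ_row_zero, Fin.sum_univ_succ, Fin.succAbove] using hm0)
      refine ⟨O8, hasNormalForm_of_columns hb' fun j => ⟨p j, m * α j, q j, 0, ?_⟩⟩
      simp [normalForm, Fin.sum_univ_four, hxx, hx1, hw, hxv, hmα]
      exact ⟨by module, by module⟩

theorem exists_det_eq_one {p q : ℂ} (h : p ≠ 0 ∨ q ≠ 0) : ∃ p' q', p * q' - q * p' = 1 := by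
  rcases h with h | h
  · exact ⟨0, p⁻¹, by simp [h]⟩
  · exact ⟨-q⁻¹, 0, by simp [h]⟩

theorem exists_eq_smul_of_det_eq_zero {a b c d : ℂ} (h : a * d - b * c = 0)
    (h0 : ¬(a = 0 ∧ b = 0 ∧ c = 0 ∧ d = 0)) :
    ∃ s t p q : ℂ, (s ≠ 0 ∨ t ≠ 0) ∧ (p ≠ 0 ∨ q ≠ 0) ∧
      a = s * p ∧ b = s * q ∧ c = t * p ∧ d = t * q := by
  by_cases ha : a = 0 ∧ b = 0
  · refine ⟨0, 1, c, d, by simp, ?_, by simp [ha.1], by simp [ha.2], by simp, by simp⟩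
    by_contra hcd
    push Not at hcd
    exact h0 ⟨ha.1, ha.2, hcd⟩
  · by_cases ha0 : a = 0
    · have hb0 : b ≠ 0 := fun hb => ha ⟨ha0, hb⟩
      refine ⟨1, d / b, a, b, by simp, .inr hb0, by simp, by simp, ?_, by field_simp⟩
      rw [ha0] at h ⊢
      have : b * c = 0 := by linear_combination -h
      simpa [hb0] using this
    · refine ⟨1, c / a, a, b, by simp, .inl ha0, by simp, by simp, by field_simp, ?_⟩
      field_simp
      linear_combination h

/-- A three-dimensional space `W` of commuting endomorphisms with square zero whose images span a
plane `⟨b 0, b 1⟩`. Since `dim W < 4`, the `2 × 2` matrices that describe `W` satisfy a linear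
relation, a bilinear form between the plane and the quotient space. The two types are distinguished
by whether that form is nondegenerate. -/
theorem exists_normalForm_of_apply_mem_plane {W : Type*} [AddCommGroup W] [Module ℂ W]
    (hW : finrank ℂ W = 3) (f : W →ₗ[ℂ] End ℂ E) {b : Fin 4 → E} (hb : LinearIndependent ℂ b)
    (h0 : ∀ x, f x (b 0) = 0) (h1 : ∀ x, f x (b 1) = 0)
    (h : ∀ x u, ∃ c d : ℂ, f x u = c • b 0 + d • b 1) : ∃ o, HasNormalForm f o := by
  have : FiniteDimensional ℂ W := FiniteDimensional.of_finrank_pos (by omega)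
  have hpair : ∀ {c d c' d' : ℂ}, c • b 0 + d • b 1 = c' • b 0 + d' • b 1 → c = c' ∧ d = d' := by
    intro c d c' d' he
    have h2 := coeff_eq_zero_of_linearIndependent hb (a₀ := c - c') (a₁ := d - d') (a₂ := 0)
      (a₃ := 0) (by
        rw [zero_smul, zero_smul, add_zero, add_zero, ← sub_eq_zero.2 he]
        module)
    exact ⟨sub_eq_zero.1 h2.1, sub_eq_zero.1 h2.2.1⟩
  choose α β hαβ using h
  let M : W →ₗ[ℂ] Fin 4 → ℂ :=
    { toFun := fun x => ![α x (b 2), β x (b 2), α x (b 3), β x (b 3)]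
      map_add' := fun x y => by
        have h2 : ∀ u, α (x + y) u = α x u + α y u ∧ β (x + y) u = β x u + β y u := fun u =>
          hpair (by rw [← hαβ, map_add, LinearMap.add_apply, hαβ, hαβ]; module)
        simp [h2]
      map_smul' := fun k x => by
        have h2 : ∀ u, α (k • x) u = k * α x u ∧ β (k • x) u = k * β x u := fun u =>
          hpair (by rw [← hαβ, map_smul, LinearMap.smul_apply, hαβ]; module)
        simp [h2] }
  have hM : LinearMap.range M < ⊤ := by
    refine lt_top_iff_ne_top.2 fun htop => ?_
    have h2 := LinearMap.finrank_range_le M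
    rw [htop, finrank_top] at h2
    simp [hW] at h2
  obtain ⟨n, hn0, hn⟩ := Submodule.exists_le_ker_of_lt_top _ hM
  obtain ⟨m, hm⟩ : ∃ m : Fin 4 → ℂ, ∀ v, n v = v 0 * m 0 + v 1 * m 1 + v 2 * m 2 + v 3 * m 3 :=
    ⟨fun i => n fun j => if i = j then 1 else 0, fun v => by
      rw [LinearMap.pi_apply_eq_sum_univ n v, Fin.sum_univ_four]; rfl⟩
  have hrel : ∀ x, α x (b 2) * m 0 + β x (b 2) * m 1 + α x (b 3) * m 2 + β x (b 3) * m 3 = 0 :=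
    fun x => by
      have h2 : n (M x) = 0 := hn ⟨x, rfl⟩
      rw [hm] at h2
      exact h2
  have hm0 : ¬(m 0 = 0 ∧ m 2 = 0 ∧ m 1 = 0 ∧ m 3 = 0) := by
    rintro ⟨h2, h3, h4, h5⟩
    exact hn0 (LinearMap.ext fun v => by rw [hm, h2, h3, h4, h5]; simp)
  by_cases hdet : m 0 * m 3 - m 2 * m 1 = 0
  · obtain ⟨s, t, p, q, hst, hpq, e0, e2, e1, e3⟩ := exists_eq_smul_of_det_eq_zero hdet hm0
    obtain ⟨p', q', hpq'⟩ := exists_det_eq_one hpq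
    obtain ⟨r', r, hr⟩ := exists_det_eq_one hst
    -- basis `t b₀ - s b₁, r b₀ - r' b₁, p b₂ + q b₃, p' b₂ + q' b₃`
    have hb' := linearIndependent_combination hb
      !![t, r, 0, 0; -s, -r', 0, 0; 0, 0, p, p'; 0, 0, q, q']
      (by
        have : (s * r - t * r') * (p * q' - q * p') ≠ 0 := by rw [hr, hpq']; simp
        convert this using 1
        simp [Matrix.det_succ_row_zero, Fin.sum_univ_succ, Fin.succAbove]
        ring)
    refine ⟨O6, hasNormalForm_of_columns hb' fun x => ?_⟩
    have hx := hrel x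
    rw [e0, e1, e2, e3] at hx
    set A := α x (b 2) with hA
    set B := β x (b 2) with hB
    set C := α x (b 3) with hC
    set D := β x (b 3) with hD
    have h2 : f x (b 2) = A • b 0 + B • b 1 := hαβ x _
    have h3 : f x (b 3) = C • b 0 + D • b 1 := hαβ x _
    refine ⟨-r' * (p * A + q * C) - r * (p * B + q * D),
      -r' * (p' * A + q' * C) - r * (p' * B + q' * D),
      s * (p' * A + q' * C) + t * (p' * B + q' * D), 0, ?_⟩
    have hlin : s * (p * A + q * C) + t * (p * B + q * D) = 0 := by linear_combination hx
    refine ⟨?_, ?_, ?_, ?_⟩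
    · simp [normalForm, Fin.sum_univ_four, h0, h1]
    · simp [normalForm, Fin.sum_univ_four, h0, h1]
    · simp only [normalForm, Fin.sum_univ_four]
      simp [h2, h3]
      match_scalars
      · linear_combination r * hlin - (p * A + q * C) * hr
      · linear_combination -r' * hlin - (p * B + q * D) * hr
    · simp only [normalForm, Fin.sum_univ_four]
      simp [h2, h3]
      match_scalars
      · linear_combination -(p' * A + q' * C) * hr
      · linear_combination -(p' * B + q' * D) * hr
  · have hb' := linearIndependent_combination hb
      !![0, 1, 0, 0; -1, 0, 0, 0; 0, 0, m 0, m 1; 0, 0, m 2, m 3]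
      (by
        convert hdet using 1
        simp [Matrix.det_succ_row_zero, Fin.sum_univ_succ, Fin.succAbove]
        ring)
    refine ⟨O7, hasNormalForm_of_columns hb' fun x => ?_⟩
    have hx := hrel x
    set A := α x (b 2) with hA
    set B := β x (b 2) with hB
    set C := α x (b 3) with hC
    set D := β x (b 3) with hD
    have h2 : f x (b 2) = A • b 0 + B • b 1 := hαβ x _
    have h3 : f x (b 3) = C • b 0 + D • b 1 := hαβ x _
    refine ⟨-(m 0 * B + m 2 * D), m 0 * A + m 2 * C, m 1 * A + m 3 * C, 0, ?_⟩
    have hlin : m 0 * A + m 2 * C = -(m 1 * B + m 3 * D) := by linear_combination hx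
    refine ⟨?_, ?_, ?_, ?_⟩
    · simp [normalForm, Fin.sum_univ_four, h1]
    · simp [normalForm, Fin.sum_univ_four, h0]
    · simp only [normalForm, Fin.sum_univ_four]
      simp [h2, h3]
      module
    · simp only [normalForm, Fin.sum_univ_four]
      simp [h2, h3, hlin]
      module

/-- Commuting endomorphisms with square zero. All products vanish, so the vectors in the images are
killed by the whole family; the images span a subspace of dimension at most three, and the types are
distinguished by its dimension. -/
theorem IsCommutingFamily.exists_normalForm_of_sq_eq_zero [FiniteDimensional ℂ E] {W : Type*}
    [AddCommGroup W] [Module ℂ W] (hW : finrank ℂ W = 3) (f : W →ₗ[ℂ] End ℂ E)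
    (hf : IsCommutingFamily f) (hE : finrank ℂ E = 4) (hsq : ∀ x v, f x (f x v) = 0) :
    ∃ o, HasNormalForm f o := by
  have hprod := hf.apply_apply_eq_zero hsq
  by_cases h0 : ∀ i v, f i v = 0
  · let b := Module.finBasisOfFinrankEq ℂ E hE
    exact ⟨O3', hasNormalForm_of_columns b.linearIndependent fun i => ⟨0, 0, 0, 0, by
      simp [h0, normalForm, Fin.sum_univ_four]⟩⟩
  push Not at h0
  obtain ⟨i, v, hv⟩ := h0
  have hli1 : LinearIndependent ℂ ![f i v] :=
    LinearIndependent.of_subsingleton (ι := Fin 1) 0 (by simpa using hv)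
  by_cases h1 : ∀ j u, ∃ c : ℂ, f j u = c • f i v
  · obtain ⟨b, hb, hbv⟩ := exists_extension hli1 hE (by omega)
    have hb0 : b 0 = f i v := hbv 0
    refine ⟨O3', hasNormalForm_of_columns hb fun j => ?_⟩
    obtain ⟨q, hq⟩ := h1 j (b 1)
    obtain ⟨r, hr⟩ := h1 j (b 2)
    obtain ⟨s, hs⟩ := h1 j (b 3)
    have h0 : f j (b 0) = 0 := by rw [hb0, hprod]
    refine ⟨q, r, s, 0, ?_⟩
    rw [← hb0] at hq hr hs
    simp [normalForm, Fin.sum_univ_four, h0, hq, hr, hs]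
  push Not at h1
  obtain ⟨j, u, hju⟩ := h1
  have hli2 : LinearIndependent ℂ ![f i v, f j u] :=
    (LinearIndependent.pair_iff' hv).2 fun c hc => hju c hc.symm
  by_cases h2 : ∀ k w, ∃ c d : ℂ, f k w = c • f i v + d • f j u
  · obtain ⟨b, hb, hbv⟩ := exists_extension hli2 hE (by omega)
    have hb0 : b 0 = f i v := hbv 0
    have hb1 : b 1 = f j u := hbv 1
    rw [← hb0, ← hb1] at h2
    exact exists_normalForm_of_apply_mem_plane hW f hb (fun x => by rw [hb0, hprod])
      (fun x => by rw [hb1, hprod]) h2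
  · push Not at h2
    obtain ⟨k, w, hkw⟩ := h2
    have hli3 : LinearIndependent ℂ ![f i v, f j u, f k w] := by
      have h3 : f k w ∉ Submodule.span ℂ (Set.range ![f i v, f j u]) := fun hmem => by
        obtain ⟨c, hc⟩ := (Submodule.mem_span_range_iff_exists_fun ℂ).1 hmem
        exact hkw (c 0) (c 1) (by rw [← hc, Fin.sum_univ_two]; rfl)
      have h4 := hli2.finSnoc h3
      have h5 : ![f i v, f j u, f k w] = Fin.snoc ![f i v, f j u] (f k w) := by
        funext a
        fin_cases a <;> rfl
      rw [h5]
      exact h4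
    obtain ⟨b, hb, hbv⟩ := exists_extension hli3 hE (by omega)
    have hb0 : b 0 = f i v := hbv 0
    have hb1 : b 1 = f j u := hbv 1
    have hb2 : b 2 = f k w := hbv 2
    refine ⟨O3'', hasNormalForm_of_columns hb fun l => ?_⟩
    have h0 : f l (b 0) = 0 := by rw [hb0, hprod]
    have h1 : f l (b 1) = 0 := by rw [hb1, hprod]
    have h2 : f l (b 2) = 0 := by rw [hb2, hprod]
    obtain ⟨c, hc⟩ := exists_coeff hb hE (f l (b 3))
    rw [Fin.sum_univ_four] at hc
    rcases eq_zero_or_apply_eq_zero (u := b 3) (c := c 3)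
      (w := c 0 • b 0 + c 1 • b 1 + c 2 • b 2) (by rw [← hc, add_comm])
      (by simp [h0, h1, h2]) (hsq l _) with h3 | h3
    · rw [h3, zero_smul, add_zero] at hc
      refine ⟨c 2, c 1, c 0, 0, ?_⟩
      simp [normalForm, Fin.sum_univ_four, h0, h1, h2, ← hc]
    · refine ⟨0, 0, 0, 0, ?_⟩
      simp [normalForm, Fin.sum_univ_four, h0, h1, h2, h3]

/-- Every three-dimensional commuting space of traceless endomorphisms of a four-dimensional space
has one of the normal forms. -/
theorem IsCommutingFamily.exists_normalForm [FiniteDimensional ℂ E] {W : Type*}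
    [AddCommGroup W] [Module ℂ W] (hW : finrank ℂ W = 3) (f : W →ₗ[ℂ] End ℂ E)
    (hf : IsCommutingFamily f) (hE : finrank ℂ E = 4) (htr : ∀ x, LinearMap.trace ℂ E (f x) = 0) :
    ∃ o, HasNormalForm f o := by
  have : Nontrivial E := Module.nontrivial_of_finrank_pos (R := ℂ) (by omega)
  rcases hf.exists_isNilpotent_or_isCompl with ⟨μ, hμ, -⟩ | ⟨p, q, hpq, hp, hq, hfp, hfq⟩
  · have hnil : ∀ x, IsNilpotent (f x) := fun x => by
      have h1 := (LinearMap.isNilpotent_trace_of_isNilpotent (hμ x)).eq_zero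
      rw [map_sub, htr, Algebra.algebraMap_eq_smul_one, map_smul, LinearMap.trace_one, hE] at h1
      have h2 : μ x = 0 := by simpa using h1
      simpa [h2] using hμ x
    by_cases h3 : ∃ x v, (f x ^ 3) v ≠ 0
    · obtain ⟨x, v, hv⟩ := h3
      exact ⟨O9, hf.hasNormalForm_O9 hnil hE hv⟩
    push Not at h3
    by_cases h2 : ∃ x v, f x (f x v) ≠ 0
    · obtain ⟨x, v, hv⟩ := h2
      exact hf.exists_normalForm_of_sq_ne_zero hnil hE
        (fun x v => by simpa [pow_succ] using h3 x v) hv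
    push Not at h2
    exact hf.exists_normalForm_of_sq_eq_zero hW f hE h2
  · have h1 := Submodule.finrank_add_eq_of_isCompl hpq
    have h2 := Submodule.one_le_finrank_iff.2 hp
    have h3 := Submodule.one_le_finrank_iff.2 hq
    have h4 : finrank ℂ p = 3 ∧ finrank ℂ q = 1 ∨ finrank ℂ p = 2 ∧ finrank ℂ q = 2 ∨
        finrank ℂ q = 3 ∧ finrank ℂ p = 1 := by omega
    rcases h4 with ⟨h4, h5⟩ | ⟨h4, h5⟩ | ⟨h4, h5⟩
    · exact hf.exists_normalForm_of_three_one hpq h4 h5 hfp hfq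
    · exact hf.exists_normalForm_of_two_two hpq h4 h5 hfp hfq
    · exact hf.exists_normalForm_of_three_one hpq.symm h4 h5 hfq hfp

end NormalForms

theorem exists_mem_orbit_normalAlgebra {W : Grass 3 sl4} (hW : W ∈ Ab4) :
    ∃ o, W ∈ MulAction.orbit PGL(Fin 4, ℂ) (normalAlgebra o) := by
  have hcomm := mem_Ab4_iff.1 hW
  rw [pairwiseCommute_iff] at hcomm
  let f : W.1 →ₗ[ℂ] Module.End ℂ C4 :=
    { toFun := fun x => Matrix.toLin' x.1.1
      map_add' := fun x y => map_add Matrix.toLin' x.1.1 y.1.1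
      map_smul' := fun c x => map_smul Matrix.toLin' c x.1.1 }
  have hfx : ∀ x : W.1, f x = Matrix.toLin' x.1.1 := fun x => rfl
  have hf : IsCommutingFamily f :=
    ⟨fun x y => by
      have h := hcomm x.1 x.2 y.1 y.2
      change f x * f y = f y * f x
      rw [hfx, hfx, Module.End.mul_eq_comp, ← Matrix.toLin'_mul, h, Matrix.toLin'_mul]
      rfl, fun x y => ⟨x + y, map_add f x y⟩⟩
  obtain ⟨o, v, hv, h⟩ := hf.exists_normalForm W.2 f (by simp) fun x => by
    rw [hfx, Matrix.trace_toLin'_eq]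
    exact x.1.2
  refine ⟨o, mem_orbit_normalAlgebra (Matrix.of v).transpose ?_ fun x hx => ?_⟩
  · rw [Matrix.det_transpose]
    have h1 : IsUnit (Matrix.of v) := Matrix.linearIndependent_rows_iff_isUnit.1 hv
    exact ((Matrix.isUnit_iff_isUnit_det _).1 h1).ne_zero
  · obtain ⟨a, b, c, d, h1⟩ := h ⟨x, hx⟩
    refine ⟨a, b, c, d, Matrix.ext fun i j => ?_⟩
    have h2 := congrFun (h1 j) i
    rw [hfx, Matrix.toLin'_apply, Finset.sum_apply] at h2
    rw [Matrix.mul_apply, Matrix.mul_apply]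
    refine Eq.trans h2 (Finset.sum_congr rfl fun k _ => ?_)
    simp [mul_comm]

/-! ### Cartan subalgebras -/

/-- The representation of `𝔰𝔩₄` on `ℂ⁴` is faithful and irreducible, and its elements have trace
zero; hence `𝔰𝔩₄` is semisimple. -/
theorem hasTrivialRadical_sl4 : LieAlgebra.HasTrivialRadical ℂ sl4 := by
  have hlie : ∀ (x : sl4) (v : C4), ⁅x, v⁆ = Matrix.mulVec x.1 v := fun x v => rfl
  have htoEnd : ∀ x : sl4, LieModule.toEnd ℂ sl4 C4 x = Matrix.toLin' x.1 := fun x =>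
    LinearMap.ext fun v => hlie x v
  have : LieModule.IsFaithful ℂ sl4 C4 := ⟨fun x y h => by
    rw [htoEnd, htoEnd] at h
    exact Subtype.ext (Matrix.toLin'.injective h)⟩
  have : LieModule.IsIrreducible ℂ sl4 C4 := by
    refine LieModule.IsIrreducible.mk fun N hN => ?_
    rw [Ne, LieSubmodule.eq_bot_iff] at hN
    push Not at hN
    obtain ⟨v, hv, hv0⟩ := hN
    obtain ⟨k, hk⟩ := Function.ne_iff.1 hv0
    have hk : v k ≠ 0 := hk
    -- the matrix units `E i k` with `i ≠ k` produce all the `e i` with `i ≠ k` from `v`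
    have h1 : ∀ (u : C4) (k : Fin 4), u ∈ N → u k ≠ 0 → ∀ i ≠ k,
        (Pi.single i 1 : C4) ∈ N := fun u k hu huk i hik => by
      have h2 : (⁅(⟨Matrix.single i k 1, by
        change Matrix.trace (Matrix.single i k (1 : ℂ)) = 0
        rw [Matrix.trace_single_eq_of_ne _ _ _ hik]⟩ : sl4), u⁆ : C4) ∈ N := N.lie_mem hu
      rw [hlie] at h2
      have h3 : Matrix.mulVec (Matrix.single i k (1 : ℂ)) u = u k • (Pi.single i 1 : C4) := by
        ext j
        simp [Matrix.mulVec, dotProduct, Matrix.single_apply, Pi.single_apply, eq_comm, ite_and]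
      rw [h3] at h2
      have h4 := N.smul_mem (u k)⁻¹ h2
      rwa [smul_smul, inv_mul_cancel₀ huk, one_smul] at h4
    have h5 : ∀ i, (Pi.single i 1 : C4) ∈ N := fun i => by
      by_cases hik : i = k
      · obtain ⟨j, hj⟩ := exists_ne k
        exact h1 _ j (h1 v k hv hk j hj) (by simp) i (by rw [hik]; exact hj.symm)
      · exact h1 v k hv hk i hik
    refine SetLike.ext fun u => iff_of_true ?_ (LieSubmodule.mem_top u)
    rw [pi_eq_sum_univ' u]
    exact sum_mem fun i _ => N.smul_mem _ (h5 i)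
  refine LieAlgebra.hasTrivialRadical_of_isIrreducible_of_isFaithful ℂ sl4 C4 fun x => ?_
  rw [htoEnd, Matrix.trace_toLin'_eq]
  exact x.2

theorem cartanPoints_subset : CartanPoints ⊆ Ab4 := by
  rintro W ⟨H, hH, hW⟩
  have := hasTrivialRadical_sl4
  exact ⟨H, LieAlgebra.IsKilling.instIsLieAbelianOfIsCartanSubalgebra ℂ sl4 H, hW⟩

theorem red4_subset_ab4 : Red4 ⊆ Ab4 := by
  have h : Ab4 = {W | PairwiseCommute W} := Set.ext fun W => mem_Ab4_iff
  intro W hW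
  rw [h]
  exact isClosedInvariant_pairwiseCommute.closure _
    (fun W hW => mem_Ab4_iff.1 (cartanPoints_subset hW)) _ hW

theorem conjLinearMap_lie (g : GL (Fin 4) ℂ) (x y : sl4) :
    conjLinearMap g ⁅x, y⁆ = ⁅conjLinearMap g x, conjLinearMap g y⁆ := by
  apply Subtype.ext
  rw [coe_conjLinearMap, LieAlgebra.SpecialLinear.sl_bracket, LieAlgebra.SpecialLinear.sl_bracket,
    coe_conjLinearMap, coe_conjLinearMap, conj_mul_conj, conj_mul_conj, mul_sub, sub_mul]

theorem pairwiseCommute_O12 : PairwiseCommute (normalAlgebra OrbitType.O12) := by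
  rw [pairwiseCommute_iff]
  intro x hx y hy
  obtain ⟨a, b, c, d, hx⟩ := mem_normalAlgebra.1 hx
  obtain ⟨a', b', c', d', hy⟩ := mem_normalAlgebra.1 hy
  rw [hx, hy]
  ext i j
  fin_cases i <;> fin_cases j <;> simp [normalForm, Matrix.mul_apply, Fin.sum_univ_four, mul_comm]

/-- The algebra of diagonal matrices is its own normalizer: a matrix whose commutator with
`diag(1, 2, 3, -6)` is diagonal is itself diagonal. -/
theorem mem_normalAlgebra_O12_of_lie_mem {y : sl4}
    (h : ∀ x ∈ (normalAlgebra OrbitType.O12).1, ⁅y, x⁆ ∈ (normalAlgebra OrbitType.O12).1) :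
    y ∈ (normalAlgebra OrbitType.O12).1 := by
  have hdiag : ∀ a b c d, normalForm OrbitType.O12 a b c d = Matrix.diagonal ![a, b, c, d] :=
    fun a b c d => by ext i j; fin_cases i <;> fin_cases j <;> rfl
  obtain ⟨z, hz⟩ : ∃ z : sl4, z.1 = Matrix.diagonal ![1, 2, 3, -6] :=
    ⟨⟨Matrix.diagonal ![1, 2, 3, -6], by
      change Matrix.trace (Matrix.diagonal (![1, 2, 3, -6] : Fin 4 → ℂ)) = 0
      rw [Matrix.trace_diagonal, Fin.sum_univ_four]
      simp
      norm_num⟩, rfl⟩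
  obtain ⟨a, b, c, d, h1⟩ := mem_normalAlgebra.1
    (h z (mem_normalAlgebra.2 ⟨1, 2, 3, -6, by rw [hz, hdiag]⟩))
  rw [LieAlgebra.SpecialLinear.sl_bracket, hz, hdiag] at h1
  have ht : Function.Injective (![1, 2, 3, -6] : Fin 4 → ℂ) := by
    intro i j hij
    fin_cases i <;> fin_cases j <;> first | rfl | (norm_num at hij)
  have h2 : ∀ i j, i ≠ j → y.1 i j = 0 := fun i j hij => by
    have h3 := congrFun (congrFun h1 i) j
    rw [Matrix.sub_apply, Matrix.mul_diagonal, Matrix.diagonal_mul, Matrix.diagonal_apply_ne _ hij]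
      at h3
    have h4 : y.1 i j * ((![1, 2, 3, -6] : Fin 4 → ℂ) j - (![1, 2, 3, -6] : Fin 4 → ℂ) i) = 0 := by
      linear_combination h3
    exact (mul_eq_zero.1 h4).resolve_right (sub_ne_zero.2 (ht.ne hij.symm))
  refine mem_normalAlgebra.2 ⟨y.1 0 0, y.1 1 1, y.1 2 2, y.1 3 3, ?_⟩
  rw [hdiag]
  ext i j
  by_cases hij : i = j
  · subst hij
    fin_cases i <;> rfl
  · rw [h2 i j hij, Matrix.diagonal_apply_ne _ hij]

theorem orbit_O12_subset_cartanPoints :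
    MulAction.orbit PGL(Fin 4, ℂ) (normalAlgebra OrbitType.O12) ⊆ CartanPoints := by
  rintro _ ⟨g, rfl⟩
  have hcomm := isClosedInvariant_pairwiseCommute.smul g pairwiseCommute_O12
  obtain ⟨H, hH, hW⟩ := mem_Ab4_iff.2 hcomm
  refine ⟨H, ⟨inferInstance, le_antisymm (fun y hy => ?_) H.le_normalizer⟩, hW⟩
  rw [LieSubalgebra.mem_normalizer_iff] at hy
  have hmem : ∀ x, x ∈ H ↔ x ∈ (g • normalAlgebra OrbitType.O12).1 := fun x => by
    rw [← hW]; rfl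
  rw [hmem]
  induction g using pgl_induction with
  | h g =>
    have hinv : ∀ x, conjLinearMap g (conjLinearMap g⁻¹ x) = x := fun x => by
      rw [← conjLinearMap_mul, mul_inv_cancel, conjLinearMap_one]
    have hinv' : ∀ x, conjLinearMap g⁻¹ (conjLinearMap g x) = x := fun x => by
      rw [← conjLinearMap_mul, inv_mul_cancel, conjLinearMap_one]
    refine mem_mk_smul.2 ⟨conjLinearMap g⁻¹ y, mem_normalAlgebra_O12_of_lie_mem fun x hx => ?_,
      hinv y⟩
    obtain ⟨z, hz, hzy⟩ := mem_mk_smul.1 ((hmem _).1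
      (hy (conjLinearMap g x) ((hmem _).2 (mem_mk_smul.2 ⟨x, hx, rfl⟩))))
    have h1 : ⁅conjLinearMap g⁻¹ y, x⁆ = z := by
      rw [← hinv' z, hzy, conjLinearMap_lie, hinv']
    rw [h1]
    exact hz

/-! ### The orbits that make up the variety of reductions -/

theorem orbit_subset_red4 (o : OrbitType) :
    MulAction.orbit PGL(Fin 4, ℂ) (normalAlgebra o) ⊆ Red4 :=
  (orbit_subset_closure_of_reflTransGen (reflTransGen_O12 o)).trans
    (zariskiClosure_mono orbit_O12_subset_cartanPoints)

theorem ab4_eq_red4 : Ab4 = Red4 := by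
  refine Set.Subset.antisymm (fun W hW => ?_) red4_subset_ab4
  obtain ⟨o, ho⟩ := exists_mem_orbit_normalAlgebra hW
  exact orbit_subset_red4 o ho

theorem red4_eq_iUnion_orbit :
    Red4 = ⋃ o : OrbitType, MulAction.orbit PGL(Fin 4, ℂ) (normalAlgebra o) :=
  Set.Subset.antisymm
    (fun _ hW => Set.mem_iUnion.2 (exists_mem_orbit_normalAlgebra (red4_subset_ab4 hW)))
    (Set.iUnion_subset orbit_subset_red4)

theorem orbit_subset_closure_iff {o o' : OrbitType} :
    MulAction.orbit PGL(Fin 4, ℂ) (normalAlgebra o') ⊆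
      zariskiClosure (MulAction.orbit PGL(Fin 4, ℂ) (normalAlgebra o)) ↔
    Relation.ReflTransGen Arrow o o' :=
  ⟨fun h => reflTransGen_of_mem_closure_orbit (MulAction.mem_orbit_self _)
    (h (MulAction.mem_orbit_self _)), orbit_subset_closure_of_reflTransGen⟩

theorem orbit_normalAlgebra_injective :
    Function.Injective fun o => MulAction.orbit PGL(Fin 4, ℂ) (normalAlgebra o) := by
  intro o o' h
  have h1 : MulAction.orbit PGL(Fin 4, ℂ) (normalAlgebra o) =
      MulAction.orbit PGL(Fin 4, ℂ) (normalAlgebra o') := h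
  exact eq_of_reflTransGen (orbit_subset_closure_iff.1 (h1 ▸ subset_zariskiClosure _))
    (orbit_subset_closure_iff.1 (h1 ▸ subset_zariskiClosure _))

theorem setOf_orbits_eq_range :
    {O : Set (Grass 3 sl4) | ∃ W ∈ Red4, O = MulAction.orbit PGL(Fin 4, ℂ) W} =
      Set.range fun o => MulAction.orbit PGL(Fin 4, ℂ) (normalAlgebra o) := by
  ext O
  constructor
  · rintro ⟨W, hW, rfl⟩
    rw [red4_eq_iUnion_orbit] at hW
    obtain ⟨o, ho⟩ := Set.mem_iUnion.1 hW
    exact ⟨o, (MulAction.orbit_eq_iff.2 ho).symm⟩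
  · rintro ⟨o, rfl⟩
    exact ⟨_, orbit_subset_red4 o (MulAction.mem_orbit_self _), rfl⟩

theorem card_orbitType : Nat.card OrbitType = 14 := by
  let e : OrbitType ≃ Fin 14 :=
    { toFun := fun o => ⟨o.ctorIdx, by cases o <;> decide⟩
      invFun := fun i => ![.O12, .O11, .O10', .O10'', .O9, .O8, .O8', .O8'', .O7', .O7'', .O7, .O6,
        .O3', .O3''] i
      left_inv := fun o => by cases o <;> rfl
      right_inv := fun i => by fin_cases i <;> rfl }
  rw [Nat.card_congr e, Nat.card_fin]

theorem ncard_orbits :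
    {O : Set (Grass 3 sl4) | ∃ W ∈ Red4, O = MulAction.orbit PGL(Fin 4, ℂ) W}.ncard = 14 := by
  rw [setOf_orbits_eq_range, ← Set.image_univ,
    Set.ncard_image_of_injective _ orbit_normalAlgebra_injective, Set.ncard_univ, card_orbitType]

/-- An orbit is closed exactly if no arrow starts at its type: its closure consists of the orbits of
the types that can be reached. -/
theorem isZariskiClosed_orbit_iff {o : OrbitType} :
    IsZariskiClosed (MulAction.orbit PGL(Fin 4, ℂ) (normalAlgebra o)) ↔ ∀ o', ¬ Arrow o o' := by
  constructor
  · intro h o' ha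
    have h1 := orbit_subset_closure_iff.2 (.single ha)
    rw [h] at h1
    have h2 := MulAction.orbit_eq_iff.2 (h1 (MulAction.mem_orbit_self _))
    obtain rfl := orbit_normalAlgebra_injective h2
    exact (orbitDim_lt_of_arrow ha).false
  · intro h
    refine Set.Subset.antisymm (fun W hW => ?_) (subset_zariskiClosure _)
    have h1 : W ∈ Red4 := by
      have := zariskiClosure_mono (orbit_subset_red4 o) hW
      rwa [Red4, zariskiClosure_idem] at this
    rw [red4_eq_iUnion_orbit] at h1
    obtain ⟨o', ho'⟩ := Set.mem_iUnion.1 h1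
    rcases (reflTransGen_of_mem_closure_orbit ho' hW).cases_head with rfl | ⟨o₁, h2, -⟩
    · exact ho'
    · exact absurd h2 (h o₁)

theorem forall_not_arrow_iff {o : OrbitType} : (∀ o', ¬ Arrow o o') ↔
    o = OrbitType.O3' ∨ o = OrbitType.O3'' ∨ o = OrbitType.O6 := by
  constructor
  · intro h
    cases o
    case O12 => exact absurd .a1 (h _)
    case O11 => exact absurd .a2 (h _)
    case O10' => exact absurd .a4 (h _)
    case O10'' => exact absurd .a5 (h _)
    case O9 => exact absurd .a8 (h _)
    case O8 => exact absurd .a10 (h _)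
    case O8' => exact absurd .a12 (h _)
    case O8'' => exact absurd .a13 (h _)
    case O7 => exact absurd .a14 (h _)
    case O7' => exact absurd .a15 (h _)
    case O7'' => exact absurd .a16 (h _)
    all_goals simp
  · rintro (rfl | rfl | rfl) o' h <;> cases h

/-! ### Polynomial sections of families of subspaces -/

section Sections

variable {σ τ : Type}

theorem IsPolyFun.comp_reindex {f : (σ → ℂ) → ℂ} (hf : IsPolyFun f) (r : σ → τ) :
    IsPolyFun fun p : τ → ℂ => f (p ∘ r) := by
  obtain ⟨P, hP⟩ := hf
  exact ⟨MvPolynomial.rename r P, fun p => by rw [MvPolynomial.eval_rename, hP]⟩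

variable {V : Type} [AddCommGroup V] [Module ℂ V] {k : ℕ} {X Y I J : Type}
  [HomogeneousCoordinates X σ] [HomogeneousCoordinates Y τ]

/-- A section of a family `r` of subspaces of `V`, the parameters of which have values `M` in a
variety: a vector of `r i` that is a polynomial function of the homogeneous coordinates of `M i`,
and is multiplied by a nonzero number when they change. -/
structure IsSection (M : I → X) (r : I → Submodule ℂ V) (w : (σ → ℂ) → V) : Prop where
  poly : IsPolyVec w
  mem : ∀ i, ∀ p ∈ coords (M i), w p ∈ r i
  scale : ∀ i, ∀ p ∈ coords (M i), ∀ q ∈ coords (M i), ∃ c : ℂˣ, w q = c • w p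

/-- Near each parameter there are sections that form bases of the subspaces `r i`. -/
def HasSections (M : I → X) (r : I → Grass k V) : Prop :=
  ∀ i₀, ∃ w : Fin k → (σ → ℂ) → V, (∀ j, IsSection M (fun i => (r i).1) (w j)) ∧
    ∃ p ∈ coords (M i₀), LinearIndependent ℂ fun j => w j p

theorem IsSection.comp {M : I → X} {r : I → Submodule ℂ V} {w : (σ → ℂ) → V}
    (hw : IsSection M r w) (a : J → I) : IsSection (fun j => M (a j)) (fun j => r (a j)) w :=
  ⟨hw.poly, fun j => hw.mem (a j), fun j => hw.scale (a j)⟩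

theorem IsSection.fst {M : I → X × Y} {r : I → Submodule ℂ V} {w : (σ → ℂ) → V}
    (hw : IsSection (fun i => (M i).1) r w) : IsSection M r fun p => w (p ∘ Sum.inl) :=
  ⟨fun f => (hw.poly f).comp_reindex _, fun i _ hp => hw.mem i _ hp.1,
    fun i _ hp _ hq => hw.scale i _ hp.1 _ hq.1⟩

theorem IsSection.snd {M : I → X × Y} {r : I → Submodule ℂ V} {w : (τ → ℂ) → V}
    (hw : IsSection (fun i => (M i).2) r w) : IsSection M r fun p => w (p ∘ Sum.inr) :=
  ⟨fun f => (hw.poly f).comp_reindex _, fun i _ hp => hw.mem i _ hp.2,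
    fun i _ hp _ hq => hw.scale i _ hp.2 _ hq.2⟩

theorem HasSections.isBasicRegular [FiniteDimensional ℂ V] {M : I → X} {r : I → Grass k V}
    (h : HasSections M r) {A : Set X} (a : A → I) (ha : ∀ x, M (a x) = x) :
    IsBasicRegular fun x => r (a x) := by
  refine isBasicRegular_of_basis _ fun x => ?_
  obtain ⟨w, hw, p, hp, hli⟩ := h (a x)
  have hmem : ∀ {y : A} {q : σ → ℂ}, q ∈ coords (y : X) → q ∈ coords (M (a y)) :=
    fun {y q} hq => by rwa [ha]
  refine ⟨fun p j => w j p, fun j => (hw j).poly, fun y q hq j => (hw j).mem _ q (hmem hq),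
    fun y q hq s hs => ?_, p, by rwa [ha] at hp, hli⟩
  choose c hc using fun j => (hw j).scale _ q (hmem hq) s (hmem hs)
  exact ⟨c, hc⟩

theorem HasSections.eq_of_eq [FiniteDimensional ℂ V] {M : I → X} {r : I → Grass k V}
    (h : HasSections M r) {i j : I} (hij : M i = M j) : r i = r j := by
  obtain ⟨w, hw, p, hp, hli⟩ := h i
  refine Subtype.ext ?_
  rw [← Grass.span_eq (r i) hli fun l => (hw l).mem i p hp,
    ← Grass.span_eq (r j) hli fun l => (hw l).mem j p (hij ▸ hp)]

/-- The alternating form that replaces the column `i` of the matrix of the values of `L` by the values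
of `f`, and takes the determinant. -/
def cramerForm (L : V →ₗ[ℂ] Fin k → ℂ) (i : Fin k) (f : V →ₗ[ℂ] ℂ) : V [⋀^Fin k]→ₗ[ℂ] ℂ :=
  Matrix.detRowAlternating.compLinearMap
    (LinearMap.pi (Function.update (fun j => LinearMap.proj j ∘ₗ L) i f))

theorem cramerForm_apply (L : V →ₗ[ℂ] Fin k → ℂ) (i : Fin k) (f : V →ₗ[ℂ] ℂ) (w : Fin k → V) :
    cramerForm L i f w =
      ∑ j, Matrix.adjugate (Matrix.of fun j => L (w j)) i j * f (w j) := by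
  have h : cramerForm L i f w =
      ((Matrix.of fun j => L (w j)).updateCol i fun j => f (w j)).det := by
    change Matrix.det _ = _
    congr 1
    ext a b
    by_cases hb : b = i
    · subst hb
      simp
    · simp [hb]
  rw [h, ← Matrix.cramer_apply, Matrix.cramer_eq_adjugate_mulVec]
  rfl

/-- The vector of a subspace that Cramer's rule produces from its Plücker coordinates: the one with
`f (cramerVector L i p) = p (cramerForm L i f)` for all functionals `f`. -/
def cramerVector [FiniteDimensional ℂ V] (L : V →ₗ[ℂ] Fin k → ℂ) (i : Fin k)
    (p : (V [⋀^Fin k]→ₗ[ℂ] ℂ) → ℂ) : V :=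
  ∑ a, p (cramerForm L i ((Module.finBasis ℂ V).coord a)) • Module.finBasis ℂ V a

theorem cramerVector_eq [FiniteDimensional ℂ V] (L : V →ₗ[ℂ] Fin k → ℂ) (i : Fin k) (w : Fin k → V) :
    cramerVector L i (fun ω => ω w) =
      ∑ j, Matrix.adjugate (Matrix.of fun j => L (w j)) i j • w j := by
  refine (Module.finBasis ℂ V).ext_elem fun a => ?_
  have h : ∀ c : Fin (Module.finrank ℂ V) → ℂ,
      (Module.finBasis ℂ V).repr (∑ b, c b • Module.finBasis ℂ V b) a = c a := fun c => by
    rw [Module.Basis.repr_sum_self]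
  rw [cramerVector, h, cramerForm_apply]
  simp

theorem isSection_cramerVector [FiniteDimensional ℂ V] (L : V →ₗ[ℂ] Fin k → ℂ) (i : Fin k) :
    IsSection (fun W : Grass k V => W) (fun W => W.1) (cramerVector L i) where
  poly := IsPolyVec.sum fun a _ => IsPolyVec.smul (IsPolyFun.coord _) (IsPolyVec.const _)
  mem W p hp := by
    obtain ⟨w, -, hW, hpw⟩ := hp
    rw [show p = fun ω => ω w from funext hpw, cramerVector_eq, ← hW]
    exact sum_mem fun j _ => Submodule.smul_mem _ _ (Submodule.subset_span ⟨j, rfl⟩)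
  scale W p hp q hq := by
    obtain ⟨c, hc, rfl⟩ := Grass.exists_smul_of_mem_coords hp hq
    refine ⟨Units.mk0 c hc, ?_⟩
    rw [Units.smul_def, Units.val_mk0, cramerVector, cramerVector, Finset.smul_sum]
    exact Finset.sum_congr rfl fun a _ => by rw [Pi.smul_apply, smul_smul, smul_eq_mul]

theorem exists_section_eq [FiniteDimensional ℂ V] {w : Fin k → V} (hw : LinearIndependent ℂ w)
    (i : Fin k) : ∃ s, IsSection (fun W : Grass k V => W) (fun W => W.1) s ∧
      s (fun ω => ω w) = w i := by
  obtain ⟨L, hL⟩ := exists_dual_of_linearIndependent hw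
  refine ⟨_, isSection_cramerVector L i, ?_⟩
  have h : (Matrix.of fun j => L (w j)) = 1 := by
    ext a b
    rw [Matrix.of_apply, hL, Matrix.one_apply, Pi.single_apply]
    simp [eq_comm]
  rw [cramerVector_eq, h, Matrix.adjugate_one]
  simp [Matrix.one_apply]

/-- A functional that vanishes on a subspace extends to a section of the annihilators of the
subspaces: subtract from it its values on the projections along the common kernel of suitable
functionals `L`, and clear denominators. -/
theorem exists_annihilator_section_eq [FiniteDimensional ℂ V] {w : Fin k → V}
    (hw : LinearIndependent ℂ w) (d : Module.Dual ℂ V) (hd : ∀ i, d (w i) = 0) :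
    ∃ s, IsSection (fun W : Grass k V => W) (fun W => W.1.dualAnnihilator) s ∧
      s (fun ω => ω w) = d := by
  obtain ⟨L, hL⟩ := exists_dual_of_linearIndependent hw
  let D : V [⋀^Fin k]→ₗ[ℂ] ℂ := Matrix.detRowAlternating.compLinearMap L
  let l : Fin k → Module.Dual ℂ V := fun i => LinearMap.proj i ∘ₗ L
  have hD : ∀ u : Fin k → V, D u = (Matrix.of fun j => L (u j)).det := fun u => rfl
  refine ⟨fun p => p D • d - ∑ i, p (cramerForm L i d) • l i, ⟨?_, fun W p hp => ?_,
    fun W p hp q hq => ?_⟩, ?_⟩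
  · exact (IsPolyVec.smul (IsPolyFun.coord _) (IsPolyVec.const _)).sub
      (IsPolyVec.sum fun i _ => IsPolyVec.smul (IsPolyFun.coord _) (IsPolyVec.const _))
  · obtain ⟨u, -, hW, hpu⟩ := hp
    rw [Submodule.mem_dualAnnihilator, ← hW]
    intro v hv
    have hle : Submodule.span ℂ (Set.range u) ≤
        LinearMap.ker (p D • d - ∑ i, p (cramerForm L i d) • l i) := by
      rw [Submodule.span_le]
      rintro _ ⟨j, rfl⟩
      set A : Matrix (Fin k) (Fin k) ℂ := Matrix.of fun j => L (u j) with hA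
      have h1 : ∑ i, p (cramerForm L i d) * A j i = A.det * d (u j) := by
        have h2 : ∀ i, p (cramerForm L i d) = (A.adjugate.mulVec fun j => d (u j)) i := fun i => by
          rw [hpu, cramerForm_apply]
          rfl
        calc ∑ i, p (cramerForm L i d) * A j i
            = (A.mulVec (A.adjugate.mulVec fun j => d (u j))) j :=
              Finset.sum_congr rfl fun i _ => by rw [h2, mul_comm]
          _ = A.det * d (u j) := by
            rw [Matrix.mulVec_mulVec, Matrix.mul_adjugate, Matrix.smul_mulVec, Matrix.one_mulVec]
            rfl
      change (p D • d - ∑ i, p (cramerForm L i d) • l i) (u j) = 0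
      rw [LinearMap.sub_apply, LinearMap.smul_apply, LinearMap.sum_apply, hpu, hD, ← hA,
        smul_eq_mul, ← h1, sub_eq_zero]
      rfl
    exact hle hv
  · obtain ⟨c, hc, rfl⟩ := Grass.exists_smul_of_mem_coords hp hq
    refine ⟨Units.mk0 c hc, ?_⟩
    rw [Units.smul_def, Units.val_mk0, smul_sub, Finset.smul_sum]
    simp only [Pi.smul_apply, smul_assoc]
  · have h1 : ∀ i, cramerForm L i d w = 0 := fun i => by
      rw [cramerForm_apply]
      simp [hd]
    have h2 : D w = 1 := by
      rw [hD]
      have h : (Matrix.of fun j => L (w j)) = 1 := by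
        ext a b
        rw [Matrix.of_apply, hL, Matrix.one_apply, Pi.single_apply]
        simp [eq_comm]
      rw [h, Matrix.det_one]
    simp [h1, h2]

theorem mem_coords_of_linearIndependent [FiniteDimensional ℂ V] {W : Grass k V} {w : Fin k → V}
    (hw : LinearIndependent ℂ w) (hW : ∀ i, w i ∈ W.1) : (fun ω => ω w) ∈ coords W :=
  ⟨w, hw, Grass.span_eq W hw hW, fun _ => rfl⟩

end Sections

/-! ### Matrices of rank one -/

theorem dual_apply_eq_sum (φ : Module.Dual ℂ C4) (u : C4) :
    φ u = ∑ j, u j * φ (Pi.single j 1) := by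
  rw [LinearMap.pi_apply_eq_sum_univ φ u]
  refine Finset.sum_congr rfl fun j _ => ?_
  rw [smul_eq_mul]
  congr 2
  ext i
  simp [Pi.single_apply, eq_comm]

/-- The traceless part of the matrix of the endomorphism `u ↦ φ u • v`. -/
def rankOne (v : C4) (φ : Module.Dual ℂ C4) : sl4 :=
  ⟨Matrix.of (fun i j => v i * φ (Pi.single j 1)) - (φ v / 4) • 1, by
    change Matrix.trace (Matrix.of (fun i j => v i * φ (Pi.single j 1)) -
      (φ v / 4) • (1 : Matrix (Fin 4) (Fin 4) ℂ)) = 0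
    rw [Matrix.trace_sub, Matrix.trace_smul, Matrix.trace_one, dual_apply_eq_sum φ v]
    simp [Matrix.trace]⟩

theorem rankOne_mulVec {v : C4} {φ : Module.Dual ℂ C4} (h : φ v = 0) (u : C4) :
    (rankOne v φ).1.mulVec u = φ u • v := by
  ext i
  have h1 : (rankOne v φ).1 = Matrix.of fun i j => v i * φ (Pi.single j 1) := by
    simp [rankOne, h]
  rw [h1, dual_apply_eq_sum φ u]
  simp only [Matrix.mulVec, dotProduct, Matrix.of_apply, Pi.smul_apply, smul_eq_mul,
    Finset.sum_mul]
  exact Finset.sum_congr rfl fun j _ => by ring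

theorem rankOne_smul_smul (a b : ℂ) (v : C4) (φ : Module.Dual ℂ C4) :
    rankOne (a • v) (b • φ) = (a * b) • rankOne v φ := by
  apply Subtype.ext
  ext i j
  simp [rankOne, smul_sub]
  ring

theorem IsPolyVec.rankOne {σ : Type} {v : (σ → ℂ) → C4} {φ : (σ → ℂ) → Module.Dual ℂ C4}
    (hv : IsPolyVec v) (hφ : IsPolyVec φ) : IsPolyVec fun p => rankOne (v p) (φ p) := by
  have h1 : ∀ i, IsPolyFun fun p => v p i := fun i => hv (LinearMap.proj i)
  have h2 : ∀ j, IsPolyFun fun p => φ p (Pi.single j 1) := fun j =>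
    hφ (Module.Dual.eval ℂ C4 (Pi.single j 1))
  have h3 : IsPolyFun fun p => φ p (v p) := by
    simp only [fun p => dual_apply_eq_sum (φ p) (v p)]
    exact IsPolyFun.sum fun j _ => (h1 j).mul (h2 j)
  refine isPolyVec_sl4 fun i j => ?_
  have h4 : ∀ p, (_root_.rankOne (v p) (φ p)).1 i j =
      v p i * φ p (Pi.single j 1) - φ p (v p) * (1 / 4 * (1 : Matrix (Fin 4) (Fin 4) ℂ) i j) :=
    fun p => by
      simp [_root_.rankOne]
      ring
  simp only [h4]
  exact ((h1 i).mul (h2 j)).sub (h3.mul (IsPolyFun.const _))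

theorem IsSection.rankOne {X σ I : Type} [HomogeneousCoordinates X σ] {M : I → X}
    {r : I → Submodule ℂ C4} {s : I → Submodule ℂ (Module.Dual ℂ C4)} {R : I → Submodule ℂ sl4}
    {v : (σ → ℂ) → C4} {φ : (σ → ℂ) → Module.Dual ℂ C4} (hv : IsSection M r v)
    (hφ : IsSection M s φ) (h : ∀ i, ∀ u ∈ r i, ∀ ψ ∈ s i, rankOne u ψ ∈ R i) :
    IsSection M R fun p => rankOne (v p) (φ p) where
  poly := hv.poly.rankOne hφ.poly
  mem i p hp := h i _ (hv.mem i p hp) _ (hφ.mem i p hp)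
  scale i p hp q hq := by
    obtain ⟨a, ha⟩ := hv.scale i p hp q hq
    obtain ⟨b, hb⟩ := hφ.scale i p hp q hq
    refine ⟨a * b, ?_⟩
    rw [ha, hb, Units.smul_def, Units.smul_def, rankOne_smul_smul, Units.smul_def, Units.val_mul]

/-! ### The closed orbits -/

theorem IsSection.map {X σ I V V' : Type} [HomogeneousCoordinates X σ] [AddCommGroup V] [Module ℂ V]
    [AddCommGroup V'] [Module ℂ V'] {M : I → X} {R : I → Submodule ℂ V} {r : I → Submodule ℂ V'}
    {w : (σ → ℂ) → V} (hw : IsSection M R w) (T : V →ₗ[ℂ] V') (h : ∀ i, ∀ x ∈ R i, T x ∈ r i) :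
    IsSection M r fun p => T (w p) where
  poly f := hw.poly (f ∘ₗ T)
  mem i p hp := h i _ (hw.mem i p hp)
  scale i p hp q hq := by
    obtain ⟨c, hc⟩ := hw.scale i p hp q hq
    exact ⟨c, by rw [hc, Units.smul_def, map_smul, Units.smul_def]⟩

/-- A parametrization of `B` by `A` that is regular, has a regular inverse and is equivariant. -/
theorem equivariantlyIsomorphic_of_hasSections {X σ : Type} [HomogeneousCoordinates X σ]
    [MulAction PGL(Fin 4, ℂ) X] {A : Set X} {B : Set (Grass 3 sl4)} (M : A → Grass 3 sl4)
    (hM : ∀ F, M F ∈ B) (hsurj : ∀ W ∈ B, ∃ F, M F = W) (hinj : Function.Injective M)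
    (hreg : HasSections (fun F : A => (F : X)) M)
    (hinv : ∀ a : B → A, (∀ y, M (a y) = y) → IsBasicRegular fun y => (a y : X))
    (hequiv : ∀ (g : GL (Fin 4) ℂ) (F F' : A), Matrix.ProjGenLinGroup.mk g • (F : X) = F' →
      Matrix.ProjGenLinGroup.mk g • M F = M F') :
    EquivariantlyIsomorphic PGL(Fin 4, ℂ) A B := by
  let e : A ≃ B := Equiv.ofBijective (fun F => ⟨M F, hM F⟩)
    ⟨fun F F' h => hinj (congrArg Subtype.val h), fun W => by
      obtain ⟨F, hF⟩ := hsurj W W.2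
      exact ⟨F, Subtype.ext hF⟩⟩
  refine ⟨e, ?_, ?_, fun g x y => ?_⟩
  · exact IsBasicRegular.isRegularMap (hreg.isBasicRegular id fun _ => rfl)
  · exact IsBasicRegular.isRegularMap
      (hinv e.symm fun y => congrArg Subtype.val (e.apply_symm_apply y))
  · induction g using pgl_induction with
    | h g => exact hequiv g x y

/-- The matrices of trace zero that map `ℂ⁴` into `U`, `H` into `L` and `U` to zero. -/
def nilAlgebra (L U H : Submodule ℂ C4) : Submodule ℂ sl4 where
  carrier := {x | (∀ v, x.1.mulVec v ∈ U) ∧ (∀ v ∈ U, x.1.mulVec v = 0) ∧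
    ∀ v ∈ H, x.1.mulVec v ∈ L}
  zero_mem' := ⟨fun v => by simp, fun v _ => by simp, fun v _ => by simp⟩
  add_mem' {x y} hx hy := by
    have h : ∀ v, (x + y).1.mulVec v = x.1.mulVec v + y.1.mulVec v := fun v =>
      Matrix.add_mulVec _ _ _
    refine ⟨fun v => ?_, fun v hv => ?_, fun v hv => ?_⟩
    · rw [h]; exact add_mem (hx.1 v) (hy.1 v)
    · rw [h, hx.2.1 v hv, hy.2.1 v hv, add_zero]
    · rw [h]; exact add_mem (hx.2.2 v hv) (hy.2.2 v hv)
  smul_mem' c x hx := by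
    have h : ∀ v, (c • x).1.mulVec v = c • x.1.mulVec v := fun v => Matrix.smul_mulVec _ _ _
    refine ⟨fun v => ?_, fun v hv => ?_, fun v hv => ?_⟩
    · rw [h]; exact U.smul_mem c (hx.1 v)
    · rw [h, hx.2.1 v hv, smul_zero]
    · rw [h]; exact L.smul_mem c (hx.2.2 v hv)

theorem conjLinearMap_mem_nilAlgebra (g : GL (Fin 4) ℂ) {L U H : Submodule ℂ C4} {x : sl4}
    (hx : x ∈ nilAlgebra L U H) : conjLinearMap g x ∈
      nilAlgebra (L.map (standardRep g : C4 →ₗ[ℂ] C4)) (U.map (standardRep g : C4 →ₗ[ℂ] C4))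
        (H.map (standardRep g : C4 →ₗ[ℂ] C4)) := by
  have hs : ∀ v, standardRep g v = (g : Matrix (Fin 4) (Fin 4) ℂ).mulVec v := fun v => rfl
  have hx' : ∀ v, (conjLinearMap g x).1.mulVec (standardRep g v) = standardRep g (x.1.mulVec v) :=
    fun v => by
      rw [hs, hs, Matrix.mulVec_mulVec, conjLinearMap_eq_iff.1 rfl, Matrix.mulVec_mulVec]
  refine ⟨fun v => ?_, ?_, ?_⟩
  · obtain ⟨u, rfl⟩ := (standardRep g).surjective v
    rw [hx']
    exact ⟨_, hx.1 u, rfl⟩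
  · rintro _ ⟨u, hu, rfl⟩
    change (conjLinearMap g x).1.mulVec (standardRep g u) = 0
    rw [hx', hx.2.1 u hu, map_zero]
  · rintro _ ⟨u, hu, rfl⟩
    change (conjLinearMap g x).1.mulVec (standardRep g u) ∈ _
    rw [hx']
    exact ⟨_, hx.2.2 u hu, rfl⟩

theorem rankOne_mem_nilAlgebra {L U H : Submodule ℂ C4} {u : C4} {φ : Module.Dual ℂ C4}
    (hu : u ∈ U) (hφ : φ ∈ U.dualAnnihilator) (h : u ∈ L ∨ φ ∈ H.dualAnnihilator) :
    rankOne u φ ∈ nilAlgebra L U H := by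
  rw [Submodule.mem_dualAnnihilator] at hφ
  have hx := rankOne_mulVec (hφ u hu)
  refine ⟨fun v => ?_, fun v hv => ?_, fun v hv => ?_⟩
  · rw [hx]; exact U.smul_mem _ hu
  · rw [hx, hφ v hv, zero_smul]
  · rw [hx]
    rcases h with h | h
    · exact L.smul_mem _ h
    · rw [(Submodule.mem_dualAnnihilator _).1 h v hv, zero_smul]
      exact L.zero_mem

/-! ### Adapted bases -/

/-- A basis of `ℂ⁴` together with its dual basis. -/
structure IsDualPair (b : Fin 4 → C4) (d : Fin 4 → Module.Dual ℂ C4) : Prop where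
  li : LinearIndependent ℂ b
  apply : ∀ i j, d i (b j) = if i = j then 1 else 0
  sum : ∀ u, u = d 0 u • b 0 + d 1 u • b 1 + d 2 u • b 2 + d 3 u • b 3

theorem exists_isDualPair {b : Fin 4 → C4} (hb : LinearIndependent ℂ b) :
    ∃ d, IsDualPair b d := by
  obtain ⟨L, hL⟩ := exists_dual_of_linearIndependent hb
  have h : ∀ i j, (LinearMap.proj i ∘ₗ L : Module.Dual ℂ C4) (b j) = if i = j then 1 else 0 :=
    fun i j => by
      change L (b j) i = _
      rw [hL, Pi.single_apply]
  refine ⟨fun i => LinearMap.proj i ∘ₗ L, hb, h, fun u => ?_⟩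
  obtain ⟨c, hc⟩ := exists_coeff hb (by simp) u
  have h1 : ∀ i, (LinearMap.proj i ∘ₗ L : Module.Dual ℂ C4) u = c i := fun i => by
    rw [← hc, map_sum]
    simp only [map_smul, h]
    simp
  rw [h1, h1, h1, h1, ← hc, Fin.sum_univ_four]

theorem IsDualPair.mulVec_eq {b : Fin 4 → C4} {d : Fin 4 → Module.Dual ℂ C4} (h : IsDualPair b d)
    (x : Matrix (Fin 4) (Fin 4) ℂ) (v : C4) : x.mulVec v = d 0 v • x.mulVec (b 0) +
      d 1 v • x.mulVec (b 1) + d 2 v • x.mulVec (b 2) + d 3 v • x.mulVec (b 3) := by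
  conv_lhs => rw [h.sum v]
  simp only [Matrix.mulVec_add, Matrix.mulVec_smul]

/-- The matrices of rank one formed from different pairs of a basis and its dual basis are linearly
independent. -/
theorem IsDualPair.linearIndependent_rankOne {b : Fin 4 → C4} {d : Fin 4 → Module.Dual ℂ C4}
    (h : IsDualPair b d) {n : ℕ} {i j : Fin n → Fin 4} (hij : ∀ k, i k ≠ j k)
    (hinj : ∀ k l, i k = i l → j k = j l → k = l) :
    LinearIndependent ℂ fun k => rankOne (b (i k)) (d (j k)) := by
  rw [Fintype.linearIndependent_iff]
  intro c hc k
  let T : sl4 →ₗ[ℂ] ℂ :=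
    { toFun := fun x => d (i k) (x.1.mulVec (b (j k)))
      map_add' := fun x y => by
        rw [← map_add, ← Matrix.add_mulVec]; rfl
      map_smul' := fun a x => by
        rw [RingHom.id_apply, ← map_smul, ← Matrix.smul_mulVec]; rfl }
  have h1 : ∀ l, T (rankOne (b (i l)) (d (j l))) = if l = k then 1 else 0 := fun l => by
    change d (i k) ((rankOne (b (i l)) (d (j l))).1.mulVec (b (j k))) = _
    rw [rankOne_mulVec (by rw [h.apply, if_neg (hij l).symm]), map_smul, h.apply, h.apply,
      smul_eq_mul]
    by_cases hl : l = k
    · subst hl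
      simp
    · rw [if_neg hl]
      by_cases h2 : i k = i l
      · rw [if_neg fun h3 => hl (hinj l k h2.symm h3), zero_mul]
      · rw [if_neg h2, mul_zero]
  have h2 := congrArg T hc
  rw [map_sum, map_zero] at h2
  simpa [h1] using h2

theorem mem_mk_smul_normalAlgebra_iff {o : OrbitType} {g : GL (Fin 4) ℂ} {x : sl4} :
    x ∈ (Matrix.ProjGenLinGroup.mk g • normalAlgebra o).1 ↔ ∃ a b c d : ℂ,
      ∀ j, x.1.mulVec ((g : Matrix (Fin 4) (Fin 4) ℂ).transpose j) =
        ∑ k, normalForm o a b c d k j • (g : Matrix (Fin 4) (Fin 4) ℂ).transpose k := by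
  have key : ∀ y : Matrix (Fin 4) (Fin 4) ℂ, x.1 * (g : Matrix (Fin 4) (Fin 4) ℂ) = g * y ↔
      ∀ j, x.1.mulVec ((g : Matrix (Fin 4) (Fin 4) ℂ).transpose j) =
        ∑ k, y k j • (g : Matrix (Fin 4) (Fin 4) ℂ).transpose k := fun y => by
    have h1 : ∀ i j, x.1.mulVec ((g : Matrix (Fin 4) (Fin 4) ℂ).transpose j) i =
        (x.1 * (g : Matrix (Fin 4) (Fin 4) ℂ)) i j := fun i j => rfl
    have h2 : ∀ i j, (∑ k, y k j • (g : Matrix (Fin 4) (Fin 4) ℂ).transpose k) i =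
        ((g : Matrix (Fin 4) (Fin 4) ℂ) * y) i j := fun i j => by
      rw [Finset.sum_apply, Matrix.mul_apply]
      exact Finset.sum_congr rfl fun k _ => by simp [mul_comm]
    constructor
    · intro h j
      ext i
      rw [h1, h2, h]
    · intro h
      ext i j
      rw [← h1, ← h2, h]
  rw [mem_mk_smul]
  constructor
  · rintro ⟨y, hy, hyx⟩
    obtain ⟨a, b, c, d, habcd⟩ := mem_normalAlgebra.1 hy
    exact ⟨a, b, c, d, (key _).1 (by rw [← habcd]; exact conjLinearMap_eq_iff.1 hyx)⟩
  · rintro ⟨a, b, c, d, h⟩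
    have h1 := (key _).2 h
    refine ⟨conjLinearMap g⁻¹ x, mem_normalAlgebra.2 ⟨a, b, c, d, ?_⟩, ?_⟩
    · rw [coe_conjLinearMap, inv_inv, mul_assoc, h1, ← mul_assoc, ← Units.val_mul, inv_mul_cancel,
        Units.val_one, one_mul]
    · rw [← conjLinearMap_mul, mul_inv_cancel, conjLinearMap_one]

theorem linearIndependent_transpose (g : GL (Fin 4) ℂ) :
    LinearIndependent ℂ fun j => (g : Matrix (Fin 4) (Fin 4) ℂ).transpose j :=
  Matrix.linearIndependent_cols_of_isUnit g.isUnit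

theorem exists_transpose_eq {b : Fin 4 → C4} (hb : LinearIndependent ℂ b) :
    ∃ g : GL (Fin 4) ℂ, ∀ j, (g : Matrix (Fin 4) (Fin 4) ℂ).transpose j = b j := by
  have h1 : IsUnit (Matrix.of b) := Matrix.linearIndependent_rows_iff_isUnit.1 hb
  have h2 : (Matrix.of b).transpose.det ≠ 0 := by
    rw [Matrix.det_transpose]
    exact ((Matrix.isUnit_iff_isUnit_det _).1 h1).ne_zero
  exact ⟨Matrix.GeneralLinearGroup.mkOfDetNeZero _ h2, fun j => rfl⟩

theorem Grass.mem_iff_exists_sum {k : ℕ} {V : Type} [AddCommGroup V] [Module ℂ V]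
    [FiniteDimensional ℂ V] (W : Grass k V) {w : Fin k → V} (hw : LinearIndependent ℂ w)
    (hW : ∀ i, w i ∈ W.1) {v : V} : v ∈ W.1 ↔ ∃ c : Fin k → ℂ, ∑ i, c i • w i = v := by
  rw [← Grass.span_eq W hw hW, Submodule.mem_span_range_iff_exists_fun]

/-- The subspace spanned by the first vectors of a basis. -/
def spanFirst (b : Fin 4 → C4) (hb : LinearIndependent ℂ b) (k : ℕ) (hk : k ≤ 4) : Grass k C4 :=
  ⟨Submodule.span ℂ (Set.range fun i : Fin k => b (Fin.castLE hk i)),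
    (finrank_span_eq_card (hb.comp _ (Fin.castLE_injective hk))).trans (Fintype.card_fin k)⟩

theorem mem_spanFirst {b : Fin 4 → C4} {hb : LinearIndependent ℂ b} {k : ℕ} {hk : k ≤ 4}
    (i : Fin k) : b (Fin.castLE hk i) ∈ (spanFirst b hb k hk).1 :=
  Submodule.subset_span ⟨i, rfl⟩

theorem exists_adapted_basis {k : ℕ} (hk : k ≤ 4) (W : Grass k C4) :
    ∃ b : Fin 4 → C4, LinearIndependent ℂ b ∧ ∀ i, b (Fin.castLE hk i) ∈ W.1 := by
  obtain ⟨w, hw, hW⟩ := W.exists_basis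
  obtain ⟨b, hb, hbw⟩ := exists_extension hw (by simp : Module.finrank ℂ C4 = 4) hk
  exact ⟨b, hb, fun i => by rw [hbw, ← hW]; exact Submodule.subset_span ⟨i, rfl⟩⟩

/-! ### The orbits of lines and of hyperplanes -/

theorem exists_smul_eq_of_mem_iff {o : OrbitType} {N : Submodule ℂ sl4} {b : Fin 4 → C4}
    (hb : LinearIndependent ℂ b) (h : ∀ x, x ∈ N ↔ ∃ α β γ δ : ℂ,
      ∀ j, x.1.mulVec (b j) = ∑ k, normalForm o α β γ δ k j • b k) :
    ∃ g : GL (Fin 4) ℂ, (Matrix.ProjGenLinGroup.mk g • normalAlgebra o).1 = N := by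
  obtain ⟨g, hg⟩ := exists_transpose_eq hb
  refine ⟨g, Submodule.ext fun x => ?_⟩
  rw [mem_mk_smul_normalAlgebra_iff, h]
  simp only [hg]

/-- The linear map `x ↦ x u`. -/
def applyAt (u : C4) : sl4 →ₗ[ℂ] C4 where
  toFun x := x.1.mulVec u
  map_add' _ _ := Matrix.add_mulVec _ _ _
  map_smul' _ _ := Matrix.smul_mulVec _ _ _

theorem applyAt_rankOne {b : Fin 4 → C4} {d : Fin 4 → Module.Dual ℂ C4} (h : IsDualPair b d)
    {i j : Fin 4} (hij : i ≠ j) : applyAt (b j) (rankOne (b i) (d j)) = b i := by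
  change (rankOne (b i) (d j)).1.mulVec (b j) = b i
  rw [rankOne_mulVec (by rw [h.apply, if_neg hij.symm]), h.apply, if_pos rfl, one_smul]

section Lines

open OrbitType

variable {b : Fin 4 → C4} {d : Fin 4 → Module.Dual ℂ C4}

theorem mem_nilAlgebra_line (hbd : IsDualPair b d) {l : Grass 1 C4} (h0 : b 0 ∈ l.1) (x : sl4) :
    x ∈ nilAlgebra ⊤ l.1 ⊤ ↔ ∃ α β γ δ : ℂ,
      ∀ j, x.1.mulVec (b j) = ∑ k, normalForm O3' α β γ δ k j • b k := by
  have hl : ∀ v, v ∈ l.1 ↔ ∃ c : ℂ, c • b 0 = v := fun v => by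
    rw [l.mem_iff_exists_sum (w := fun _ => b 0)
      (LinearIndependent.of_subsingleton (ι := Fin 1) 0 (hbd.li.ne_zero 0)) fun _ => h0]
    simp only [Fin.sum_univ_one]
    exact ⟨fun ⟨c, hc⟩ => ⟨c 0, hc⟩, fun ⟨c, hc⟩ => ⟨fun _ => c, hc⟩⟩
  constructor
  · intro hx
    obtain ⟨α, hα⟩ := (hl _).1 (hx.1 (b 1))
    obtain ⟨β, hβ⟩ := (hl _).1 (hx.1 (b 2))
    obtain ⟨γ, hγ⟩ := (hl _).1 (hx.1 (b 3))
    refine ⟨α, β, γ, 0, fun j => ?_⟩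
    fin_cases j <;> simp [normalForm, Fin.sum_univ_four, hx.2.1 _ h0, ← hα, ← hβ, ← hγ]
  · rintro ⟨α, β, γ, δ, h⟩
    have e0 : x.1.mulVec (b 0) = 0 := by simpa [normalForm, Fin.sum_univ_four] using h 0
    have e1 : x.1.mulVec (b 1) = α • b 0 := by simpa [normalForm, Fin.sum_univ_four] using h 1
    have e2 : x.1.mulVec (b 2) = β • b 0 := by simpa [normalForm, Fin.sum_univ_four] using h 2
    have e3 : x.1.mulVec (b 3) = γ • b 0 := by simpa [normalForm, Fin.sum_univ_four] using h 3
    refine ⟨fun v => ?_, fun v hv => ?_, fun v _ => trivial⟩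
    · rw [hbd.mulVec_eq, e0, e1, e2, e3]
      exact (hl _).2 ⟨d 1 v * α + d 2 v * β + d 3 v * γ, by module⟩
    · obtain ⟨c, rfl⟩ := (hl v).1 hv
      rw [Matrix.mulVec_smul, e0, smul_zero]

theorem exists_smul_eq_nilAlgebra_line (l : Grass 1 C4) : ∃ g : GL (Fin 4) ℂ,
    (Matrix.ProjGenLinGroup.mk g • normalAlgebra O3').1 = nilAlgebra ⊤ l.1 ⊤ := by
  obtain ⟨b, hb, h⟩ := exists_adapted_basis (by norm_num) l
  obtain ⟨d, hbd⟩ := exists_isDualPair hb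
  exact exists_smul_eq_of_mem_iff hb (mem_nilAlgebra_line hbd (h 0))

/-- The algebra of the endomorphisms with image in a line that they kill. -/
def lineAlgebra (l : P3) : Grass 3 sl4 :=
  ⟨nilAlgebra ⊤ l.1.1 ⊤, by
    obtain ⟨g, hg⟩ := exists_smul_eq_nilAlgebra_line l.1
    rw [← hg]
    exact (Matrix.ProjGenLinGroup.mk g • normalAlgebra O3').2⟩

theorem hasSections_lineAlgebra : HasSections (fun l : P3 => (l : Grass 1 C4)) lineAlgebra := by
  intro l
  obtain ⟨b, hb, h⟩ := exists_adapted_basis (by norm_num) l.1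
  obtain ⟨d, hbd⟩ := exists_isDualPair hb
  have hb' : LinearIndependent ℂ fun i : Fin 1 => b (Fin.castLE (by norm_num) i) :=
    hb.comp _ (Fin.castLE_injective _)
  obtain ⟨v, hv, hv0⟩ := exists_section_eq hb' 0
  choose φ hφ hφ0 using fun j : Fin 3 => exists_annihilator_section_eq hb' (d j.succ) fun i => by
    rw [hbd.apply, if_neg]
    fin_cases i
    exact Fin.succ_ne_zero j
  refine ⟨fun j p => rankOne (v p) (φ j p), fun j => ?_, _,
    mem_coords_of_linearIndependent hb' h, ?_⟩
  · exact (hv.comp Subtype.val).rankOne ((hφ j).comp Subtype.val)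
      fun l u hu ψ hψ => rankOne_mem_nilAlgebra hu hψ (.inl trivial)
  · simp only [hv0, hφ0]
    exact hbd.linearIndependent_rankOne (i := fun _ => 0) (j := Fin.succ)
      (fun k => (Fin.succ_ne_zero k).symm) fun k l _ h => Fin.succ_injective _ h

theorem hasSections_line : HasSections lineAlgebra fun l => l.1 := by
  intro l
  obtain ⟨b, hb, h⟩ := exists_adapted_basis (by norm_num) l.1
  have h0 : b 0 ∈ l.1.1 := h 0
  obtain ⟨d, hbd⟩ := exists_isDualPair hb
  have hli := hbd.linearIndependent_rankOne (i := fun _ : Fin 3 => 0) (j := Fin.succ)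
      (fun k => (Fin.succ_ne_zero k).symm) fun k l _ h => Fin.succ_injective _ h
  obtain ⟨s, hs, hs0⟩ := exists_section_eq hli 0
  refine ⟨fun _ p => applyAt (b 1) (s p), fun _ => (hs.comp lineAlgebra).map _
    fun l x hx => hx.1 _, _, mem_coords_of_linearIndependent hli fun k => ?_, ?_⟩
  · refine rankOne_mem_nilAlgebra h0 ((Submodule.mem_dualAnnihilator _).2 fun v hv => ?_)
      (.inl trivial)
    obtain ⟨c, rfl⟩ := (l.1.mem_iff_exists_sum (w := fun _ => b 0)
      (LinearIndependent.of_subsingleton (ι := Fin 1) 0 (hb.ne_zero 0)) fun _ => h0).1 hv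
    rw [Fin.sum_univ_one, map_smul, hbd.apply, if_neg (Fin.succ_ne_zero k), smul_zero]
  · refine LinearIndependent.of_subsingleton (ι := Fin 1) 0 ?_
    have h1 := applyAt_rankOne hbd (i := 0) (j := 1) (by decide)
    simp only [hs0]
    exact ne_of_eq_of_ne h1 (hb.ne_zero 0)

/-- The closed orbit of matrices of rank one with a common image. -/
theorem equivariantlyIsomorphic_line : EquivariantlyIsomorphic PGL(Fin 4, ℂ) P3
    (MulAction.orbit PGL(Fin 4, ℂ) (normalAlgebra O3')) := by
  refine equivariantlyIsomorphic_of_hasSections lineAlgebra (fun l => ?_) ?_ (fun l l' h => ?_)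
    hasSections_lineAlgebra (fun a ha => hasSections_line.isBasicRegular a ha) fun g l l' h => ?_
  · obtain ⟨g, hg⟩ := exists_smul_eq_nilAlgebra_line l.1
    exact ⟨_, Subtype.ext hg⟩
  · rintro _ ⟨g, rfl⟩
    induction g using pgl_induction with | h g => ?_
    have hb := linearIndependent_transpose g
    obtain ⟨d, hbd⟩ := exists_isDualPair hb
    refine ⟨⟨spanFirst _ hb 1 (by norm_num), trivial⟩, Subtype.ext (Submodule.ext fun x => ?_)⟩
    rw [mem_mk_smul_normalAlgebra_iff]
    exact mem_nilAlgebra_line hbd (mem_spanFirst (hb := hb) (hk := by norm_num) (0 : Fin 1)) x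
  · exact Subtype.ext (hasSections_line.eq_of_eq h)
  · refine Grass.eq_of_le ?_
    rintro _ ⟨x, hx, rfl⟩
    have h1 := conjLinearMap_mem_nilAlgebra g hx
    have h2 : l'.1.1 = l.1.1.map (standardRep g : C4 →ₗ[ℂ] C4) := congrArg Subtype.val h.symm
    rw [Submodule.map_top, LinearEquiv.range, ← h2] at h1
    exact h1

end Lines

section Hyperplanes

open OrbitType

variable {b : Fin 4 → C4} {d : Fin 4 → Module.Dual ℂ C4}

theorem mem_hyperplane_iff (hbd : IsDualPair b d) {H : Grass 3 C4} (h0 : b 0 ∈ H.1)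
    (h1 : b 1 ∈ H.1) (h2 : b 2 ∈ H.1) {v : C4} :
    v ∈ H.1 ↔ ∃ r s t : ℂ, v = r • b 0 + s • b 1 + t • b 2 := by
  rw [H.mem_iff_exists_sum (w := fun i => b (Fin.castLE (by norm_num : 3 ≤ 4) i))
    (hbd.li.comp _ (Fin.castLE_injective (by norm_num))) (by intro i; fin_cases i <;> assumption)]
  constructor
  · rintro ⟨c, rfl⟩
    exact ⟨c 0, c 1, c 2, Fin.sum_univ_three _⟩
  · rintro ⟨r, s, t, rfl⟩
    exact ⟨![r, s, t], Fin.sum_univ_three _⟩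

theorem annihilator_hyperplane (hbd : IsDualPair b d) {H : Grass 3 C4} (h0 : b 0 ∈ H.1)
    (h1 : b 1 ∈ H.1) (h2 : b 2 ∈ H.1) : d 3 ∈ H.1.dualAnnihilator := by
  rw [Submodule.mem_dualAnnihilator]
  intro v hv
  obtain ⟨r, s, t, rfl⟩ := (mem_hyperplane_iff hbd h0 h1 h2).1 hv
  simp [hbd.apply]

theorem mem_nilAlgebra_hyperplane (hbd : IsDualPair b d) {H : Grass 3 C4} (h0 : b 0 ∈ H.1)
    (h1 : b 1 ∈ H.1) (h2 : b 2 ∈ H.1) (x : sl4) :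
    x ∈ nilAlgebra ⊤ H.1 ⊤ ↔ ∃ α β γ δ : ℂ,
      ∀ j, x.1.mulVec (b j) = ∑ k, normalForm O3'' α β γ δ k j • b k := by
  constructor
  · intro hx
    obtain ⟨γ, β, α, h⟩ := (mem_hyperplane_iff hbd h0 h1 h2).1 (hx.1 (b 3))
    refine ⟨α, β, γ, 0, fun j => ?_⟩
    fin_cases j <;> simp [normalForm, Fin.sum_univ_four, hx.2.1 _ h0, hx.2.1 _ h1, hx.2.1 _ h2, h]
  · rintro ⟨α, β, γ, δ, h⟩
    have e0 : x.1.mulVec (b 0) = 0 := by simpa [normalForm, Fin.sum_univ_four] using h 0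
    have e1 : x.1.mulVec (b 1) = 0 := by simpa [normalForm, Fin.sum_univ_four] using h 1
    have e2 : x.1.mulVec (b 2) = 0 := by simpa [normalForm, Fin.sum_univ_four] using h 2
    have e3 : x.1.mulVec (b 3) = γ • b 0 + β • b 1 + α • b 2 := by
      simpa [normalForm, Fin.sum_univ_four] using h 3
    refine ⟨fun v => ?_, fun v hv => ?_, fun v _ => trivial⟩
    · rw [hbd.mulVec_eq, e0, e1, e2, e3]
      exact (mem_hyperplane_iff hbd h0 h1 h2).2 ⟨d 3 v * γ, d 3 v * β, d 3 v * α, by module⟩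
    · obtain ⟨r, s, t, rfl⟩ := (mem_hyperplane_iff hbd h0 h1 h2).1 hv
      simp [Matrix.mulVec_add, Matrix.mulVec_smul, e0, e1, e2]

theorem exists_smul_eq_nilAlgebra_hyperplane (H : Grass 3 C4) : ∃ g : GL (Fin 4) ℂ,
    (Matrix.ProjGenLinGroup.mk g • normalAlgebra O3'').1 = nilAlgebra ⊤ H.1 ⊤ := by
  obtain ⟨b, hb, h⟩ := exists_adapted_basis (by norm_num) H
  obtain ⟨d, hbd⟩ := exists_isDualPair hb
  exact exists_smul_eq_of_mem_iff hb (mem_nilAlgebra_hyperplane hbd (h 0) (h 1) (h 2))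

/-- The algebra of the endomorphisms that kill a hyperplane containing their image. -/
def hyperplaneAlgebra (H : P3Dual) : Grass 3 sl4 :=
  ⟨nilAlgebra ⊤ H.1.1 ⊤, by
    obtain ⟨g, hg⟩ := exists_smul_eq_nilAlgebra_hyperplane H.1
    rw [← hg]
    exact (Matrix.ProjGenLinGroup.mk g • normalAlgebra O3'').2⟩

theorem hasSections_hyperplaneAlgebra :
    HasSections (fun H : P3Dual => (H : Grass 3 C4)) hyperplaneAlgebra := by
  intro H
  obtain ⟨b, hb, h⟩ := exists_adapted_basis (by norm_num) H.1
  obtain ⟨d, hbd⟩ := exists_isDualPair hb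
  have hb' : LinearIndependent ℂ fun i : Fin 3 => b (Fin.castLE (by norm_num) i) :=
    hb.comp _ (Fin.castLE_injective _)
  choose v hv hv0 using exists_section_eq hb'
  obtain ⟨φ, hφ, hφ0⟩ := exists_annihilator_section_eq hb' (d 3) fun i => by
    rw [hbd.apply, if_neg]
    fin_cases i <;> decide
  refine ⟨fun j p => rankOne (v j p) (φ p), fun j => ?_, _,
    mem_coords_of_linearIndependent hb' h, ?_⟩
  · exact ((hv j).comp Subtype.val).rankOne (hφ.comp Subtype.val)
      fun l u hu ψ hψ => rankOne_mem_nilAlgebra hu hψ (.inl trivial)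
  · simp only [hv0, hφ0]
    exact hbd.linearIndependent_rankOne (i := fun k : Fin 3 => Fin.castLE (by norm_num) k)
      (j := fun _ => 3) (fun k => by fin_cases k <;> decide)
      fun k l h _ => Fin.castLE_injective _ h

theorem hasSections_hyperplane : HasSections hyperplaneAlgebra fun H => H.1 := by
  intro H
  obtain ⟨b, hb, h⟩ := exists_adapted_basis (by norm_num) H.1
  obtain ⟨d, hbd⟩ := exists_isDualPair hb
  have hne : ∀ k : Fin 3, Fin.castLE (by norm_num : 3 ≤ 4) k ≠ 3 := by decide
  have hli := hbd.linearIndependent_rankOne (i := fun k : Fin 3 => Fin.castLE (by norm_num) k)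
    (j := fun _ => 3) hne fun k l h _ => Fin.castLE_injective _ h
  choose s hs hs0 using exists_section_eq hli
  refine ⟨fun j p => applyAt (b 3) (s j p), fun j => ((hs j).comp hyperplaneAlgebra).map _
    fun l x hx => hx.1 _, _, mem_coords_of_linearIndependent hli fun k => ?_, ?_⟩
  · exact rankOne_mem_nilAlgebra (h k) (annihilator_hyperplane hbd (h 0) (h 1) (h 2)) (.inl trivial)
  · simp only [hs0, fun k => applyAt_rankOne hbd (hne k)]
    exact hb.comp _ (Fin.castLE_injective _)

/-- The closed orbit of matrices of rank one with a common kernel. -/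
theorem equivariantlyIsomorphic_hyperplane : EquivariantlyIsomorphic PGL(Fin 4, ℂ) P3Dual
    (MulAction.orbit PGL(Fin 4, ℂ) (normalAlgebra O3'')) := by
  refine equivariantlyIsomorphic_of_hasSections hyperplaneAlgebra (fun l => ?_) ?_
    (fun l l' h => ?_) hasSections_hyperplaneAlgebra
    (fun a ha => hasSections_hyperplane.isBasicRegular a ha) fun g l l' h => ?_
  · obtain ⟨g, hg⟩ := exists_smul_eq_nilAlgebra_hyperplane l.1
    exact ⟨_, Subtype.ext hg⟩
  · rintro _ ⟨g, rfl⟩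
    induction g using pgl_induction with | h g => ?_
    have hb := linearIndependent_transpose g
    obtain ⟨d, hbd⟩ := exists_isDualPair hb
    have hmem := fun i : Fin 3 => mem_spanFirst (hb := hb) (hk := by norm_num) i
    refine ⟨⟨spanFirst _ hb 3 (by norm_num), trivial⟩, Subtype.ext (Submodule.ext fun x => ?_)⟩
    rw [mem_mk_smul_normalAlgebra_iff]
    exact mem_nilAlgebra_hyperplane hbd (hmem 0) (hmem 1) (hmem 2) x
  · exact Subtype.ext (hasSections_hyperplane.eq_of_eq h)
  · refine Grass.eq_of_le ?_
    rintro _ ⟨x, hx, rfl⟩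
    have h1 := conjLinearMap_mem_nilAlgebra g hx
    have h2 : l'.1.1 = l.1.1.map (standardRep g : C4 →ₗ[ℂ] C4) := congrArg Subtype.val h.symm
    rw [Submodule.map_top, LinearEquiv.range, ← h2] at h1
    exact h1

end Hyperplanes

/-! ### The orbit of complete flags -/

section Flags

open OrbitType

variable {b : Fin 4 → C4} {d : Fin 4 → Module.Dual ℂ C4}

/-- A basis the first vectors of which span the members of a flag. -/
structure IsAdapted (b : Fin 4 → C4) (F : Flags4) : Prop where
  line : b 0 ∈ F.1.1.1
  plane : b 1 ∈ F.1.2.1.1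
  hyperplane : b 2 ∈ F.1.2.2.1

theorem exists_isAdapted (F : Flags4) :
    ∃ b : Fin 4 → C4, LinearIndependent ℂ b ∧ IsAdapted b F := by
  obtain ⟨⟨l, P, H⟩, hlP, hPH⟩ := F
  change l.1 ≤ P.1 at hlP
  change P.1 ≤ H.1 at hPH
  obtain ⟨w, hw, hwl⟩ := l.exists_basis
  have hlt : ∀ {S T : Submodule ℂ C4}, S ≤ T → Module.finrank ℂ S < Module.finrank ℂ T →
      ∃ v ∈ T, v ∉ S := fun h hf =>
    SetLike.exists_of_lt (lt_of_le_of_ne h fun h' => by rw [h'] at hf; exact hf.false)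
  obtain ⟨u, hu, hul⟩ := hlt hlP (by rw [l.2, P.2]; norm_num)
  have hw2 : LinearIndependent ℂ (Fin.snoc w u : Fin 2 → C4) := hw.finSnoc (by rwa [hwl])
  have hw0 : ∀ i, w i ∈ l.1 := fun i => by rw [← hwl]; exact Submodule.subset_span ⟨i, rfl⟩
  have hmem2 : ∀ i, (Fin.snoc w u : Fin 2 → C4) i ∈ P.1 := fun i => by
    refine Fin.lastCases ?_ (fun i => ?_) i
    · rwa [Fin.snoc_last]
    · rw [Fin.snoc_castSucc]; exact hlP (hw0 i)
  obtain ⟨t, ht, htP⟩ := hlt hPH (by rw [P.2, H.2]; norm_num)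
  have hw3 : LinearIndependent ℂ (Fin.snoc (Fin.snoc w u : Fin 2 → C4) t : Fin 3 → C4) :=
    hw2.finSnoc (by rwa [P.span_eq hw2 hmem2])
  obtain ⟨b, hb, hbw⟩ := exists_extension hw3 (by simp : Module.finrank ℂ C4 = 4) (by norm_num)
  refine ⟨b, hb, ?_, ?_, ?_⟩
  · exact (hbw 0) ▸ hw0 0
  · exact (hbw 1) ▸ hu
  · exact (hbw 2) ▸ ht

variable {F : Flags4}

theorem mem_line_iff (hbd : IsDualPair b d) (hF : IsAdapted b F) {v : C4} :
    v ∈ F.1.1.1 ↔ ∃ r : ℂ, v = r • b 0 := by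
  rw [F.1.1.mem_iff_exists_sum (w := fun _ => b 0)
    (LinearIndependent.of_subsingleton (ι := Fin 1) 0 (hbd.li.ne_zero 0)) fun _ => hF.line]
  simp only [Fin.sum_univ_one]
  exact ⟨fun ⟨c, hc⟩ => ⟨c 0, hc.symm⟩, fun ⟨c, hc⟩ => ⟨fun _ => c, hc.symm⟩⟩

theorem mem_plane_iff (hbd : IsDualPair b d) (hF : IsAdapted b F) {v : C4} :
    v ∈ F.1.2.1.1 ↔ ∃ r s : ℂ, v = r • b 0 + s • b 1 := by
  rw [F.1.2.1.mem_iff_exists_sum (w := fun i => b (Fin.castLE (by norm_num : 2 ≤ 4) i))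
    (hbd.li.comp _ (Fin.castLE_injective (by norm_num))) (by
      intro i
      fin_cases i
      exacts [F.2.1 hF.line, hF.plane])]
  constructor
  · rintro ⟨c, rfl⟩
    exact ⟨c 0, c 1, Fin.sum_univ_two _⟩
  · rintro ⟨r, s, rfl⟩
    exact ⟨![r, s], Fin.sum_univ_two _⟩

theorem IsAdapted.mem_hyperplane_iff (hF : IsAdapted b F) (hbd : IsDualPair b d) {v : C4} :
    v ∈ F.1.2.2.1 ↔ ∃ r s t : ℂ, v = r • b 0 + s • b 1 + t • b 2 :=
  _root_.mem_hyperplane_iff hbd (F.2.2 (F.2.1 hF.line)) (F.2.2 hF.plane) hF.hyperplane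

theorem annihilator_plane (hbd : IsDualPair b d) (hF : IsAdapted b F) {j : Fin 4} (h0 : j ≠ 0)
    (h1 : j ≠ 1) : d j ∈ F.1.2.1.1.dualAnnihilator := by
  rw [Submodule.mem_dualAnnihilator]
  intro v hv
  obtain ⟨r, s, rfl⟩ := (mem_plane_iff hbd hF).1 hv
  simp [hbd.apply, h0, h1]

/-- The algebra of the matrices that map `ℂ⁴` to the plane of the flag, the plane to zero, and the
hyperplane to the line. -/
def flagSubmodule (F : Flags4) : Submodule ℂ sl4 := nilAlgebra F.1.1.1 F.1.2.1.1 F.1.2.2.1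

theorem mem_flagSubmodule (hbd : IsDualPair b d) (hF : IsAdapted b F) (x : sl4) :
    x ∈ flagSubmodule F ↔ ∃ α β γ δ : ℂ,
      ∀ j, x.1.mulVec (b j) = ∑ k, normalForm O6 α β γ δ k j • b k := by
  constructor
  · intro hx
    obtain ⟨α, hα⟩ := (mem_line_iff hbd hF).1 (hx.2.2 _ hF.hyperplane)
    obtain ⟨β, γ, hβ⟩ := (mem_plane_iff hbd hF).1 (hx.1 (b 3))
    refine ⟨α, β, γ, 0, fun j => ?_⟩
    fin_cases j <;> simp [normalForm, Fin.sum_univ_four, hx.2.1 _ (F.2.1 hF.line),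
      hx.2.1 _ hF.plane, hα, hβ]
  · rintro ⟨α, β, γ, δ, h⟩
    have e0 : x.1.mulVec (b 0) = 0 := by simpa [normalForm, Fin.sum_univ_four] using h 0
    have e1 : x.1.mulVec (b 1) = 0 := by simpa [normalForm, Fin.sum_univ_four] using h 1
    have e2 : x.1.mulVec (b 2) = α • b 0 := by
      simpa [normalForm, Fin.sum_univ_four] using h 2
    have e3 : x.1.mulVec (b 3) = β • b 0 + γ • b 1 := by
      simpa [normalForm, Fin.sum_univ_four] using h 3
    refine ⟨fun v => ?_, fun v hv => ?_, fun v hv => ?_⟩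
    · rw [hbd.mulVec_eq, e0, e1, e2, e3]
      exact (mem_plane_iff hbd hF).2 ⟨d 2 v * α + d 3 v * β, d 3 v * γ, by module⟩
    · obtain ⟨r, s, rfl⟩ := (mem_plane_iff hbd hF).1 hv
      simp [Matrix.mulVec_add, Matrix.mulVec_smul, e0, e1]
    · obtain ⟨r, s, t, rfl⟩ := (hF.mem_hyperplane_iff hbd).1 hv
      refine (mem_line_iff hbd hF).2 ⟨t * α, ?_⟩
      simp [Matrix.mulVec_add, Matrix.mulVec_smul, e0, e1, e2, smul_smul]

theorem exists_mulVec_eq_of_mem_flagSubmodule (hbd : IsDualPair b d) (hF : IsAdapted b F) {x : sl4}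
    (hx : x ∈ flagSubmodule F) : ∃ α β γ : ℂ, ∀ v,
      x.1.mulVec v = (d 2 v * α + d 3 v * β) • b 0 + (d 3 v * γ) • b 1 := by
  obtain ⟨α, β, γ, δ, h⟩ := (mem_flagSubmodule hbd hF x).1 hx
  have e0 : x.1.mulVec (b 0) = 0 := by simpa [normalForm, Fin.sum_univ_four] using h 0
  have e1 : x.1.mulVec (b 1) = 0 := by simpa [normalForm, Fin.sum_univ_four] using h 1
  have e2 : x.1.mulVec (b 2) = α • b 0 := by
    simpa [normalForm, Fin.sum_univ_four] using h 2
  have e3 : x.1.mulVec (b 3) = β • b 0 + γ • b 1 := by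
    simpa [normalForm, Fin.sum_univ_four] using h 3
  refine ⟨α, β, γ, fun v => ?_⟩
  rw [hbd.mulVec_eq, e0, e1, e2, e3]
  module

theorem exists_smul_eq_flagSubmodule (F : Flags4) : ∃ g : GL (Fin 4) ℂ,
    (Matrix.ProjGenLinGroup.mk g • normalAlgebra O6).1 = flagSubmodule F := by
  obtain ⟨b, hb, hF⟩ := exists_isAdapted F
  obtain ⟨d, hbd⟩ := exists_isDualPair hb
  exact exists_smul_eq_of_mem_iff hb (mem_flagSubmodule hbd hF)

/-- `flagSubmodule` as a point of the Grassmannian. -/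
def flagAlgebra (F : Flags4) : Grass 3 sl4 :=
  ⟨flagSubmodule F, by
    obtain ⟨g, hg⟩ := exists_smul_eq_flagSubmodule F
    rw [← hg]
    exact (Matrix.ProjGenLinGroup.mk g • normalAlgebra O6).2⟩

theorem hasSections_flagAlgebra :
    HasSections (fun F : Flags4 => (F : Grass 1 C4 × Grass 2 C4 × Grass 3 C4)) flagAlgebra := by
  intro F
  obtain ⟨b, hb, hF⟩ := exists_isAdapted F
  obtain ⟨d, hbd⟩ := exists_isDualPair hb
  have hli : ∀ {k : ℕ} (hk : k ≤ 4), LinearIndependent ℂ fun i : Fin k => b (Fin.castLE hk i) :=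
    fun hk => hb.comp _ (Fin.castLE_injective _)
  obtain ⟨v, hv, hv0⟩ := exists_section_eq (hli (by norm_num : 1 ≤ 4)) 0
  obtain ⟨u, hu, hu0⟩ := exists_section_eq (hli (by norm_num : 2 ≤ 4)) 1
  obtain ⟨ψ, hψ, hψ0⟩ := exists_annihilator_section_eq (hli (by norm_num : 2 ≤ 4)) (d 2) fun i => by
    rw [hbd.apply, if_neg]
    fin_cases i <;> decide
  obtain ⟨φ, hφ, hφ0⟩ := exists_annihilator_section_eq (hli (by norm_num : 3 ≤ 4)) (d 3) fun i => by
    rw [hbd.apply, if_neg]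
    fin_cases i <;> decide
  have hv' := IsSection.fst (M := fun F : Flags4 => F.1) (hv.comp fun F : Flags4 => F.1.1)
  have hu' := IsSection.snd (M := fun F : Flags4 => F.1)
    (IsSection.fst (M := fun F : Flags4 => F.1.2) (hu.comp fun F : Flags4 => F.1.2.1))
  have hψ' := IsSection.snd (M := fun F : Flags4 => F.1)
    (IsSection.fst (M := fun F : Flags4 => F.1.2) (hψ.comp fun F : Flags4 => F.1.2.1))
  have hφ' := IsSection.snd (M := fun F : Flags4 => F.1)
    (IsSection.snd (M := fun F : Flags4 => F.1.2) (hφ.comp fun F : Flags4 => F.1.2.2))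
  have hanti : ∀ G : Flags4, ∀ θ ∈ G.1.2.2.1.dualAnnihilator, θ ∈ G.1.2.1.1.dualAnnihilator :=
    fun G θ hθ => Submodule.dualAnnihilator_anti G.2.2 hθ
  have h1 := hv'.rankOne hφ' (R := flagSubmodule) fun G w hw θ hθ =>
    rankOne_mem_nilAlgebra (G.2.1 hw) (hanti G θ hθ) (.inl hw)
  have h2 := hv'.rankOne hψ' (R := flagSubmodule) fun G w hw θ hθ =>
    rankOne_mem_nilAlgebra (G.2.1 hw) hθ (.inl hw)
  have h3 := hu'.rankOne hφ' (R := flagSubmodule) fun G w hw θ hθ =>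
    rankOne_mem_nilAlgebra hw (hanti G θ hθ) (.inr hθ)
  refine ⟨![fun p => rankOne (v (p ∘ Sum.inl)) (φ ((p ∘ Sum.inr) ∘ Sum.inr)),
      fun p => rankOne (v (p ∘ Sum.inl)) (ψ ((p ∘ Sum.inr) ∘ Sum.inl)),
      fun p => rankOne (u ((p ∘ Sum.inr) ∘ Sum.inl)) (φ ((p ∘ Sum.inr) ∘ Sum.inr))],
    fun j => ?_, Sum.elim (fun ω => ω _) (Sum.elim (fun ω => ω _) fun ω => ω _),
    ⟨mem_coords_of_linearIndependent (hli (by norm_num : 1 ≤ 4)) fun i => ?_,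
      mem_coords_of_linearIndependent (hli (by norm_num : 2 ≤ 4)) fun i => ?_,
      mem_coords_of_linearIndependent (hli (by norm_num : 3 ≤ 4)) fun i => ?_⟩, ?_⟩
  · fin_cases j
    exacts [h1, h2, h3]
  · fin_cases i
    exact hF.line
  · fin_cases i
    exacts [F.2.1 hF.line, hF.plane]
  · fin_cases i
    exacts [F.2.2 (F.2.1 hF.line), F.2.2 hF.plane, hF.hyperplane]
  · have h4 := hbd.linearIndependent_rankOne (i := ![0, 0, 1]) (j := ![3, 2, 3])
      (by decide) (by decide)
    convert h4 using 1
    funext j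
    fin_cases j
    · exact congrArg₂ rankOne hv0 hφ0
    · exact congrArg₂ rankOne hv0 hψ0
    · exact congrArg₂ rankOne hu0 hφ0

/-- Bases of the algebra of a flag by matrices of rank one, and their Plücker coordinates. -/
theorem linearIndependent_rankOne_flag (hbd : IsDualPair b d) {i j : Fin 3 → Fin 4}
    (hij : ∀ k, i k ≠ j k) (hinj : ∀ k l, i k = i l → j k = j l → k = l) (hF : IsAdapted b F)
    (h : ∀ k, (i k = 0 ∧ j k = 2) ∨ (i k = 0 ∧ j k = 3) ∨ (i k = 1 ∧ j k = 3)) :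
    LinearIndependent ℂ (fun k => rankOne (b (i k)) (d (j k))) ∧
      (fun ω => ω fun k => rankOne (b (i k)) (d (j k))) ∈ coords (flagAlgebra F) := by
  have hli := hbd.linearIndependent_rankOne hij hinj
  have h3 := annihilator_hyperplane hbd (F.2.2 (F.2.1 hF.line)) (F.2.2 hF.plane) hF.hyperplane
  refine ⟨hli, mem_coords_of_linearIndependent hli fun k => ?_⟩
  rcases h k with ⟨hi, hj⟩ | ⟨hi, hj⟩ | ⟨hi, hj⟩ <;> rw [hi, hj]
  · exact rankOne_mem_nilAlgebra (F.2.1 hF.line)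
      (annihilator_plane hbd hF (by decide) (by decide)) (.inl hF.line)
  · exact rankOne_mem_nilAlgebra (F.2.1 hF.line)
      (annihilator_plane hbd hF (by decide) (by decide)) (.inl hF.line)
  · exact rankOne_mem_nilAlgebra hF.plane
      (annihilator_plane hbd hF (by decide) (by decide)) (.inr h3)

/-- The plane of a flag is spanned by the values of the elements of the algebra at a vector outside
the hyperplane. -/
theorem hasSections_plane : HasSections flagAlgebra fun F => F.1.2.1 := by
  intro F
  obtain ⟨b, hb, hF⟩ := exists_isAdapted F
  obtain ⟨d, hbd⟩ := exists_isDualPair hb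
  obtain ⟨hli, hcoords⟩ := linearIndependent_rankOne_flag hbd (i := ![0, 1, 0]) (j := ![3, 3, 2])
    (by decide) (by decide) hF (by decide)
  choose s hs hs0 using exists_section_eq hli
  refine ⟨fun j p => applyAt (b 3) (s (Fin.castSucc j) p),
    fun j => ((hs (Fin.castSucc j)).comp flagAlgebra).map _ fun G x hx => hx.1 _, _, hcoords, ?_⟩
  simp only [hs0]
  have h1 : (fun j : Fin 2 => applyAt (b 3) (rankOne (b (![0, 1, 0] (Fin.castSucc j)))
      (d (![3, 3, 2] (Fin.castSucc j))))) = fun j => b (Fin.castLE (by norm_num : 2 ≤ 4) j) := by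
    funext j
    fin_cases j
    · exact applyAt_rankOne hbd (i := 0) (j := 3) (by decide)
    · exact applyAt_rankOne hbd (i := 1) (j := 3) (by decide)
  rw [h1]
  exact hb.comp _ (Fin.castLE_injective (by norm_num : 2 ≤ 4))

theorem adjugate_two_apply (A : Matrix (Fin 3) (Fin 3) ℂ) :
    A.adjugate 2 0 = A 1 0 * A 2 1 - A 1 1 * A 2 0 ∧
      A.adjugate 2 1 = A 0 1 * A 2 0 - A 0 0 * A 2 1 ∧
      A.adjugate 2 2 = A 0 0 * A 1 1 - A 0 1 * A 1 0 := by
  rw [Matrix.adjugate_fin_three]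
  constructor
  · simp
  · constructor <;> simp <;> ring

/-- The last row of the adjugate is orthogonal to the first two columns of `A`, hence to the vectors
`y` and `z` if these columns are combinations of them with nonzero determinant; if the determinant is
zero, the row vanishes. -/
theorem sum_adjugate_mul_eq_zero {A : Matrix (Fin 3) (Fin 3) ℂ} {y z : Fin 3 → ℂ}
    {p q r s : ℂ} (h0 : ∀ j, A j 0 = p * y j + q * z j) (h1 : ∀ j, A j 1 = r * y j + s * z j) :
    ∑ j, A.adjugate 2 j * z j = 0 := by
  obtain ⟨e0, e1, e2⟩ := adjugate_two_apply A
  rw [Fin.sum_univ_three, e0, e1, e2]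
  simp only [h0, h1]
  ring

theorem isSection_cramerVector_flagAlgebra (L : sl4 →ₗ[ℂ] Fin 3 → ℂ) {R : Flags4 → Submodule ℂ sl4}
    (h : ∀ G, ∀ u : Fin 3 → sl4, (∀ j, u j ∈ flagSubmodule G) →
      ∑ j, (Matrix.of fun j => L (u j)).adjugate 2 j • u j ∈ R G) :
    IsSection flagAlgebra R (cramerVector L 2) where
  poly := (isSection_cramerVector L 2).poly
  scale G := (isSection_cramerVector L 2).scale (flagAlgebra G)
  mem G p hp := by
    obtain ⟨u, -, hW, hpu⟩ := hp
    rw [show p = fun ω => ω u from funext hpu, cramerVector_eq]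
    refine h G u fun j => ?_
    have h1 : u j ∈ Submodule.span ℂ (Set.range u) := Submodule.subset_span ⟨j, rfl⟩
    rw [hW] at h1
    exact h1

theorem cramerVector_two_eq (L : sl4 →ₗ[ℂ] Fin 3 → ℂ) {w : Fin 3 → sl4}
    (h0 : L (w 0) 0 = 1 ∧ L (w 0) 1 = 0) (h1 : L (w 1) 0 = 0 ∧ L (w 1) 1 = 1)
    (h2 : L (w 2) 0 = 0 ∧ L (w 2) 1 = 0) : cramerVector L 2 (fun ω => ω w) = w 2 := by
  obtain ⟨e0, e1, e2⟩ := adjugate_two_apply (Matrix.of fun j => L (w j))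
  rw [cramerVector_eq, Fin.sum_univ_three, e0, e1, e2]
  simp [h0, h1, h2]

theorem sum_smul_mulVec {c : Fin 3 → ℂ} {u : Fin 3 → sl4} {e e' : C4} {α β γ : Fin 3 → ℂ} {k l : ℂ}
    {v : C4} (h : ∀ j, (u j).1.mulVec v = (k * α j + l * β j) • e + (l * γ j) • e') :
    (∑ j, c j • u j).1.mulVec v =
      (k * ∑ j, c j * α j + l * ∑ j, c j * β j) • e + (l * ∑ j, c j * γ j) • e' := by
  have h1 : applyAt v (∑ j, c j • u j) = ∑ j, c j • applyAt v (u j) := by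
    rw [map_sum]
    exact Finset.sum_congr rfl fun j _ => map_smul _ _ _
  have h2 : ∀ j, applyAt v (u j) = (k * α j + l * β j) • e + (l * γ j) • e' := h
  change applyAt v (∑ j, c j • u j) = _
  rw [h1]
  simp only [h2, Fin.sum_univ_three]
  module

/-- The functionals `f (x t)` and `f' (x t)` of `x`, completed by zero. -/
def pairFunctional (f f' : Module.Dual ℂ C4) (t t' : C4) : sl4 →ₗ[ℂ] Fin 3 → ℂ :=
  LinearMap.pi ![f ∘ₗ applyAt t, f' ∘ₗ applyAt t', 0]

/-- Modulo matrices with image in the line of the flag, the vector `x t` is determined up to a factor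
that does not depend on `x`. Hence the combination that Cramer's rule forms from the values of two
functionals at `x t` has its image in the line. -/
theorem isSection_image_line (f f' : Module.Dual ℂ C4) (t : C4) :
    IsSection flagAlgebra (fun G => nilAlgebra G.1.1.1 G.1.2.1.1 ⊤)
      (cramerVector (pairFunctional f f' t t) 2) := by
  refine isSection_cramerVector_flagAlgebra _ fun G u hu => ?_
  obtain ⟨b, hb, hG⟩ := exists_isAdapted G
  obtain ⟨d, hbd⟩ := exists_isDualPair hb
  choose α β γ h using fun j => exists_mulVec_eq_of_mem_flagSubmodule hbd hG (hu j)
  have hmem : ∑ j, (Matrix.of fun j => pairFunctional f f' t t (u j)).adjugate 2 j • u j ∈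
      flagSubmodule G := sum_mem fun j _ => Submodule.smul_mem _ _ (hu j)
  have hval : ∀ (g : Module.Dual ℂ C4) j, g ((u j).1.mulVec t) =
      g (b 0) * (d 2 t * α j + d 3 t * β j) + (d 3 t * g (b 1)) * γ j := fun g j => by
    rw [h, map_add, map_smul, map_smul, smul_eq_mul, smul_eq_mul]
    ring
  refine ⟨hmem.1, hmem.2.1, fun v _ => ?_⟩
  rw [sum_smul_mulVec fun j => h j v, sum_adjugate_mul_eq_zero (z := γ) (hval f) (hval f'),
    mul_zero, zero_smul, add_zero]
  exact Submodule.smul_mem _ _ hG.line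

/-- The counterpart of `isSection_image_line` for the transposed matrices. -/
theorem isSection_kernel_hyperplane (f : Module.Dual ℂ C4) (t t' : C4) :
    IsSection flagAlgebra (fun G => nilAlgebra ⊥ G.1.2.1.1 G.1.2.2.1)
      (cramerVector (pairFunctional f f t t') 2) := by
  refine isSection_cramerVector_flagAlgebra _ fun G u hu => ?_
  obtain ⟨b, hb, hG⟩ := exists_isAdapted G
  obtain ⟨d, hbd⟩ := exists_isDualPair hb
  choose α β γ h using fun j => exists_mulVec_eq_of_mem_flagSubmodule hbd hG (hu j)
  have hmem : ∑ j, (Matrix.of fun j => pairFunctional f f t t' (u j)).adjugate 2 j • u j ∈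
      flagSubmodule G := sum_mem fun j _ => Submodule.smul_mem _ _ (hu j)
  have hval : ∀ s j, f ((u j).1.mulVec s) =
      d 3 s * (f (b 0) * β j + f (b 1) * γ j) + (d 2 s * f (b 0)) * α j := fun s j => by
    rw [h, map_add, map_smul, map_smul, smul_eq_mul, smul_eq_mul]
    ring
  refine ⟨hmem.1, hmem.2.1, fun v hv => ?_⟩
  have h3 : d 3 v = 0 := (Submodule.mem_dualAnnihilator _).1 (annihilator_hyperplane hbd
    (G.2.2 (G.2.1 hG.line)) (G.2.2 hG.plane) hG.hyperplane) v hv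
  rw [sum_smul_mulVec fun j => h j v, sum_adjugate_mul_eq_zero (z := α) (hval t) (hval t'), h3]
  simp

theorem IsDualPair.apply_applyAt_rankOne (hbd : IsDualPair b d) {i j k l : Fin 4} (hij : i ≠ j) :
    d k (applyAt (b l) (rankOne (b i) (d j))) = if j = l ∧ k = i then 1 else 0 := by
  change d k ((rankOne (b i) (d j)).1.mulVec (b l)) = _
  rw [rankOne_mulVec (by rw [hbd.apply, if_neg hij.symm]), map_smul, hbd.apply, hbd.apply,
    smul_eq_mul]
  by_cases h1 : j = l <;> by_cases h2 : k = i <;> simp [h1, h2]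

theorem hasSections_flagLine : HasSections flagAlgebra fun F => F.1.1 := by
  intro F
  obtain ⟨b, hb, hF⟩ := exists_isAdapted F
  obtain ⟨d, hbd⟩ := exists_isDualPair hb
  obtain ⟨-, hcoords⟩ := linearIndependent_rankOne_flag hbd (i := ![0, 1, 0]) (j := ![3, 3, 2])
    (by decide) (by decide) hF (by decide)
  refine ⟨fun _ p => applyAt (b 2) (cramerVector (pairFunctional (d 0) (d 1) (b 3) (b 3)) 2 p),
    fun _ => (isSection_image_line _ _ _).map _ fun G x hx => hx.2.2 _ trivial, _, hcoords, ?_⟩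
  have hval := fun i j k l hij => hbd.apply_applyAt_rankOne (i := i) (j := j) (k := k) (l := l) hij
  beta_reduce
  rw [cramerVector_two_eq]
  · refine LinearIndependent.of_subsingleton (ι := Fin 1) 0 ?_
    exact ne_of_eq_of_ne (applyAt_rankOne hbd (i := 0) (j := 2) (by decide)) (hb.ne_zero 0)
  · exact ⟨(hval 0 3 0 3 (by decide)).trans (by simp), (hval 0 3 1 3 (by decide)).trans (by simp)⟩
  · exact ⟨(hval 1 3 0 3 (by decide)).trans (by simp), (hval 1 3 1 3 (by decide)).trans (by simp)⟩
  · exact ⟨(hval 0 2 0 3 (by decide)).trans (by simp), (hval 0 2 1 3 (by decide)).trans (by simp)⟩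

/-- The linear map `x ↦ f ∘ x`. -/
def compFunctional (f : Module.Dual ℂ C4) : sl4 →ₗ[ℂ] Module.Dual ℂ C4 where
  toFun x := f ∘ₗ Matrix.mulVecLin x.1
  map_add' x y := LinearMap.ext fun v => by
    change f ((x + y).1.mulVec v) = f (x.1.mulVec v) + f (y.1.mulVec v)
    rw [← map_add, ← Matrix.add_mulVec]; rfl
  map_smul' c x := LinearMap.ext fun v => by
    change f ((c • x).1.mulVec v) = c • f (x.1.mulVec v)
    rw [← map_smul, ← Matrix.smul_mulVec]; rfl

/-- The linear map `θ ↦ θ(v) u - θ(u) v`, with values in the kernel of `θ`. -/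
def kernelVector (u v : C4) : Module.Dual ℂ C4 →ₗ[ℂ] C4 where
  toFun θ := θ v • u - θ u • v
  map_add' θ η := by
    rw [LinearMap.add_apply, LinearMap.add_apply]
    module
  map_smul' c θ := by
    rw [LinearMap.smul_apply, LinearMap.smul_apply, RingHom.id_apply, smul_eq_mul, smul_eq_mul]
    module

theorem kernelVector_mem {H : Grass 3 C4} {θ : Module.Dual ℂ C4} (hθ : θ ∈ H.1.dualAnnihilator)
    (u v : C4) : kernelVector u v θ ∈ H.1 := by
  obtain ⟨b, hb, h⟩ := exists_adapted_basis (by norm_num) H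
  obtain ⟨d, hbd⟩ := exists_isDualPair hb
  have hθ' := (Submodule.mem_dualAnnihilator _).1 hθ
  have h0 : b 0 ∈ H.1 := h 0
  have h1 : b 1 ∈ H.1 := h 1
  have h2 : b 2 ∈ H.1 := h 2
  have h4 : ∀ w, θ w = d 3 w * θ (b 3) := fun w => by
    conv_lhs => rw [hbd.sum w]
    simp [hθ' _ h0, hθ' _ h1, hθ' _ h2]
  have h5 : d 3 (kernelVector u v θ) = 0 := by
    change d 3 (θ v • u - θ u • v) = 0
    rw [map_sub, map_smul, map_smul, h4 u, h4 v, smul_eq_mul, smul_eq_mul]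
    ring
  rw [hbd.sum (kernelVector u v θ), h5, zero_smul, add_zero]
  exact (mem_hyperplane_iff hbd h0 h1 h2).2 ⟨_, _, _, rfl⟩

theorem hasSections_flagHyperplane : HasSections flagAlgebra fun F => F.1.2.2 := by
  intro F
  obtain ⟨b, hb, hF⟩ := exists_isAdapted F
  obtain ⟨d, hbd⟩ := exists_isDualPair hb
  obtain ⟨-, hcoords⟩ := linearIndependent_rankOne_flag hbd (i := ![0, 0, 1]) (j := ![2, 3, 3])
    (by decide) (by decide) hF (by decide)
  have hψ : IsSection flagAlgebra (fun G => G.1.2.2.1.dualAnnihilator) fun p =>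
      compFunctional (d 1) (cramerVector (pairFunctional (d 0) (d 0) (b 2) (b 3)) 2 p) :=
    (isSection_kernel_hyperplane _ _ _).map _ fun G x hx =>
      (Submodule.mem_dualAnnihilator _).2 fun v hv => by
        change d 1 (x.1.mulVec v) = 0
        rw [(Submodule.mem_bot ℂ).1 (hx.2.2 v hv), map_zero]
  refine ⟨fun k p => kernelVector (b (Fin.castLE (by norm_num : 3 ≤ 4) k)) (b 3) (compFunctional (d 1)
    (cramerVector (pairFunctional (d 0) (d 0) (b 2) (b 3)) 2 p)),
    fun k => hψ.map _ fun G θ hθ => kernelVector_mem hθ _ _, _, hcoords, ?_⟩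
  have hval := fun i j k l hij => hbd.apply_applyAt_rankOne (i := i) (j := j) (k := k) (l := l) hij
  beta_reduce
  rw [cramerVector_two_eq]
  · have h1 : ∀ k, kernelVector (b (Fin.castLE (by norm_num : 3 ≤ 4) k)) (b 3)
        (compFunctional (d 1) (rankOne (b 1) (d 3))) = b (Fin.castLE (by norm_num : 3 ≤ 4) k) :=
      fun k => by
        change d 1 (applyAt (b 3) (rankOne (b 1) (d 3))) • b (Fin.castLE _ k) -
          d 1 (applyAt (b (Fin.castLE _ k)) (rankOne (b 1) (d 3))) • b 3 = _
        have h2 : (3 : Fin 4) ≠ Fin.castLE (by norm_num : 3 ≤ 4) k := by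
          fin_cases k <;> decide
        rw [hval 1 3 1 3 (by decide), hval 1 3 1 _ (by decide), if_pos ⟨rfl, rfl⟩,
          if_neg fun h => h2 h.1, one_smul, zero_smul, sub_zero]
    have h2 := hb.comp _ (Fin.castLE_injective (by norm_num : 3 ≤ 4))
    change LinearIndependent ℂ fun k => kernelVector (b (Fin.castLE (by norm_num : 3 ≤ 4) k)) (b 3)
      (compFunctional (d 1) (rankOne (b 1) (d 3)))
    simp only [h1]
    exact h2
  · exact ⟨(hval 0 2 0 2 (by decide)).trans (by simp), (hval 0 2 0 3 (by decide)).trans (by simp)⟩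
  · exact ⟨(hval 0 3 0 2 (by decide)).trans (by simp), (hval 0 3 0 3 (by decide)).trans (by simp)⟩
  · exact ⟨(hval 1 3 0 2 (by decide)).trans (by simp), (hval 1 3 0 3 (by decide)).trans (by simp)⟩

/-- The closed orbit of dimension six. -/
theorem equivariantlyIsomorphic_flag : EquivariantlyIsomorphic PGL(Fin 4, ℂ) Flags4
    (MulAction.orbit PGL(Fin 4, ℂ) (normalAlgebra O6)) := by
  refine equivariantlyIsomorphic_of_hasSections flagAlgebra (fun F => ?_) ?_ (fun F F' h => ?_)
    hasSections_flagAlgebra (fun a ha => ?_) fun g F F' h => ?_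
  · obtain ⟨g, hg⟩ := exists_smul_eq_flagSubmodule F
    exact ⟨_, Subtype.ext hg⟩
  · rintro _ ⟨g, rfl⟩
    induction g using pgl_induction with | h g => ?_
    have hb := linearIndependent_transpose g
    obtain ⟨d, hbd⟩ := exists_isDualPair hb
    refine ⟨⟨(spanFirst _ hb 1 (by norm_num), spanFirst _ hb 2 (by norm_num),
      spanFirst _ hb 3 (by norm_num)), Submodule.span_mono ?_, Submodule.span_mono ?_⟩,
      Subtype.ext (Submodule.ext fun x => ?_)⟩
    · rintro _ ⟨i, rfl⟩
      exact ⟨Fin.castLE (by norm_num) i, rfl⟩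
    · rintro _ ⟨i, rfl⟩
      exact ⟨Fin.castLE (by norm_num) i, rfl⟩
    rw [mem_mk_smul_normalAlgebra_iff]
    exact mem_flagSubmodule hbd ⟨mem_spanFirst (hb := hb) (hk := by norm_num) (0 : Fin 1),
      mem_spanFirst (hb := hb) (hk := by norm_num) (1 : Fin 2),
      mem_spanFirst (hb := hb) (hk := by norm_num) (2 : Fin 3)⟩ x
  · exact Subtype.ext (Prod.ext (hasSections_flagLine.eq_of_eq h)
      (Prod.ext (hasSections_plane.eq_of_eq h) (hasSections_flagHyperplane.eq_of_eq h)))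
  · exact (hasSections_flagLine.isBasicRegular a ha).prodMk
      ((hasSections_plane.isBasicRegular a ha).prodMk
        (hasSections_flagHyperplane.isBasicRegular a ha))
  · refine Grass.eq_of_le ?_
    rintro _ ⟨x, hx, rfl⟩
    have h1 := conjLinearMap_mem_nilAlgebra g hx
    have e1 : F'.1.1.1 = F.1.1.1.map (standardRep g : C4 →ₗ[ℂ] C4) :=
      congrArg (fun G => G.1.1) h.symm
    have e2 : F'.1.2.1.1 = F.1.2.1.1.map (standardRep g : C4 →ₗ[ℂ] C4) :=
      congrArg (fun G => G.2.1.1) h.symm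
    have e3 : F'.1.2.2.1 = F.1.2.2.1.map (standardRep g : C4 →ₗ[ℂ] C4) :=
      congrArg (fun G => G.2.2.1) h.symm
    rw [← e1, ← e2, ← e3] at h1
    exact h1

end Flags

/-! ### Abelian algebras of dimension three -/

theorem proposition18 :
    Ab4 = Red4 ∧
    ∃ A : OrbitType → Grass 3 sl4,
      (∀ (o : OrbitType) (x : sl4), x ∈ (A o).1 ↔
        ∃ a b c d : ℂ, (x : Matrix (Fin 4) (Fin 4) ℂ) = normalForm o a b c d) ∧
      Red4 = ⋃ o : OrbitType, MulAction.orbit PGL(Fin 4, ℂ) (A o) ∧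
      Function.Injective (fun o : OrbitType => MulAction.orbit PGL(Fin 4, ℂ) (A o)) ∧
      {O : Set (Grass 3 sl4) | ∃ W ∈ Red4, O = MulAction.orbit PGL(Fin 4, ℂ) W}.ncard = 14 ∧
      (∀ o o' : OrbitType,
        MulAction.orbit PGL(Fin 4, ℂ) (A o') ⊆ zariskiClosure (MulAction.orbit PGL(Fin 4, ℂ) (A o)) ↔
          Relation.ReflTransGen Arrow o o') ∧
      (∀ o : OrbitType, IsZariskiClosed (MulAction.orbit PGL(Fin 4, ℂ) (A o)) ↔
        o = OrbitType.O3' ∨ o = OrbitType.O3'' ∨ o = OrbitType.O6) ∧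
      EquivariantlyIsomorphic PGL(Fin 4, ℂ) P3 (MulAction.orbit PGL(Fin 4, ℂ) (A OrbitType.O3')) ∧
      EquivariantlyIsomorphic PGL(Fin 4, ℂ) P3Dual
        (MulAction.orbit PGL(Fin 4, ℂ) (A OrbitType.O3'')) ∧
      EquivariantlyIsomorphic PGL(Fin 4, ℂ) Flags4
        (MulAction.orbit PGL(Fin 4, ℂ) (A OrbitType.O6)) := by
  exact ⟨ab4_eq_red4, normalAlgebra, fun o x => mem_normalAlgebra, red4_eq_iUnion_orbit,
    orbit_normalAlgebra_injective, ncard_orbits, fun o o' => orbit_subset_closure_iff,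
    fun o => isZariskiClosed_orbit_iff.trans forall_not_arrow_iff,
    equivariantlyIsomorphic_line, equivariantlyIsomorphic_hyperplane,
    equivariantlyIsomorphic_flag⟩

end
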